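/- **Proposition (Trace formula).** Let $F$ be a nondiscrete nonarchimedean locally compact field, let $\mathcal G$ be a semisimple linear algebraic group over $F$, and let $G=\mathcal G(F)$, with its locally compact topology and a Haar measure $dx$. Let $\Gamma\subset G$ be a discrete subgroup such that $\Gamma\backslash G$ is compact, and let $(\omega,V_\omega)$ be a finite dimensional unitary representation of $\Gamma$. Let $L^2(\Gamma\backslash G,\omega)$ be the Hilbert space of measurable functions $\varphi:G\to V_\omega$ with $\varphi(\gamma x)=\omega(\gamma)\varphi(x)$ for $\gamma\in\Gamma$, $x\in G$, and $\int_{\Gamma\backslash G}\|\varphi\|^2<\infty$, modulo null functions, on which $G$ acts by $(R(g)\varphi)(x)=\varphi(xg)$. Let $\hat G$ be the set of equivalence classes of irreducible unitary representations of $G$, and for $\pi\in\hat G$ let $N_{\Gamma,\omega}(\pi)=\dim \mathrm{Hom}_G(\pi,L^2(\Gamma\backslash G,\omega))$ (continuous $G$-equivariant linear maps) be the multiplicity of $\pi$. For each $\gamma\in\Gamma$ fix a Haar measure on its centralizer $G_\gamma$ in $G$, let $\Gamma_\gamma=\Gamma\cap G_\gamma$ be its centralizer in $\Gamma$, and give $\Gamma\backslash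 G$, $\Gamma_\gamma\backslash G_\gamma$ and $G_\gamma\backslash G$ the quotient measures, where $\Gamma$ and $\Gamma_\gamma$ carry the counting measure. Let $f:G\to\mathbb C$ be integrable and uniformly locally constant, i.e. there is a compact open subgroup $U$ of $G$ such that $f$ factors over $U\backslash G/U$ (compact support is not assumed). Put $\pi(f)=\int_G f(x)\pi(x)\,dx$ and $\mathcal O_\gamma(f)=\int_{G_\gamma\backslash G}f(x^{-1}\gamma x)\,dx$. Then: 1. $N_{\Gamma,\omega}(\pi)<\infty$ for every $\pi\in\hat G$, and $\pi(f)$ has finite rank whenever $N_{\Gamma,\omega}(\pi)\neq 0$. Moreover $N_{\Gamma,\omega}(\pi)\,\mathrm{tr}\,\pi(f)\ne 0$ for only finitely many $\pi\in\hat G$. (If $N_{\Gamma,\omega}(\pi)=0$, this product is read as $0$.) 2. For every $\gamma\in\Gamma$ the volume $\mathrm{vol}(\Gamma_\gamma\backslash G_\gamma)$ is finite and the integral $\mathcal O_\gamma(f)$ converges absolutely. 3. The sum on the right hand side below, over the $\Gamma$-conjugacy classes $[\gamma]$ in $\Gamma$, converges absolutely, and $$\sum_{\pi\in\hat G}N_{\Gamma,\omega}(\pi)\,\mathrm{tr}\,\pi(f)=\sum_{[\gamma]}\mathrm{tr}\,\omega(\gamma)\,\mathrm{vol}(\Gamma_\gamma\backslash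 G_\gamma)\,\mathcal O_\gamma(f).$$ -/

import Mathlib

open MeasureTheory
open scoped ENNReal MatrixGroups

noncomputable section

namespace TraceFormula

/-! ### Linear algebraic groups over a field, as subgroups of `GL_n` over the algebraic closure -/

section AlgebraicGroups

variable {n : ℕ} {K : Type*} [Field K]

/-- The matrix entries of an invertible matrix, as a point of affine `n × n`-space. -/
def coords (g : GL (Fin n) K) : Fin n × Fin n → K := fun ij => g.val ij.1 ij.2

/-- A subset of `GL_n(K)` is Zariski closed if it contains every element of `GL_n(K)` at which
all polynomials in the matrix entries vanishing on the subset vanish. (Powers of the inverse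
determinant can be cleared, so polynomials in the entries are enough.) -/
def IsZariskiClosed (S : Set (GL (Fin n) K)) : Prop :=
  ∀ g : GL (Fin n) K,
    coords g ∈ MvPolynomial.zeroLocus K (MvPolynomial.vanishingIdeal K (coords '' S)) → g ∈ S

/-- A (closed) subset of `GL_n(K)` is Zariski connected if it is not the union of two disjoint
nonempty closed subsets. -/
def IsZariskiConnected (S : Set (GL (Fin n) K)) : Prop :=
  ∀ A B : Set (GL (Fin n) K), IsZariskiClosed A → IsZariskiClosed B → A ∪ B = S →
    Disjoint A B → A = ∅ ∨ B = ∅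

/-- A subgroup of `GL_n` over the algebraic closure of `F` is a linear algebraic group over `F`
if it is Zariski closed and its ideal of vanishing polynomials is generated by polynomials with
coefficients in `F`. -/
structure IsLinearAlgebraicGroupOver (F : Type*) [Field F]
    (H : Subgroup (GL (Fin n) (AlgebraicClosure F))) : Prop where
  closed : IsZariskiClosed (H : Set (GL (Fin n) (AlgebraicClosure F)))
  defined_over :
    MvPolynomial.vanishingIdeal (AlgebraicClosure F)
        (coords '' (H : Set (GL (Fin n) (AlgebraicClosure F)))) =
      (MvPolynomial.vanishingIdeal F
        (coords '' (H : Set (GL (Fin n) (AlgebraicClosure F))))).map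
          (MvPolynomial.map (algebraMap F (AlgebraicClosure F)))

/-- A linear algebraic group (over an algebraically closed field) is semisimple if its radical is
trivial: every closed connected solvable normal subgroup is trivial. The group itself is not
required to be connected. -/
def IsSemisimple (H : Subgroup (GL (Fin n) K)) : Prop :=
  ∀ N : Subgroup (GL (Fin n) K), N ≤ H → (N.subgroupOf H).Normal → Group.IsSolvable N →
    IsZariskiClosed (N : Set (GL (Fin n) K)) → IsZariskiConnected (N : Set (GL (Fin n) K)) →
      N = ⊥

/-- The group of `F`-rational points, with the topology inherited from `GL_n(F)`. -/
abbrev rationalPoints (F : Type*) [Field F] (H : Subgroup (GL (Fin n) (AlgebraicClosure F))) :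
    Subgroup (GL (Fin n) F) :=
  H.comap (Matrix.GeneralLinearGroup.map (algebraMap F (AlgebraicClosure F)))

end AlgebraicGroups

/-! ### Quotients `H \ G` and their invariant measures -/

section Quotients

variable {G : Type*} [Group G]

/-- The space `H \ G` of cosets `H x`. -/
abbrev LeftQuot (H : Subgroup G) : Type _ := Quotient (MulAction.orbitRel H G)

lemma exists_out_eq (H : Subgroup G) (x : G) :
    ∃ h : H, (Quotient.mk (MulAction.orbitRel H G) x).out = h * x := by
  have h : (MulAction.orbitRel H G).r (Quotient.mk (MulAction.orbitRel H G) x).out x :=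
    Quotient.exact (Quotient.out_eq _)
  obtain ⟨h, hh⟩ := (MulAction.orbitRel_apply.mp h)
  exact ⟨h, hh.symm⟩

variable [MeasurableSpace G]

/-- `ν` is the quotient of the measure `μ` on `G` by the measure `η` on `H`:
`∫_G f dμ = ∫_{H \ G} ∫_H f(h x) dη(h) dν(H x)` for all measurable `f ≥ 0`. (For `η` right
invariant the inner integral does not depend on the choice of the representative of `H x`.) -/
def IsQuotientMeasure (H : Subgroup G) (μ : Measure G) (η : Measure H)
    (ν : Measure (LeftQuot H)) : Prop :=
  ∀ f : G → ℝ≥0∞, Measurable f →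
    ∫⁻ q, (∫⁻ h : H, f (h * q.out) ∂η) ∂ν = ∫⁻ x, f x ∂μ

open Classical in
/-- The invariant measure on `H \ G` determined by the Haar measures `μ` on `G` and `η` on `H`. -/
def quotientMeasure (H : Subgroup G) (μ : Measure G) (η : Measure H) : Measure (LeftQuot H) :=
  if h : ∃ ν, IsQuotientMeasure H μ η ν then h.choose else 0

end Quotients

/-! ### Functions on `G` and orbital integrals -/

section Functions

variable {G : Type*} [Group G]

/-- `f` factors over `U \ G / U` for some compact open subgroup `U`. -/
def UniformlyLocallyConstant [TopologicalSpace G] (f : G → ℂ) : Prop :=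
  ∃ U : Subgroup G, IsOpen (U : Set G) ∧ IsCompact (U : Set G) ∧
    ∀ u ∈ U, ∀ v ∈ U, ∀ x, f (u * x * v) = f x

/-- The function `x ↦ f(x⁻¹ g x)` on `G_g \ G`, with `G_g` the centralizer of `g`. -/
def orbitFunction (f : G → ℂ) (g : G) : LeftQuot (Subgroup.centralizer {g}) → ℂ :=
  Quotient.lift (fun x => f (x⁻¹ * g * x)) (by
    intro a b hab
    obtain ⟨h, rfl⟩ := MulAction.orbitRel_apply.mp hab
    have hc : g * (h : G) = h * g := Subgroup.mem_centralizer_singleton_iff.mp h.2 |>.symm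
    have : (h • b)⁻¹ * g * (h • b) = b⁻¹ * g * b := by
      rw [Subgroup.smul_def, smul_eq_mul, mul_inv_rev]
      calc b⁻¹ * (h : G)⁻¹ * g * (h * b) = b⁻¹ * (h : G)⁻¹ * (g * h) * b := by group
        _ = b⁻¹ * (h : G)⁻¹ * (h * g) * b := by rw [hc]
        _ = b⁻¹ * g * b := by group
    simp only [this])

variable [MeasurableSpace G]

/-- The orbital integral of `f` at `g`, with respect to the Haar measure `μ` on `G` and the
Haar measure `η` on the centralizer of `g`. -/
def orbitalIntegral (μ : Measure G) (g : G) (η : Measure (Subgroup.centralizer {g}))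
    (f : G → ℂ) : ℂ :=
  ∫ q, orbitFunction f g q ∂(quotientMeasure (Subgroup.centralizer {g}) μ η)

/-- The volume of `Γ_g \ G_g`, where `G_g` carries the Haar measure `η` and `Γ_g` the counting
measure. -/
def centralizerVolume (Γ : Subgroup G) (g : G) (η : Measure (Subgroup.centralizer {g})) : ℝ≥0∞ :=
  quotientMeasure (Γ.subgroupOf (Subgroup.centralizer {g})) η Measure.count Set.univ

end Functions

/-! ### The Hilbert space `L²(Γ \ G, ω)` -/

section L2

variable {G : Type*} [Group G]
  {V : Type*} [NormedAddCommGroup V] [InnerProductSpace ℂ V]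
  (Γ : Subgroup G) (ω : Γ →* (V ≃ₗᵢ[ℂ] V))

variable {Γ} in
/-- Functions `φ : G → V` with `φ(γ x) = ω(γ) φ(x)`. -/
def IsEquivariant (φ : G → V) : Prop := ∀ (γ : Γ) (x : G), φ (γ * x) = ω γ (φ x)

variable {Γ ω} in
lemma IsEquivariant.norm_out {φ : G → V} (hφ : IsEquivariant ω φ) (x : G) :
    ‖φ (Quotient.mk (MulAction.orbitRel Γ G) x).out‖ₑ = ‖φ x‖ₑ := by
  obtain ⟨h, hh⟩ := exists_out_eq Γ x
  rw [hh, hφ, ← ofReal_norm, ← ofReal_norm, LinearIsometryEquiv.norm_map]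

variable {Γ ω} in
lemma IsEquivariant.inner_out {φ ψ : G → V} (hφ : IsEquivariant ω φ) (hψ : IsEquivariant ω ψ)
    (x : G) :
    inner ℂ (φ (Quotient.mk (MulAction.orbitRel Γ G) x).out)
      (ψ (Quotient.mk (MulAction.orbitRel Γ G) x).out) = inner ℂ (φ x) (ψ x) := by
  obtain ⟨h, hh⟩ := exists_out_eq Γ x
  rw [hh, hφ, hψ, LinearIsometryEquiv.inner_map_map]

variable [MeasurableSpace G] (μ : Measure G)

/-- The measure on `Γ \ G`, where `Γ` carries the counting measure. -/
abbrev latticeMeasure : Measure (LeftQuot Γ) := quotientMeasure Γ μ Measure.count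

variable {Γ ω} in
lemma IsEquivariant.measurable_enorm_out {φ : G → V} (hφ : IsEquivariant ω φ)
    (hm : StronglyMeasurable φ) :
    Measurable (fun q : LeftQuot Γ => ‖φ q.out‖ₑ) := by
  refine measurable_from_quotient.mpr ?_
  have : (fun q : LeftQuot Γ => ‖φ q.out‖ₑ) ∘ Quotient.mk'' = fun x => ‖φ x‖ₑ :=
    funext fun x => hφ.norm_out x
  rw [this]
  exact hm.enorm

/-- The measurable functions `φ : G → V` with `φ(γ x) = ω(γ) φ(x)` for which `|φ|²` is
integrable over `Γ \ G`. -/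
def squareIntegrable : Submodule ℂ (G → V) where
  carrier := {φ | StronglyMeasurable φ ∧ IsEquivariant ω φ ∧
    ∫⁻ q, ‖φ q.out‖ₑ ^ 2 ∂(latticeMeasure Γ μ) < ∞}
  zero_mem' := ⟨stronglyMeasurable_zero, fun γ x => by simp, by simp⟩
  add_mem' := by
    rintro φ ψ ⟨hφ, hφe, hφi⟩ ⟨hψ, hψe, hψi⟩
    refine ⟨hφ.add hψ, fun γ x => by simp [hφe γ x, hψe γ x], ?_⟩
    have hle : ∀ q : LeftQuot Γ, ‖(φ + ψ) q.out‖ₑ ^ 2 ≤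
        2 * ‖φ q.out‖ₑ ^ 2 + 2 * ‖ψ q.out‖ₑ ^ 2 := by
      intro q
      have h1 : ‖(φ + ψ) q.out‖ ^ 2 ≤ 2 * ‖φ q.out‖ ^ 2 + 2 * ‖ψ q.out‖ ^ 2 := by
        have := norm_add_le (φ q.out) (ψ q.out)
        have h0 := norm_nonneg (φ q.out + ψ q.out)
        simp only [Pi.add_apply]
        nlinarith [sq_nonneg (‖φ q.out‖ - ‖ψ q.out‖)]
      have h2 := ENNReal.ofReal_le_ofReal h1
      rw [ENNReal.ofReal_add (by positivity) (by positivity),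
        ENNReal.ofReal_mul (by norm_num), ENNReal.ofReal_mul (by norm_num),
        ENNReal.ofReal_pow (norm_nonneg _), ENNReal.ofReal_pow (norm_nonneg _),
        ENNReal.ofReal_pow (norm_nonneg _)] at h2
      simpa using h2
    refine (lintegral_mono hle).trans_lt ?_
    rw [lintegral_add_left (((hφe.measurable_enorm_out hφ).pow_const 2).const_mul 2),
      lintegral_const_mul _ ((hφe.measurable_enorm_out hφ).pow_const 2),
      lintegral_const_mul _ ((hψe.measurable_enorm_out hψ).pow_const 2)]
    exact ENNReal.add_lt_top.mpr
      ⟨ENNReal.mul_lt_top (by simp) hφi, ENNReal.mul_lt_top (by simp) hψi⟩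
  smul_mem' := by
    rintro c φ ⟨hφ, hφe, hφi⟩
    refine ⟨hφ.const_smul c, fun γ x => by simp [hφe γ x], ?_⟩
    simp only [Pi.smul_apply, enorm_smul, mul_pow]
    rw [lintegral_const_mul _ ((hφe.measurable_enorm_out hφ).pow_const 2)]
    exact ENNReal.mul_lt_top (by simp) hφi

/-- The same space, without the topology of pointwise convergence. -/
def PreL2 : Type _ := squareIntegrable Γ ω μ

instance : AddCommGroup (PreL2 Γ ω μ) := inferInstanceAs (AddCommGroup (squareIntegrable Γ ω μ))

instance : Module ℂ (PreL2 Γ ω μ) := inferInstanceAs (Module ℂ (squareIntegrable Γ ω μ))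

variable {Γ ω μ}

/-- The function on `G` underlying an element of `PreL2`. -/
def PreL2.fn (φ : PreL2 Γ ω μ) : G → V := φ.1

lemma PreL2.fn_add (φ ψ : PreL2 Γ ω μ) : (φ + ψ).fn = φ.fn + ψ.fn := rfl

lemma PreL2.fn_smul (c : ℂ) (φ : PreL2 Γ ω μ) : (c • φ).fn = c • φ.fn := rfl

lemma PreL2.integrable_inner (φ ψ : PreL2 Γ ω μ) :
    Integrable (fun q : LeftQuot Γ => inner ℂ (φ.fn q.out) (ψ.fn q.out)) (latticeMeasure Γ μ) := by
  obtain ⟨φ, hφ, hφe, hφi⟩ := φ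
  obtain ⟨ψ, hψ, hψe, hψi⟩ := ψ
  change Integrable (fun q : LeftQuot Γ => inner ℂ (φ q.out) (ψ q.out)) (latticeMeasure Γ μ)
  refine ⟨Measurable.aestronglyMeasurable ?_, ?_⟩
  · refine measurable_from_quotient.mpr ?_
    have : (fun q : LeftQuot Γ => inner ℂ (φ q.out) (ψ q.out)) ∘ Quotient.mk'' =
        fun x => inner ℂ (φ x) (ψ x) := funext fun x => hφe.inner_out hψe x
    rw [this]
    exact (hφ.inner hψ).measurable
  · have hle : ∀ q : LeftQuot Γ, ‖(inner ℂ (φ q.out) (ψ q.out) : ℂ)‖ₑ ≤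
        ‖φ q.out‖ₑ ^ 2 + ‖ψ q.out‖ₑ ^ 2 := by
      intro q
      have h1 : ‖(inner ℂ (φ q.out) (ψ q.out) : ℂ)‖ ≤ ‖φ q.out‖ ^ 2 + ‖ψ q.out‖ ^ 2 := by
        have := norm_inner_le_norm (𝕜 := ℂ) (φ q.out) (ψ q.out)
        nlinarith [sq_nonneg (‖φ q.out‖ - ‖ψ q.out‖), norm_nonneg (φ q.out),
          norm_nonneg (ψ q.out), mul_nonneg (norm_nonneg (φ q.out)) (norm_nonneg (ψ q.out))]
      have h2 := ENNReal.ofReal_le_ofReal h1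
      rw [ENNReal.ofReal_add (by positivity) (by positivity),
        ENNReal.ofReal_pow (norm_nonneg _), ENNReal.ofReal_pow (norm_nonneg _)] at h2
      simpa only [ofReal_norm] using h2
    refine (lintegral_mono hle).trans_lt ?_
    rw [lintegral_add_left ((hφe.measurable_enorm_out hφ).pow_const 2)]
    exact ENNReal.add_lt_top.mpr ⟨hφi, hψi⟩

variable (Γ ω μ) in
/-- The inner product `⟨φ, ψ⟩ = ∫_{Γ \ G} ⟨φ(x), ψ(x)⟩ dx`. -/
@[reducible]
def PreL2.core : PreInnerProductSpace.Core ℂ (PreL2 Γ ω μ) where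
  inner φ ψ := ∫ q : LeftQuot Γ, inner ℂ (φ.fn q.out) (ψ.fn q.out) ∂(latticeMeasure Γ μ)
  conj_inner_symm φ ψ := by
    rw [← integral_conj]
    simp only [inner_conj_symm]
  re_inner_nonneg φ := by
    rw [← integral_re (φ.integrable_inner φ)]
    exact integral_nonneg fun q => inner_self_nonneg
  add_left φ ψ χ := by
    simp only [PreL2.fn_add, Pi.add_apply, inner_add_left]
    exact integral_add (φ.integrable_inner χ) (ψ.integrable_inner χ)
  smul_left φ ψ c := by
    simp only [PreL2.fn_smul, Pi.smul_apply, inner_smul_left]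
    exact integral_const_mul _ _

instance : SeminormedAddCommGroup (PreL2 Γ ω μ) :=
  @InnerProductSpace.Core.toSeminormedAddCommGroup ℂ _ _ _ _ (PreL2.core Γ ω μ)

instance : InnerProductSpace ℂ (PreL2 Γ ω μ) := InnerProductSpace.ofCore (PreL2.core Γ ω μ)

variable (Γ ω μ) in
/-- The Hilbert space `L²(Γ \ G, ω)`: square integrable functions modulo functions of norm zero,
that is, modulo null functions. -/
abbrev L2 : Type _ := SeparationQuotient (PreL2 Γ ω μ)

/-- The relation `Ψ = R(g) Φ`, where `R` is the representation of `G` on `L²(Γ \ G, ω)` by right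
shifts, `(R(g) φ)(x) = φ(x g)`. -/
def IsRightShift (g : G) (Φ Ψ : L2 Γ ω μ) : Prop :=
  ∃ φ ψ : PreL2 Γ ω μ, SeparationQuotient.mk φ = Φ ∧ SeparationQuotient.mk ψ = Ψ ∧
    ∀ x, ψ.fn x = φ.fn (x * g)

end L2

/-! ### The unitary dual, traces and multiplicities -/

section UnitaryDual

/-- A unitary representation of the topological group `G` on a Hilbert space (strongly
continuous). Irreducible unitary representations of a second countable locally compact group live
on separable Hilbert spaces, so Hilbert spaces in `Type` give all of them up to equivalence. -/
structure UnitaryRep (G : Type*) [Group G] [TopologicalSpace G] where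
  /-- the Hilbert space of the representation -/
  H : Type
  [normedAddCommGroup : NormedAddCommGroup H]
  [innerProductSpace : InnerProductSpace ℂ H]
  [completeSpace : CompleteSpace H]
  /-- the action -/
  ρ : G →* (H ≃ₗᵢ[ℂ] H)
  continuous_ρ : ∀ v, Continuous fun g => ρ g v

attribute [instance] UnitaryRep.normedAddCommGroup UnitaryRep.innerProductSpace
  UnitaryRep.completeSpace

variable {G : Type*} [Group G] [TopologicalSpace G]

/-- Nonzero, with no closed invariant subspaces besides `0` and the whole space. -/
def UnitaryRep.IsIrreducible (π : UnitaryRep G) : Prop :=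
  Nontrivial π.H ∧ ∀ W : Submodule ℂ π.H, IsClosed (W : Set π.H) →
    (∀ g, ∀ v ∈ W, π.ρ g v ∈ W) → W = ⊥ ∨ W = ⊤

/-- Unitary equivalence. -/
def UnitaryRep.Equivalent (π σ : UnitaryRep G) : Prop :=
  ∃ T : π.H ≃ₗᵢ[ℂ] σ.H, ∀ g v, T (π.ρ g v) = σ.ρ g (T v)

variable (G) in
/-- Unitary equivalence of irreducible unitary representations. -/
def unitaryEquivalence : Setoid {π : UnitaryRep G // π.IsIrreducible} where
  r π σ := π.1.Equivalent σ.1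
  iseqv :=
    { refl := fun π => ⟨LinearIsometryEquiv.refl ℂ _, fun _ _ => rfl⟩
      symm := by
        rintro π σ ⟨T, hT⟩
        refine ⟨T.symm, fun g v => ?_⟩
        apply T.injective
        rw [hT, T.apply_symm_apply, T.apply_symm_apply]
      trans := by
        rintro π σ τ ⟨T, hT⟩ ⟨S, hS⟩
        refine ⟨T.trans S, fun g v => ?_⟩
        simp [hT, hS] }

variable (G) in
/-- The unitary dual of `G`: equivalence classes of irreducible unitary representations. -/
def UnitaryDual : Type _ := Quotient (unitaryEquivalence G)

/-- A representation in the class. -/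
def UnitaryDual.rep (π : UnitaryDual G) : UnitaryRep G := (Quotient.out π).1

variable [MeasurableSpace G]

/-- The operator `π(f) = ∫_G f(x) π(x) dx`. -/
def UnitaryRep.op (π : UnitaryRep G) (μ : Measure G) (f : G → ℂ) (v : π.H) : π.H :=
  ∫ x, f x • π.ρ x v ∂μ

/-- The trace of an operator on a Hilbert space, computed in a Hilbert basis. -/
def hilbertTrace {H : Type*} [NormedAddCommGroup H] [InnerProductSpace ℂ H] [CompleteSpace H]
    (A : H → H) : ℂ :=
  let b := (exists_hilbertBasis ℂ H).choose_spec.choose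
  ∑' i, inner ℂ (b i) (A (b i))

variable {V : Type*} [NormedAddCommGroup V] [InnerProductSpace ℂ V]
  (Γ : Subgroup G) (ω : Γ →* (V ≃ₗᵢ[ℂ] V)) (μ : Measure G)

/-- The space of continuous `G`-equivariant linear maps from `π` to `L²(Γ \ G, ω)`. -/
def intertwiners (π : UnitaryRep G) : Submodule ℂ (π.H →L[ℂ] L2 Γ ω μ) where
  carrier := {T | ∀ g v, IsRightShift g (T v) (T (π.ρ g v))}
  zero_mem' := fun _ _ => ⟨0, 0, by simp, by simp, fun _ => rfl⟩
  add_mem' := by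
    intro S T hS hT g v
    obtain ⟨φ, ψ, h1, h2, h3⟩ := hS g v
    obtain ⟨φ', ψ', h1', h2', h3'⟩ := hT g v
    refine ⟨φ + φ', ψ + ψ', ?_, ?_, fun x => ?_⟩
    · rw [SeparationQuotient.mk_add, h1, h1']; rfl
    · rw [SeparationQuotient.mk_add, h2, h2']; rfl
    · simp only [PreL2.fn_add, Pi.add_apply, h3, h3']
  smul_mem' := by
    intro c T hT g v
    obtain ⟨φ, ψ, h1, h2, h3⟩ := hT g v
    refine ⟨c • φ, c • ψ, ?_, ?_, fun x => ?_⟩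
    · rw [SeparationQuotient.mk_smul, h1]; rfl
    · rw [SeparationQuotient.mk_smul, h2]; rfl
    · simp only [PreL2.fn_smul, Pi.smul_apply, h3]

/-- The multiplicity `N_{Γ,ω}(π)` of `π` in `L²(Γ \ G, ω)`. -/
def multiplicity (π : UnitaryRep G) : ℕ := Module.finrank ℂ (intertwiners Γ ω μ π)

/-- The contribution `N_{Γ,ω}(π) tr π(f)` of `π` to the spectral side. -/
def spectralTerm (f : G → ℂ) (π : UnitaryDual G) : ℂ :=
  multiplicity Γ ω μ π.rep * hilbertTrace (π.rep.op μ f)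

/-- The contribution `tr ω(γ) vol(Γ_γ \ G_γ) O_γ(f)` of `γ` to the geometric side; `η γ` is the
Haar measure on the centralizer `G_γ`. -/
def geometricTerm (η : ∀ γ : Γ, Measure (Subgroup.centralizer {(γ : G)})) (f : G → ℂ) (γ : Γ) :
    ℂ :=
  LinearMap.trace ℂ V (ω γ).toLinearEquiv.toLinearMap *
    ((centralizerVolume Γ (γ : G) (η γ)).toReal : ℂ) * orbitalIntegral μ (γ : G) (η γ) f

end UnitaryDual

end TraceFormula

end

/-!
The trace of `R(f)` on `L²(Γ \ G, ω)`, `R` the right shift, is computed in two ways. Only the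
following is used about `G`: it is locally compact, second countable and totally disconnected.

*Reduction to finite sums.* Let `f` be bi-invariant under a compact open subgroup. As `Γ` is
discrete and cocompact, a smaller compact open subgroup `W` acts freely on `Γ \ G`
(`exists_actsFreely`), and `G` is the disjoint union of the tiles `γ x_i W`, for `γ ∈ Γ` and
finitely many `x_i` (`IsTiling`). So `⋃ x_i W` is a fundamental domain, `G` is unimodular, and the
`W`-invariant elements of `L²(Γ \ G, ω)` are the equivariant functions determined by their values
at the `x_i`: a finite sum of copies of `V` (`stepEquiv`). The operator `R(f)` has its range in this
finite dimensional space. No compact support is needed: the tiles `γ z W` are disjoint for fixed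
`z`, which gives `μ(W) ∑_γ |f(y⁻¹ γ z)| ≤ ‖f‖₁` (`ActsFreely.tsum_enorm_le`), and this inequality
is behind all the convergence.

*Geometric side.* In the basis of functions supported on a single `Γ x_i W`, the trace is
`∑_γ tr ω(γ) μ(W) ∑_i f(x_i⁻¹ γ x_i)` (`sum_integral_invariantBasis`). The centralizer `G_γ` again
contains `Γ_γ` as a cocompact lattice; so it is unimodular, and the quotient measures exist. They
are constructed from weight functions, which have integral one along every coset (`IsWeight`).
The sum over a conjugacy class unfolds to `vol(Γ_γ \ G_γ) O_γ(f)`, because the translates of the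
fundamental domain by representatives of `Γ_γ \ Γ` make up a fundamental domain for `Γ_γ`
(`orbitalIntegral_eq`, `geometric_side`).

*Spectral side.* As the space of `W`-invariant vectors is finite dimensional, it is exhausted by
the invariant vectors of finitely many orthogonal irreducible subrepresentations
(`exists_decomposition`). By Schur's lemma, `N(π)` is the number of those equivalent to `π`
whenever `π` has nonzero `W`-invariant vectors (`finrank_homs_eq_card`); for all other `π` the
operator `π(f)` is zero. Adding up the traces gives the trace of `R(f)` (`spectral_side`).
The finiteness of `N(π)` for every `π` follows by shrinking `W` until `π` has nonzero
`W`-invariant vectors (`finiteDimensional_intertwiners`).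
-/

noncomputable section

namespace TraceFormula

open Topology

/-! ### The topology of the group of rational points -/

section LocalFields

open ValuativeRel

variable (F : Type*) [Field F] [ValuativeRel F] [TopologicalSpace F] [IsNonarchimedeanLocalField F]

lemma countable_valueGroupWithZero : Countable (ValueGroupWithZero F) := by
  have : Countable (WithZero (Multiplicative ℤ)) := inferInstanceAs (Countable (Option ℤ))
  exact (IsNonarchimedeanLocalField.valueGroupWithZeroIsoInt F).toEquiv.injective.countable

lemma t2Space_localField : T2Space F := by
  let := IsTopologicalAddGroup.rightUniformSpace F
  have := isUniformAddGroup_of_addCommGroup (G := F)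
  have : T0Space F := inferInstance
  infer_instance

/-- The balls around zero are open subgroups. -/
lemma totallyDisconnectedSpace_localField : TotallyDisconnectedSpace F := by
  have := t2Space_localField F
  have : NonarchimedeanAddGroup F := by
    refine ⟨fun U hU => ?_⟩
    obtain ⟨γ, hγ, hU⟩ := (IsValuativeTopology.hasBasis_nhds_zero' F).mem_iff.mp hU
    let S := (valuation F).ltAddSubgroup (Units.mk0 γ hγ)
    have hS : (S : Set F) = {x | valuation F x < γ} := by ext; simp [S]
    exact ⟨⟨S, AddSubgroup.isOpen_of_mem_nhds S (g := 0)
      (hS ▸ (IsValuativeTopology.hasBasis_nhds_zero' F).mem_of_mem hγ)⟩, hS.trans_subset hU⟩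
  infer_instance

/-- The value group is countable; so `F` is metrizable, and a countable union of compact balls. -/
lemma secondCountableTopology_localField : SecondCountableTopology F := by
  have := countable_valueGroupWithZero F
  let := IsTopologicalAddGroup.rightUniformSpace F
  have := isUniformAddGroup_of_addCommGroup (G := F)
  have : (𝓝 (0 : F)).IsCountablyGenerated :=
    (IsValuativeTopology.hasBasis_nhds_zero' F).isCountablyGenerated
  have := IsUniformAddGroup.uniformity_countably_generated (α := F)
  let := TopologicalSpace.pseudoMetrizableSpacePseudoMetric F
  have : SigmaCompactSpace F := by
    refine SigmaCompactSpace.of_countable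
      (Set.range fun γ : ValueGroupWithZero F => {x : F | valuation F x ≤ γ})
      (Set.countable_range _) ?_ ?_
    · rintro _ ⟨γ, rfl⟩
      exact IsNonarchimedeanLocalField.isCompact_closedBall F γ
    · exact Set.eq_univ_of_forall fun x => ⟨_, ⟨valuation F x, rfl⟩, le_refl (valuation F x)⟩
  exact EMetric.secondCountable_of_sigmaCompact F
end LocalFields

section MatrixGroups
variable (F : Type*) [Field F] [TopologicalSpace F] (n : ℕ)

lemma locallyCompactSpace_GL [IsTopologicalRing F] [LocallyCompactSpace F] [T2Space F] :
    LocallyCompactSpace (GL (Fin n) F) := by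
  have : LocallyCompactSpace (Matrix (Fin n) (Fin n) F) :=
    inferInstanceAs (LocallyCompactSpace (Fin n → Fin n → F))
  have : LocallyCompactSpace (Matrix (Fin n) (Fin n) F)ᵐᵒᵖ :=
    MulOpposite.opHomeomorph.symm.isClosedEmbedding.locallyCompactSpace
  exact Units.isClosedEmbedding_embedProduct.locallyCompactSpace

lemma secondCountableTopology_GL [SecondCountableTopology F] :
    SecondCountableTopology (GL (Fin n) F) := by
  have : SecondCountableTopology (Matrix (Fin n) (Fin n) F) :=
    inferInstanceAs (SecondCountableTopology (Fin n → Fin n → F))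
  have : SecondCountableTopology (Matrix (Fin n) (Fin n) F)ᵐᵒᵖ :=
    MulOpposite.opHomeomorph.symm.secondCountableTopology
  exact Units.isEmbedding_embedProduct.secondCountableTopology

lemma totallyDisconnectedSpace_GL [TotallyDisconnectedSpace F] :
    TotallyDisconnectedSpace (GL (Fin n) F) := by
  have : TotallyDisconnectedSpace (Matrix (Fin n) (Fin n) F) :=
    inferInstanceAs (TotallyDisconnectedSpace (Fin n → Fin n → F))
  exact ⟨isTotallyDisconnected_of_image Units.continuous_val.continuousOn Units.val_injective
    (isTotallyDisconnected_of_totallyDisconnectedSpace _)⟩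

/-- The rational points of a linear algebraic group over `F` are cut out in `GL_n(F)` by
polynomials with coefficients in `F`, hence form a closed subgroup. -/
lemma isClosed_rationalPoints [IsTopologicalRing F] [T1Space F]
    (H : Subgroup (GL (Fin n) (AlgebraicClosure F))) (hH : IsLinearAlgebraicGroupOver F H) :
    IsClosed (rationalPoints F H : Set (GL (Fin n) F)) := by
  have key : (rationalPoints F H : Set (GL (Fin n) F)) =
      ⋂ p ∈ MvPolynomial.vanishingIdeal F (coords '' (H : Set (GL (Fin n) (AlgebraicClosure F)))),
        {g : GL (Fin n) F | MvPolynomial.eval (coords g) p = 0} := by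
    have hev : ∀ (g : GL (Fin n) F) (p : MvPolynomial (Fin n × Fin n) F),
        MvPolynomial.eval (coords (Matrix.GeneralLinearGroup.map
          (algebraMap F (AlgebraicClosure F)) g)) (MvPolynomial.map (algebraMap F _) p) =
        algebraMap F (AlgebraicClosure F) (MvPolynomial.eval (coords g) p) := by
      intro g p
      rw [MvPolynomial.eval_map]
      exact (MvPolynomial.eval₂_comp (algebraMap F (AlgebraicClosure F)) (coords g) p).symm
    ext g
    simp only [Set.mem_iInter, Set.mem_ofPred_eq]
    constructor
    · intro hg p hp
      have := hev g p
      apply (algebraMap F (AlgebraicClosure F)).injective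
      rw [← this, map_zero, MvPolynomial.eval_map]
      exact hp _ ⟨_, hg, rfl⟩
    · intro hg
      refine hH.closed _ ?_
      rw [hH.defined_over]
      intro q hq
      have hle : (MvPolynomial.vanishingIdeal F
          (coords '' (H : Set (GL (Fin n) (AlgebraicClosure F))))).map
          (MvPolynomial.map (algebraMap F (AlgebraicClosure F))) ≤
          RingHom.ker (MvPolynomial.eval (coords (Matrix.GeneralLinearGroup.map
          (algebraMap F (AlgebraicClosure F)) g))) := by
        rw [Ideal.map_le_iff_le_comap]
        intro p hp
        rw [Ideal.mem_comap, RingHom.mem_ker, hev, hg p hp, map_zero]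
      have := hle hq
      rw [RingHom.mem_ker] at this
      simpa [MvPolynomial.aeval_eq_eval] using this
  rw [key]
  refine isClosed_biInter fun p _ => ?_
  have hc : Continuous fun g : GL (Fin n) F => MvPolynomial.eval (coords g) p := by
    refine (MvPolynomial.continuous_eval p).comp ?_
    refine continuous_pi fun ij => ?_
    exact (Units.continuous_val.matrix_elem ij.1 ij.2)
  exact isClosed_singleton.preimage hc
end MatrixGroups

/-! ### Fundamental domains that are unions of cosets of a small compact open subgroup -/

section Tilings

variable {G : Type*} [Group G]

/-- The conjugates of `W` meet `Γ` trivially; equivalently `Γ` acts freely on `G / W`. -/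
def ActsFreely (Γ W : Subgroup G) : Prop :=
  ∀ x : G, ∀ γ ∈ Γ, x⁻¹ * γ * x ∈ W → γ = 1

/-- The sets `γ x_i W`, for `γ ∈ Γ` and `i : ι`, are pairwise disjoint and cover `G`. -/
structure IsTiling (Γ W : Subgroup G) {ι : Type*} (x : ι → G) : Prop where
  cover : ∀ g : G, ∃ γ : Γ, ∃ i, ((γ : G) * x i)⁻¹ * g ∈ W
  unique : ∀ {g : G} {γ γ' : Γ} {i j : ι}, ((γ : G) * x i)⁻¹ * g ∈ W →
    ((γ' : G) * x j)⁻¹ * g ∈ W → γ = γ' ∧ i = j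

lemma ActsFreely.exists_isTiling {Γ W : Subgroup G} (h : ActsFreely Γ W)
    (hfin : ∃ s : Finset G, ∀ g : G, ∃ γ : Γ, ∃ x ∈ s, ((γ : G) * x)⁻¹ * g ∈ W) :
    ∃ s : Finset G, IsTiling Γ W (fun i : s => (i : G)) := by
  classical
  -- a covering set of minimal cardinality meets every double coset exactly once
  obtain ⟨s, hs, hmin⟩ := exists_minimal_of_wellFoundedLT
    (fun s : Finset G => ∀ g : G, ∃ γ : Γ, ∃ x ∈ s, ((γ : G) * x)⁻¹ * g ∈ W) hfin
  refine ⟨s, ⟨fun g => ?_, ?_⟩⟩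
  · obtain ⟨γ, x, hx, h⟩ := hs g
    exact ⟨γ, ⟨x, hx⟩, h⟩
  · rintro g γ γ' ⟨x, hx⟩ ⟨y, hy⟩ h1 h2
    simp only at h1 h2
    have key : x = y := by
      by_contra hne
      have hcov : ∀ g : G, ∃ γ : Γ, ∃ z ∈ s.erase y, ((γ : G) * z)⁻¹ * g ∈ W := by
        intro k
        obtain ⟨δ, z, hz, hk⟩ := hs k
        by_cases hzy : z = y
        · subst hzy
          refine ⟨δ * γ'⁻¹ * γ, x, Finset.mem_erase.mpr ⟨hne, hx⟩, ?_⟩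
          have := W.mul_mem (W.mul_mem h1 (W.inv_mem h2)) hk
          have e : ((((δ * γ'⁻¹ * γ : Γ) : G)) * x)⁻¹ * k =
              (((γ : G) * x)⁻¹ * g) * (((γ' : G) * z)⁻¹ * g)⁻¹ * (((δ : G) * z)⁻¹ * k) := by
            push_cast; group
          rwa [e]
        · exact ⟨δ, z, Finset.mem_erase.mpr ⟨hzy, hz⟩, hk⟩
      exact absurd (hmin hcov (Finset.erase_subset y s) hy) (Finset.notMem_erase y s)
    subst key
    refine ⟨?_, rfl⟩
    have := W.mul_mem h2 (W.inv_mem h1)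
    have e : (((γ' : G) * x)⁻¹ * g) * (((γ : G) * x)⁻¹ * g)⁻¹ =
        x⁻¹ * ((γ'⁻¹ * γ : Γ) : G) * x := by push_cast; group
    rw [e] at this
    have := h x _ (γ'⁻¹ * γ).2 this
    have : γ'⁻¹ * γ = 1 := Subtype.ext this
    exact (inv_mul_eq_one.mp this).symm

/-- The union of the tiles `x_i W`. -/
def domain (W : Subgroup G) {ι : Type*} (x : ι → G) : Set G := {g | ∃ i, (x i)⁻¹ * g ∈ W}

variable {Γ W : Subgroup G} {ι : Type*} {x : ι → G}

lemma domain_eq_iUnion (W : Subgroup G) (x : ι → G) :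
    domain W x = ⋃ i, {g | (x i)⁻¹ * g ∈ W} := by
  ext; simp [domain]

lemma IsTiling.existsUnique (h : IsTiling Γ W x) (g : G) : ∃! γ : Γ, (γ : G) * g ∈ domain W x := by
  obtain ⟨γ, i, hi⟩ := h.cover g
  refine ⟨γ⁻¹, ⟨i, ?_⟩, ?_⟩
  · simpa [mul_assoc] using hi
  · rintro δ ⟨j, hj⟩
    have hj' : (((δ⁻¹ : Γ) : G) * x j)⁻¹ * g ∈ W := by simpa [mul_assoc] using hj
    rw [(h.unique hi hj').1, inv_inv]

lemma IsTiling.disjoint (h : IsTiling Γ W x) {i j : ι} (hij : i ≠ j) :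
    Disjoint {g | (x i)⁻¹ * g ∈ W} {g | (x j)⁻¹ * g ∈ W} := by
  rw [Set.disjoint_left]
  intro g h1 h2
  exact hij (h.unique (γ := 1) (γ' := 1) (by simpa using h1) (by simpa using h2)).2

end Tilings

section Existence

variable {G : Type*} [Group G] [TopologicalSpace G] [IsTopologicalGroup G]

lemma isOpen_tile {W : Subgroup G} (hWo : IsOpen (W : Set G)) (g : G) : IsOpen {y | g⁻¹ * y ∈ W} :=
  hWo.preimage (continuous_const_mul g⁻¹)

/-- Compact open subgroups of a profinite group `U` can be taken to be normal in `U`. -/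
lemma exists_subgroup_normalized [TotallyDisconnectedSpace G] {U : Subgroup G}
    (hUo : IsOpen (U : Set G)) (hUc : IsCompact (U : Set G)) {N : Set G} (hN : N ∈ 𝓝 (1 : G)) :
    ∃ W : Subgroup G, W ≤ U ∧ IsOpen (W : Set G) ∧ IsCompact (W : Set G) ∧ (W : Set G) ⊆ N ∧
      ∀ u ∈ U, ∀ w ∈ W, u * w * u⁻¹ ∈ W := by
  have : CompactSpace U := isCompact_iff_compactSpace.mp hUc
  obtain ⟨N', hN', hN'o, h1⟩ := mem_nhds_iff.mp hN
  obtain ⟨H, hH⟩ := ProfiniteGrp.exist_openNormalSubgroup_sub_open_nhds_of_one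
    (U := (Subtype.val : U → G) ⁻¹' N') (hN'o.preimage continuous_subtype_val) h1
  have himg : ((H.toSubgroup.map U.subtype : Subgroup G) : Set G) =
      Subtype.val '' (H : Set U) := by
    ext; simp only [Subgroup.coe_map, Subgroup.coe_subtype]; rfl
  have hcl : IsClosed (H : Set U) := H.toOpenSubgroup.isClosed
  refine ⟨H.toSubgroup.map U.subtype, Subgroup.map_subtype_le _, ?_, ?_, ?_, ?_⟩
  · rw [himg]
    exact hUo.isOpenMap_subtype_val _ H.toOpenSubgroup.isOpen
  · rw [himg]
    exact hcl.isCompact.image continuous_subtype_val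
  · rw [himg]
    rintro _ ⟨y, hy, rfl⟩
    exact hN' (hH hy)
  · rintro u hu _ ⟨w, hw, rfl⟩
    exact ⟨⟨u, hu⟩ * w * ⟨u, hu⟩⁻¹, H.isNormal'.conj_mem w hw ⟨u, hu⟩, rfl⟩

/-- By compactness, `Γ \ G / U` is finite. -/
lemma exists_finset_cover (Γ : Subgroup G) [CompactSpace (LeftQuot Γ)] {U : Subgroup G}
    (hUo : IsOpen (U : Set G)) :
    ∃ s : Finset G, ∀ g : G, ∃ γ : Γ, ∃ x ∈ s, ((γ : G) * x)⁻¹ * g ∈ U := by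
  have hopen : ∀ x : G, IsOpen (Quotient.mk (MulAction.orbitRel Γ G) '' {g | x⁻¹ * g ∈ U}) :=
    fun x => isOpenMap_quotient_mk'_mul _ (hUo.preimage (continuous_const_mul x⁻¹))
  obtain ⟨s, hs⟩ := isCompact_univ.elim_finite_subcover _ hopen (by
    intro q _
    induction q using Quotient.inductionOn with
    | h g => exact Set.mem_iUnion.mpr ⟨g, g, by simp, rfl⟩)
  refine ⟨s, fun g => ?_⟩
  obtain ⟨x, hx⟩ := Set.mem_iUnion.mp (hs (Set.mem_univ (Quotient.mk _ g)))
  obtain ⟨hxs, k, hk, he⟩ := Set.mem_iUnion.mp hx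
  obtain ⟨γ, hγ⟩ := MulAction.orbitRel_apply.mp (Quotient.exact he)
  refine ⟨γ⁻¹, x, hxs, ?_⟩
  have hγ' : (γ : G) * g = k := hγ
  have : ((((γ⁻¹ : Γ) : G)) * x)⁻¹ * g = x⁻¹ * k := by rw [← hγ']; push_cast; group
  rw [this]; exact hk

/-- Writing `y = δ x u` with `δ ∈ Γ`, `u ∈ U` and `x` in a finite set, and choosing `W` normal in
`U`, the intersection of `Γ` with `y W y⁻¹` is a `Γ`-conjugate of its intersection with
`x W x⁻¹`; so only finitely many conditions on `W` are needed. -/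
lemma exists_actsFreely [TotallyDisconnectedSpace G] (Γ : Subgroup G) [DiscreteTopology Γ]
    [CompactSpace (LeftQuot Γ)] {U : Subgroup G}
    (hUo : IsOpen (U : Set G)) (hUc : IsCompact (U : Set G)) {N : Set G} (hN : N ∈ 𝓝 (1 : G)) :
    ∃ W : Subgroup G, W ≤ U ∧ IsOpen (W : Set G) ∧ IsCompact (W : Set G) ∧ (W : Set G) ⊆ N ∧
      ActsFreely Γ W := by
  obtain ⟨s, hs⟩ := exists_finset_cover Γ hUo
  obtain ⟨O, hO, hO1⟩ : ∃ O ∈ 𝓝 (1 : G), ∀ γ ∈ Γ, γ ∈ O → γ = 1 := by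
    have : ({1} : Set Γ) ∈ 𝓝 (1 : Γ) := by simp
    obtain ⟨O, hO, h⟩ := mem_nhds_subtype _ _ _ |>.mp this
    exact ⟨O, hO, fun γ hγ hγO => congrArg Subtype.val (h (a := ⟨γ, hγ⟩) hγO)⟩
  have hN2 : N ∩ ⋂ x ∈ s, {g | x * g * x⁻¹ ∈ O} ∈ 𝓝 (1 : G) := by
    refine Filter.inter_mem hN ((Filter.biInter_finset_mem s).mpr fun x _ => ?_)
    have hc : Continuous fun g : G => x * g * x⁻¹ := by fun_prop
    exact hc.continuousAt.preimage_mem_nhds (by simpa using hO)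
  obtain ⟨W, hWU, hWo, hWc, hWN, hnorm⟩ := exists_subgroup_normalized hUo hUc hN2
  refine ⟨W, hWU, hWo, hWc, fun w hw => (hWN hw).1, fun y γ hγ hy => ?_⟩
  obtain ⟨δ, x, hx, hu⟩ := hs y
  set u := ((δ : G) * x)⁻¹ * y with hu_def
  have hyu : y = δ * x * u := by rw [hu_def]; group
  have h1 := hnorm u hu _ hy
  have h2 : u * (y⁻¹ * γ * y) * u⁻¹ = x⁻¹ * ((δ : G)⁻¹ * γ * δ) * x := by rw [hyu]; group
  rw [h2] at h1
  have h3 := Set.mem_iInter₂.mp (hWN h1).2 x hx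
  have h4 : x * (x⁻¹ * ((δ : G)⁻¹ * γ * δ) * x) * x⁻¹ = (δ : G)⁻¹ * γ * δ := by group
  simp only [Set.mem_ofPred_eq, h4] at h3
  have h5 := hO1 _ (Γ.mul_mem (Γ.mul_mem (Γ.inv_mem δ.2) hγ) δ.2) h3
  have h6 : γ = δ * ((δ : G)⁻¹ * γ * δ) * (δ : G)⁻¹ := by group
  rw [h6, h5]; group

end Existence

section Measure

variable {G : Type*} [Group G] [TopologicalSpace G] [IsTopologicalGroup G]
  [MeasurableSpace G] [BorelSpace G] (μ : Measure G)
  {Γ W : Subgroup G} {ι : Type*} {x : ι → G}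

lemma measurableSet_tile (hWo : IsOpen (W : Set G)) (g : G) : MeasurableSet {y | g⁻¹ * y ∈ W} :=
  (isOpen_tile hWo g).measurableSet

lemma measure_tile [μ.IsMulLeftInvariant] (g : G) : μ {y | g⁻¹ * y ∈ W} = μ W :=
  measure_preimage_mul μ g⁻¹ (W : Set G)

variable {μ} in
lemma measureReal_pos [μ.IsOpenPosMeasure] [IsFiniteMeasureOnCompacts μ]
    (hWo : IsOpen (W : Set G)) (hWc : IsCompact (W : Set G)) : 0 < μ.real (W : Set G) :=
  ENNReal.toReal_pos (hWo.measure_pos μ ⟨1, W.one_mem⟩).ne' hWc.measure_lt_top.ne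

lemma measurableSet_domain (hWo : IsOpen (W : Set G)) : MeasurableSet (domain W x) := by
  rw [domain_eq_iUnion]
  exact (isOpen_iUnion fun i => isOpen_tile hWo (x i)).measurableSet

lemma measure_domain_lt_top [Finite ι] [μ.IsHaarMeasure] (hWc : IsCompact (W : Set G)) :
    μ (domain W x) < ∞ := by
  have := Fintype.ofFinite ι
  rw [domain_eq_iUnion]
  refine (measure_iUnion_le _).trans_lt ?_
  simp only [measure_tile]
  rw [tsum_fintype]
  exact ENNReal.sum_lt_top.mpr fun _ _ => hWc.measure_lt_top

lemma IsTiling.isFundamentalDomain (h : IsTiling Γ W x) (hWo : IsOpen (W : Set G)) :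
    IsFundamentalDomain Γ (domain W x) μ :=
  IsFundamentalDomain.mk' (measurableSet_domain hWo).nullMeasurableSet h.existsUnique

/-- A group with a lattice is unimodular: a right translate of a fundamental domain of finite
measure is again a fundamental domain, and so has the same measure. -/
lemma IsTiling.isMulRightInvariant [LocallyCompactSpace G] [SecondCountableTopology G]
    [Countable Γ] [Finite ι] [μ.IsHaarMeasure] (h : IsTiling Γ W x) (hWo : IsOpen (W : Set G))
    (hWc : IsCompact (W : Set G)) : μ.IsMulRightInvariant := by
  refine ⟨fun g => ?_⟩
  have hD := h.isFundamentalDomain μ hWo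
  have hD' : IsFundamentalDomain Γ ((fun y => y * g) ⁻¹' domain W x) μ := by
    refine IsFundamentalDomain.mk' ((measurableSet_domain hWo).preimage
      (measurable_mul_const g)).nullMeasurableSet fun y => ?_
    have := h.existsUnique (y * g)
    simpa only [Set.mem_preimage, Subgroup.smul_def, smul_eq_mul, mul_assoc] using this
  have heq := hD'.measure_eq hD
  rw [← Measure.map_apply (measurable_mul_const g) (measurableSet_domain hWo),
    Measure.map_right_mul_eq_modularCharacterFun_smul, Measure.smul_apply] at heq
  rw [Measure.map_right_mul_eq_modularCharacterFun_smul]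
  have hfin : μ (domain W x) ≠ ∞ := (measure_domain_lt_top μ hWc).ne
  have hpos : μ (domain W x) ≠ 0 := by
    obtain ⟨_, i, _⟩ := h.cover 1
    have hsub : {y | (x i)⁻¹ * y ∈ W} ⊆ domain W x := fun y hy => ⟨i, hy⟩
    refine (lt_of_lt_of_le ?_ (measure_mono hsub)).ne'
    exact (isOpen_tile hWo (x i)).measure_pos μ ⟨x i, by simp⟩
  have : (Measure.modularCharacterFun g : ℝ≥0∞) = 1 := by
    have h1 : (Measure.modularCharacterFun g : ℝ≥0∞) * μ (domain W x) = 1 * μ (domain W x) := by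
      rw [one_mul]; exact heq
    exact (ENNReal.mul_left_inj hpos hfin).mp h1
  have : Measure.modularCharacterFun g = 1 := by exact_mod_cast this
  rw [this, one_smul]

/-- Unimodularity makes the Haar measure invariant under inversion. -/
lemma isInvInvariant_of_isMulRightInvariant [LocallyCompactSpace G] [SecondCountableTopology G]
    [μ.IsHaarMeasure] [μ.IsMulRightInvariant] {W : Subgroup G} (hWo : IsOpen (W : Set G))
    (hWc : IsCompact (W : Set G)) : μ.IsInvInvariant := by
  have h := Measure.isMulLeftInvariant_eq_smul μ.inv μ
  have hW : μ.inv (W : Set G) = μ W := by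
    rw [Measure.inv_apply]; congr 1; ext; simp
  have hfin : μ (W : Set G) ≠ ∞ := hWc.measure_lt_top.ne
  have hne : (W : Set G).Nonempty := ⟨1, W.one_mem⟩
  have hpos : μ (W : Set G) ≠ 0 := (hWo.measure_pos μ hne).ne'
  have : (Measure.haarScalarFactor μ.inv μ : ℝ≥0∞) = 1 := by
    rw [h, Measure.smul_apply] at hW
    have h1 : (Measure.haarScalarFactor μ.inv μ : ℝ≥0∞) * μ W = 1 * μ W := by
      rw [one_mul]; exact hW
    exact (ENNReal.mul_left_inj hpos hfin).mp h1
  have : Measure.haarScalarFactor μ.inv μ = 1 := by exact_mod_cast this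
  refine ⟨?_⟩
  rw [h, this, one_smul]

end Measure

/-! ### Quotient measures -/

section Weights

variable {G : Type*} [Group G] [MeasurableSpace G]

/-- A measurable function `w ≥ 0` on `G` whose integrals over all cosets `H x` are equal to `1`.
Integration of functions on `H \ G` then amounts to integration over `G` against `w`. -/
structure IsWeight (H : Subgroup G) (η : Measure H) (w : G → ℝ≥0∞) : Prop where
  measurable : Measurable w
  lintegral_eq_one : ∀ x : G, ∫⁻ h : H, w (h * x) ∂η = 1

variable {H : Subgroup G} {η : Measure H} {μ : Measure G} {w : G → ℝ≥0∞}

/-- The projection `G → H \ G`. -/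
abbrev toQuot (H : Subgroup G) : G → LeftQuot H := Quotient.mk (MulAction.orbitRel H G)

lemma measurable_toQuot (H : Subgroup G) : Measurable (toQuot H) := fun _ hs => hs

/-- A weight determines the quotient measure. -/
lemma IsWeight.eq_map (hw : IsWeight H η w) {ν : Measure (LeftQuot H)}
    (hν : IsQuotientMeasure H μ η ν) : ν = (μ.withDensity w).map (toQuot H) := by
  ext A hA
  have hA' : MeasurableSet (toQuot H ⁻¹' A) := measurable_toQuot H hA
  have h := hν ((toQuot H ⁻¹' A).indicator w) (hw.measurable.indicator hA')
  rw [Measure.map_apply (measurable_toQuot H) hA, withDensity_apply _ hA',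
    ← lintegral_indicator hA', ← h, ← lintegral_indicator_one hA]
  refine lintegral_congr fun q => ?_
  have hq : ∀ h : H, toQuot H (h * q.out) = q := fun h => by
    conv_rhs => rw [← Quotient.out_eq q]
    exact Quotient.sound (MulAction.orbitRel_apply.mpr ⟨h, rfl⟩)
  by_cases hqA : q ∈ A
  · rw [Set.indicator_of_mem hqA, Pi.one_apply, ← hw.lintegral_eq_one q.out]
    refine lintegral_congr fun h => ?_
    rw [Set.indicator_of_mem]
    rwa [Set.mem_preimage, hq]
  · rw [Set.indicator_of_notMem hqA, ← lintegral_zero (μ := η)]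
    refine lintegral_congr fun h => ?_
    rw [Set.indicator_of_notMem]
    rwa [Set.mem_preimage, hq]

/-- Weil's integration formula: the unfolding uses only Tonelli, the left invariance of `μ` and the
invariance of `η` under `h ↦ h⁻¹`. -/
lemma IsWeight.isQuotientMeasure [MeasurableMul₂ G] [MeasurableMul H] [MeasurableInv H]
    (hw : IsWeight H η w) [SFinite μ] [SFinite η] [μ.IsMulLeftInvariant]
    [η.IsMulRightInvariant] [η.IsInvInvariant] :
    IsQuotientMeasure H μ η ((μ.withDensity w).map (toQuot H)) := by
  intro f hf
  have hmul : Measurable fun p : H × G => (p.1 : G) * p.2 :=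
    (measurable_subtype_coe.comp measurable_fst).mul measurable_snd
  have hφm : Measurable fun x : G => ∫⁻ h : H, f (h * x) ∂η :=
    (hf.comp hmul).lintegral_prod_left'
  have hφ : ∀ x : G, ∫⁻ h : H, f (h * (toQuot H x).out) ∂η = ∫⁻ h : H, f (h * x) ∂η := by
    intro x
    obtain ⟨h₀, hh₀⟩ := exists_out_eq H x
    rw [← lintegral_mul_right_eq_self (fun h : H => f (h * x)) h₀]
    refine lintegral_congr fun h => ?_
    rw [toQuot, hh₀, Subgroup.coe_mul, mul_assoc]
  have hm : Measurable fun q : LeftQuot H => ∫⁻ h : H, f (h * q.out) ∂η := by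
    refine measurable_from_quotient.mpr ?_
    have : (fun q : LeftQuot H => ∫⁻ h : H, f (h * q.out) ∂η) ∘ Quotient.mk'' =
        fun x => ∫⁻ h : H, f (h * x) ∂η := funext hφ
    rw [this]; exact hφm
  rw [lintegral_map hm (measurable_toQuot H)]
  simp only [hφ]
  rw [lintegral_withDensity_eq_lintegral_mul _ hw.measurable hφm]
  calc ∫⁻ x, (w * fun x => ∫⁻ h : H, f (h * x) ∂η) x ∂μ
      = ∫⁻ x, ∫⁻ h : H, w x * f (h * x) ∂η ∂μ := by
        refine lintegral_congr fun x => ?_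
        rw [Pi.mul_apply, lintegral_const_mul]
        exact hf.comp (hmul.comp measurable_prodMk_right)
    _ = ∫⁻ h : H, ∫⁻ x, w x * f (h * x) ∂μ ∂η := by
        refine lintegral_lintegral_swap (Measurable.aemeasurable ?_)
        exact (hw.measurable.comp measurable_fst).mul (hf.comp (hmul.comp measurable_swap))
    _ = ∫⁻ h : H, ∫⁻ x, w (((h⁻¹ : H) : G) * x) * f x ∂μ ∂η := by
        refine lintegral_congr fun h => ?_
        rw [← lintegral_mul_left_eq_self (fun x => w (((h⁻¹ : H) : G) * x) * f x) (h : G)]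
        refine lintegral_congr fun x => ?_
        rw [Subgroup.coe_inv, inv_mul_cancel_left]
    _ = ∫⁻ x, ∫⁻ h : H, w (((h⁻¹ : H) : G) * x) * f x ∂η ∂μ := by
        refine lintegral_lintegral_swap (Measurable.aemeasurable ?_)
        refine (hw.measurable.comp ?_).mul (hf.comp measurable_snd)
        exact hmul.comp (measurable_fst.inv.prodMk measurable_snd)
    _ = ∫⁻ x, f x ∂μ := by
        refine lintegral_congr fun x => ?_
        have hwm : Measurable fun h : H => w (h * x) :=
          hw.measurable.comp (hmul.comp measurable_prodMk_right)
        have hwm' : Measurable fun h : H => w (((h⁻¹ : H) : G) * x) := hwm.comp measurable_inv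
        rw [lintegral_mul_const _ hwm',
          lintegral_inv_eq_self (fun h : H => w (h * x)), hw.lintegral_eq_one, one_mul]

lemma IsWeight.quotientMeasure_spec [MeasurableMul₂ G] [MeasurableMul H] [MeasurableInv H]
    (hw : IsWeight H η w) [SFinite μ] [SFinite η] [μ.IsMulLeftInvariant]
    [η.IsMulRightInvariant] [η.IsInvInvariant] :
    IsQuotientMeasure H μ η (quotientMeasure H μ η) := by
  have h : ∃ ν, IsQuotientMeasure H μ η ν := ⟨_, hw.isQuotientMeasure⟩
  rw [quotientMeasure, dif_pos h]
  exact h.choose_spec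

lemma IsWeight.quotientMeasure_eq [MeasurableMul₂ G] [MeasurableMul H] [MeasurableInv H]
    (hw : IsWeight H η w) [SFinite μ] [SFinite η] [μ.IsMulLeftInvariant]
    [η.IsMulRightInvariant] [η.IsInvInvariant] :
    quotientMeasure H μ η = (μ.withDensity w).map (toQuot H) :=
  hw.eq_map hw.quotientMeasure_spec

end Weights

section Topological

variable {G : Type*} [Group G] [TopologicalSpace G] [IsTopologicalGroup G]

lemma continuous_of_right_invariant {X : Type*} [TopologicalSpace X] {W : Subgroup G}
    (hWo : IsOpen (W : Set G)) {φ : G → X} (h : ∀ g, ∀ k ∈ W, φ (g * k) = φ g) :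
    Continuous φ := by
  refine IsLocallyConstant.continuous ((IsLocallyConstant.iff_exists_open φ).mpr fun g => ?_)
  refine ⟨{y | g⁻¹ * y ∈ W}, isOpen_tile hWo g, by simp, fun y hy => ?_⟩
  rw [← h g _ hy, mul_inv_cancel_left]

variable [MeasurableSpace G] [BorelSpace G]

lemma IsTiling.isWeight [T2Space G] {Γ W : Subgroup G} {ι : Type*} {x : ι → G}
    (h : IsTiling Γ W x) (hWo : IsOpen (W : Set G)) :
    IsWeight Γ Measure.count ((domain W x).indicator 1) := by
  refine ⟨measurable_one.indicator (measurableSet_domain hWo), fun y => ?_⟩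
  obtain ⟨γ, hγ, hu⟩ := h.existsUnique y
  have : (fun γ : Γ => (domain W x).indicator (1 : G → ℝ≥0∞) (γ * y)) =
      ({γ} : Set Γ).indicator 1 := by
    ext δ
    by_cases hδ : (δ : G) * y ∈ domain W x
    · rw [Set.indicator_of_mem hδ, Set.indicator_of_mem (by simpa using hu δ hδ)]; rfl
    · rw [Set.indicator_of_notMem hδ, Set.indicator_of_notMem]
      rintro rfl
      exact hδ hγ
  rw [this, lintegral_indicator_one (measurableSet_singleton γ), Measure.count_singleton]

/-- A closed unimodular subgroup `H` has a weight: the indicator function of the union of the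
cosets `x_j W`, for representatives `x_j` of `H \ G / W`, divided by the measure of
`H ∩ x_j W x_j⁻¹` on `x_j W`. -/
lemma exists_isWeight {H W : Subgroup G} (hH : IsClosed (H : Set G)) (η : Measure H)
    [η.IsHaarMeasure] [η.IsMulRightInvariant] (hWo : IsOpen (W : Set G))
    (hWc : IsCompact (W : Set G)) : ∃ w, IsWeight H η w := by
  classical
  let r : G → G := fun g => (DoubleCoset.mk H W g).out
  have hr : ∀ g, ∃ h ∈ H, ∃ k ∈ W, r g = h * g * k := fun g => by
    obtain ⟨h, k, hh, hk, e⟩ := DoubleCoset.mk_out_eq_mul H W g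
    exact ⟨h, hh, k, hk, e⟩
  have hrW : ∀ g, ∀ k ∈ W, r (g * k) = r g := fun g k hk => by
    change (DoubleCoset.mk H W _).out = (DoubleCoset.mk H W _).out
    congr 1
    exact ((DoubleCoset.eq H W _ _).mpr ⟨1, H.one_mem, k, hk, by simp⟩).symm
  have hrH : ∀ g, ∀ h ∈ H, r (h * g) = r g := fun g h hh => by
    change (DoubleCoset.mk H W _).out = (DoubleCoset.mk H W _).out
    congr 1
    exact ((DoubleCoset.eq H W _ _).mpr ⟨h, hh, 1, W.one_mem, by simp⟩).symm
  let S : G → Set H := fun y => {h | y⁻¹ * (h * y) ∈ W}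
  have hSo : ∀ y, IsOpen (S y) := fun y =>
    hWo.preimage (by fun_prop : Continuous fun h : H => y⁻¹ * (h * y))
  have hSc : ∀ y, IsCompact (S y) := fun y => by
    have h1 : IsCompact ((fun g : G => y * g * y⁻¹) '' W) := hWc.image (by fun_prop)
    have h2 : S y = Subtype.val ⁻¹' ((fun g : G => y * g * y⁻¹) '' W) := by
      ext h
      constructor
      · intro hh
        exact ⟨_, hh, by group⟩
      · rintro ⟨k, hk, e⟩
        have : y⁻¹ * ((h : G) * y) = k := by rw [← e]; group
        change y⁻¹ * ((h : G) * y) ∈ W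
        rwa [this]
    rw [h2]
    exact hH.isClosedEmbedding_subtypeVal.isCompact_preimage h1
  let w : G → ℝ≥0∞ := fun g => if (r g)⁻¹ * g ∈ W then (η (S (r g)))⁻¹ else 0
  refine ⟨w, (continuous_of_right_invariant hWo fun g k hk => ?_).measurable, fun y => ?_⟩
  · simp only [w, hrW g k hk, ← mul_assoc, W.mul_mem_cancel_right hk]
  · obtain ⟨h₀, hh₀, k, hk, e⟩ := hr y
    have key : (fun h : H => w (h * y)) =
        ((fun h : H => h * ⟨h₀, hh₀⟩⁻¹) ⁻¹' S (r y)).indicator fun _ => (η (S (r y)))⁻¹ := by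
      ext h
      have h1 : (r y)⁻¹ * ((h : G) * y) ∈ W ↔ h * ⟨h₀, hh₀⟩⁻¹ ∈ S (r y) := by
        have e2 : (r y)⁻¹ * (((h * ⟨h₀, hh₀⟩⁻¹ : H) : G) * r y) = (r y)⁻¹ * (h * y) * k := by
          conv_lhs => enter [2, 2]; rw [e]
          push_cast; group
        change _ ↔ (r y)⁻¹ * (((h * ⟨h₀, hh₀⟩⁻¹ : H) : G) * r y) ∈ W
        rw [e2, W.mul_mem_cancel_right hk]
      simp only [w, hrH y h h.2, h1, Set.indicator, Set.mem_preimage]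
    have hmeas : MeasurableSet ((fun h : H => h * ⟨h₀, hh₀⟩⁻¹) ⁻¹' S (r y)) :=
      ((hSo _).preimage (continuous_mul_const _)).measurableSet
    rw [key, lintegral_indicator_const hmeas, measure_preimage_mul_right]
    exact ENNReal.inv_mul_cancel ((hSo _).measure_pos η ⟨1, by simp [S, W.one_mem]⟩).ne'
      (hSc _).measure_lt_top.ne

end Topological

/-! ### Unfolding over a conjugacy class -/

section Centralizers

variable {G : Type*} [Group G] {Γ W : Subgroup G}

lemma ActsFreely.subgroupOf (h : ActsFreely Γ W) (C : Subgroup G) :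
    ActsFreely (Γ.subgroupOf C) (W.subgroupOf C) := fun x γ hγ hx =>
  Subtype.ext (h x γ hγ hx)

/-- If `Γ \ G / W` is finite, so is `Γ_γ \ G_γ / W_γ`: if `c = δ x w` centralizes `γ`, then
`δ⁻¹ γ δ` lies in the finite set `Γ ∩ x W γ W x⁻¹`, and it determines, together with `x`, the
double coset of `c`. -/
lemma exists_finset_cover_centralizer [TopologicalSpace G] [IsTopologicalGroup G] [T2Space G]
    [DiscreteTopology Γ] (hWc : IsCompact (W : Set G))
    (hcov : ∃ s : Finset G, ∀ g : G, ∃ γ : Γ, ∃ x ∈ s, ((γ : G) * x)⁻¹ * g ∈ W) (γ : Γ) :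
    ∃ s : Finset (Subgroup.centralizer {(γ : G)}), ∀ c : Subgroup.centralizer {(γ : G)},
      ∃ σ : Γ.subgroupOf (Subgroup.centralizer {(γ : G)}), ∃ x ∈ s,
        ((σ : Subgroup.centralizer {(γ : G)}) * x)⁻¹ * c ∈
          W.subgroupOf (Subgroup.centralizer {(γ : G)}) := by
  classical
  obtain ⟨s, hs⟩ := hcov
  have hcomm : ∀ c : Subgroup.centralizer {(γ : G)}, (c : G) * γ = γ * c := fun c =>
    Subgroup.mem_centralizer_singleton_iff.mp c.2
  choose δ x hxs hδ using fun c : Subgroup.centralizer {(γ : G)} => hs c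
  let p : Subgroup.centralizer {(γ : G)} → G × Γ := fun c => (x c, (δ c)⁻¹ * γ * δ c)
  -- the finite set `Γ ∩ x W γ W x⁻¹`
  let K : G → Set G := fun y =>
    (fun q : G × G => y * (q.1 * γ * q.2) * y⁻¹) '' ((W : Set G) ×ˢ (W : Set G))
  have hK : ∀ y, {δ : Γ | (δ : G) ∈ K y}.Finite := fun y => by
    have hKc : IsCompact (K y) := (hWc.prod hWc).image (by fun_prop)
    have hcl : IsClosed (Γ : Set G) := Subgroup.isClosed_of_discrete
    have : IsCompact (Subtype.val ⁻¹' K y : Set Γ) :=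
      hcl.isClosedEmbedding_subtypeVal.isCompact_preimage hKc
    exact this.finite_of_discrete
  have hfin : (Set.range p).Finite := by
    refine (s.finite_toSet.biUnion fun y _ =>
      ((hK y).image fun δ => (y, δ))).subset ?_
    rintro _ ⟨c, rfl⟩
    refine Set.mem_biUnion (hxs c) ⟨(δ c)⁻¹ * γ * δ c, ?_, rfl⟩
    refine ⟨(((δ c : G) * x c)⁻¹ * c, (((δ c : G) * x c)⁻¹ * c)⁻¹),
      ⟨hδ c, W.inv_mem (hδ c)⟩, ?_⟩
    have e : x c * ((((δ c : G) * x c)⁻¹ * c) * γ * (((δ c : G) * x c)⁻¹ * c)⁻¹) * (x c)⁻¹ =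
        (δ c : G)⁻¹ * (c * γ) * (c : G)⁻¹ * δ c := by group
    push_cast
    simp only [e, hcomm c]
    group
  have hrep : ∀ q, ∃ c₀, q ∈ Set.range p → p c₀ = q := fun q => by
    by_cases h : q ∈ Set.range p
    · exact ⟨h.choose, fun _ => h.choose_spec⟩
    · exact ⟨1, fun h' => absurd h' h⟩
  choose rep hrep using hrep
  refine ⟨hfin.toFinset.image rep, fun c => ?_⟩
  have hpc := hrep (p c) ⟨c, rfl⟩
  set c₀ := rep (p c) with hc₀
  have hx : x c₀ = x c := congrArg Prod.fst hpc
  have hd : (δ c₀ : G)⁻¹ * γ * δ c₀ = (δ c : G)⁻¹ * γ * δ c :=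
    congrArg (fun q : G × Γ => (q.2 : G)) hpc
  have hσ : (δ c * (δ c₀ : G)⁻¹ : G) ∈ Subgroup.centralizer {(γ : G)} := by
    rw [Subgroup.mem_centralizer_singleton_iff]
    calc (δ c * (δ c₀ : G)⁻¹ : G) * γ = δ c * ((δ c₀ : G)⁻¹ * γ * δ c₀) * (δ c₀ : G)⁻¹ := by group
      _ = γ * (δ c * (δ c₀ : G)⁻¹ : G) := by rw [hd]; group
  refine ⟨⟨⟨_, hσ⟩, Γ.mul_mem (δ c).2 (Γ.inv_mem (δ c₀).2)⟩, c₀,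
    Finset.mem_image.mpr ⟨p c, by simp, rfl⟩, ?_⟩
  rw [Subgroup.mem_subgroupOf]
  have h1 := W.mul_mem (W.inv_mem (hδ c₀)) (hδ c)
  have e : (((δ c₀ : G) * x c₀)⁻¹ * c₀)⁻¹ * (((δ c : G) * x c)⁻¹ * c) =
      (δ c * (δ c₀ : G)⁻¹ * c₀)⁻¹ * c := by rw [hx]; group
  rw [e] at h1
  exact h1

end Centralizers

section KernelBound

lemma ActsFreely.disjoint_tile {G : Type*} [Group G] {Γ W : Subgroup G}
    (h : ActsFreely Γ W) (z : G) :
    Pairwise (Function.onFun Disjoint fun γ : Γ => {g | ((γ : G) * z)⁻¹ * g ∈ W}) := by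
  intro γ γ' hne
  rw [Function.onFun, Set.disjoint_left]
  intro g h1 h2
  refine hne ?_
  have h3 := W.mul_mem h2 (W.inv_mem h1)
  have e : (((γ' : G) * z)⁻¹ * g) * (((γ : G) * z)⁻¹ * g)⁻¹ =
      z⁻¹ * ((γ'⁻¹ * γ : Γ) : G) * z := by push_cast; group
  rw [e] at h3
  have h4 : γ'⁻¹ * γ = 1 := Subtype.ext (h z _ (γ'⁻¹ * γ).2 h3)
  exact (inv_mul_eq_one.mp h4).symm

variable {G : Type*} [Group G] [TopologicalSpace G] [IsTopologicalGroup G]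
  [MeasurableSpace G] [BorelSpace G] (μ : Measure G)
  {Γ W : Subgroup G} {f : G → ℂ}

/-- The sets `γ z W` are disjoint, and `g ↦ f (y⁻¹ g)` is constant on each of them. -/
lemma ActsFreely.tsum_enorm_le [Countable Γ] [μ.IsMulLeftInvariant] (h : ActsFreely Γ W)
    (hWo : IsOpen (W : Set G)) (hf : ∀ g, ∀ k ∈ W, f (g * k) = f g) (y z : G) :
    (∑' γ : Γ, ‖f (y⁻¹ * γ * z)‖ₑ) * μ W ≤ ∫⁻ g, ‖f g‖ₑ ∂μ := by
  rw [← lintegral_mul_left_eq_self (fun g => ‖f g‖ₑ) y⁻¹, ← ENNReal.tsum_mul_right]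
  calc ∑' γ : Γ, ‖f (y⁻¹ * γ * z)‖ₑ * μ W
      = ∑' γ : Γ, ∫⁻ g in {g | ((γ : G) * z)⁻¹ * g ∈ W}, ‖f (y⁻¹ * g)‖ₑ ∂μ := by
        refine tsum_congr fun γ => ?_
        rw [← measure_tile μ ((γ : G) * z), ← setLIntegral_const]
        refine setLIntegral_congr_fun (measurableSet_tile hWo _) fun g hg => ?_
        rw [← hf (y⁻¹ * γ * z) _ hg]
        congr 2; group
    _ = ∫⁻ g in ⋃ γ : Γ, {g | ((γ : G) * z)⁻¹ * g ∈ W}, ‖f (y⁻¹ * g)‖ₑ ∂μ :=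
        (lintegral_iUnion (fun γ => measurableSet_tile hWo _) (h.disjoint_tile z) _).symm
    _ ≤ _ := setLIntegral_le_lintegral _ _

end KernelBound

section Unfolding

variable {G : Type*} [Group G] {Γ : Subgroup G}

/-- The inclusion of `Γ ∩ C`, as a subgroup of `C`, into `Γ`. -/
def toLattice (C : Subgroup G) (σ : Γ.subgroupOf C) : Γ :=
  ⟨((σ : C) : G), Subgroup.mem_subgroupOf.mp σ.2⟩

lemma toLattice_injective (C : Subgroup G) : Function.Injective (toLattice (Γ := Γ) C) :=
  fun _ _ h => Subtype.ext (Subtype.ext (congrArg (fun δ : Γ => (δ : G)) h))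

/-- Every element of `Γ` is uniquely of the form `δ_{γ'}⁻¹ σ` with `σ ∈ Γ_γ` and `γ'` conjugate
to `γ`, where the `δ_{γ'}` are chosen such that `γ' = δ_{γ'}⁻¹ γ δ_{γ'}`. -/
lemma bijective_inv_mul (γ : Γ) (δ : {γ' : Γ // IsConj γ γ'} → Γ)
    (hδ : ∀ γ', (δ γ')⁻¹ * γ * δ γ' = γ'.1) :
    Function.Bijective fun p : (Γ.subgroupOf (Subgroup.centralizer {(γ : G)})) ×
      {γ' : Γ // IsConj γ γ'} =>
      (δ p.2)⁻¹ * toLattice _ p.1 := by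
  have hcomm : ∀ σ : Γ.subgroupOf (Subgroup.centralizer {(γ : G)}),
      ((σ : Subgroup.centralizer {(γ : G)}) : G) * γ = γ * (σ : Subgroup.centralizer {(γ : G)}) :=
    fun σ => Subgroup.mem_centralizer_singleton_iff.mp σ.1.2
  have hcomm' : ∀ σ : Γ.subgroupOf (Subgroup.centralizer {(γ : G)}),
      toLattice _ σ * γ =
        γ * toLattice _ σ := fun σ => Subtype.ext (hcomm σ)
  constructor
  · rintro ⟨σ, a⟩ ⟨τ, b⟩ h
    simp only at h
    have key : ∀ (σ : Γ.subgroupOf (Subgroup.centralizer {(γ : G)})) a,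
        ((δ a)⁻¹ * toLattice _ σ) * γ *
        ((δ a)⁻¹ * toLattice _ σ)⁻¹ = a.1 := by
      intro σ a
      rw [mul_assoc (δ a)⁻¹, hcomm' σ, ← hδ a]
      group
    have hab : a = b := Subtype.ext (by rw [← key σ a, h, key τ b])
    subst hab
    have := mul_left_cancel h
    exact Prod.ext (toLattice_injective _ this) rfl
  · intro ε
    let a : {γ' : Γ // IsConj γ γ'} := ⟨ε * γ * ε⁻¹, isConj_iff.mpr ⟨ε, rfl⟩⟩
    have ha : (δ a)⁻¹ * γ * δ a = ε * γ * ε⁻¹ := hδ a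
    have h1 : δ a * ε * γ = γ * (δ a * ε) := by
      calc δ a * ε * γ = δ a * (ε * γ * ε⁻¹) * ε := by group
        _ = γ * (δ a * ε) := by rw [← ha]; group
    refine ⟨(⟨⟨((δ a * ε : Γ) : G), ?_⟩, (δ a * ε).2⟩, a), ?_⟩
    · rw [Subgroup.mem_centralizer_singleton_iff]
      exact congrArg Subtype.val h1
    · exact inv_mul_cancel_left (δ a) ε

variable [MeasurableSpace G] {μ : Measure G} {D : Set G}

/-- Unfolding twice, along `Γ ∩ C \ C` and along `C \ G`: if the `δ_j⁻¹` represent the cosets of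
`Γ ∩ C` in `Γ`, the sum of the restrictions of `μ` to the translates `δ_j D` of a fundamental
domain `D` for `Γ` projects to `vol(Γ ∩ C \ C)` times the invariant measure on `C \ G`. -/
lemma map_sum_restrict_eq [MeasurableMul₂ G] [Countable Γ] [MeasurableSingletonClass G]
    (hD : MeasurableSet D) (hΓ : IsWeight Γ Measure.count (D.indicator 1)) {C : Subgroup G}
    {η : Measure C} {J : Type*} [Countable J] (δ : J → Γ)
    (hδ : Function.Bijective fun p : Γ.subgroupOf C × J => (δ p.2)⁻¹ * toLattice C p.1)
    (hη : IsQuotientMeasure (Γ.subgroupOf C) η Measure.count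
      (quotientMeasure (Γ.subgroupOf C) η Measure.count))
    (hμ : IsQuotientMeasure C μ η (quotientMeasure C μ η)) :
    (Measure.sum fun j => μ.restrict {g | ((δ j : G))⁻¹ * g ∈ D}).map (toQuot C) =
      quotientMeasure (Γ.subgroupOf C) η Measure.count Set.univ • quotientMeasure C μ η := by
  have hcΓC : Countable (Γ.subgroupOf C) := (toLattice_injective C).countable
  set vol := quotientMeasure (Γ.subgroupOf C) η Measure.count Set.univ
  let T : J → Set G := fun j => {g | ((δ j : G))⁻¹ * g ∈ D}
  have hT : ∀ j, MeasurableSet (T j) := fun j => hD.preimage (measurable_const_mul _)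
  let a : G → ℝ≥0∞ := fun g => ∑' j, (T j).indicator 1 g
  have ha : Measurable a := Measurable.tsum fun j => measurable_one.indicator (hT j)
  have h1 : ∀ y : G, ∫⁻ σ : Γ.subgroupOf C, a ((σ : C) * y) ∂Measure.count = 1 := by
    intro y
    rw [lintegral_count, ← hΓ.lintegral_eq_one y, lintegral_count]
    rw [← ENNReal.tsum_prod (f := fun (σ : Γ.subgroupOf C) j =>
      (T j).indicator (1 : G → ℝ≥0∞) ((σ : C) * y))]
    rw [← (Equiv.ofBijective _ hδ).tsum_eq]
    refine tsum_congr fun p => ?_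
    change (T p.2).indicator 1 (((p.1 : C) : G) * y) =
      D.indicator 1 ((((δ p.2)⁻¹ * toLattice _ p.1 : Γ) : G) * y)
    have e : (((δ p.2)⁻¹ * toLattice _ p.1 : Γ) : G) * y =
        (δ p.2 : G)⁻¹ * (((p.1 : C) : G) * y) := by
      push_cast; rw [mul_assoc]; rfl
    rw [e]; rfl
  have h2 : ∀ y : G, ∫⁻ h : C, a (h * y) ∂η = vol := by
    intro y
    have hm : Measurable fun h : C => a (h * y) :=
      ha.comp (measurable_subtype_coe.mul_const y)
    rw [← hη _ hm]
    have : ∀ q : LeftQuot (Γ.subgroupOf C),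
        ∫⁻ σ : Γ.subgroupOf C, a ((((σ : C) * q.out : C) : G) * y) ∂Measure.count = 1 := by
      intro q
      rw [← h1 (q.out * y)]
      refine lintegral_congr fun σ => ?_
      rw [Subgroup.coe_mul, mul_assoc]
    simp only [this, lintegral_one]
    rfl
  ext A hA
  have hA' : MeasurableSet (toQuot C ⁻¹' A) := measurable_toQuot C hA
  rw [Measure.map_apply (measurable_toQuot C) hA, Measure.sum_apply _ hA', Measure.smul_apply,
    smul_eq_mul]
  have h3 := hμ ((toQuot C ⁻¹' A).indicator a) (ha.indicator hA')
  have hq : ∀ (h : C) (q : LeftQuot C), toQuot C (h * q.out) = q := fun h q => by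
    conv_rhs => rw [← Quotient.out_eq q]
    exact Quotient.sound (MulAction.orbitRel_apply.mpr ⟨h, rfl⟩)
  have h4 : ∀ q : LeftQuot C, ∫⁻ h : C, (toQuot C ⁻¹' A).indicator a (h * q.out) ∂η =
      A.indicator (fun _ => vol) q := by
    intro q
    by_cases hqA : q ∈ A
    · rw [Set.indicator_of_mem hqA, ← h2 q.out]
      refine lintegral_congr fun h => ?_
      rw [Set.indicator_of_mem]
      rwa [Set.mem_preimage, hq]
    · rw [Set.indicator_of_notMem hqA, ← lintegral_zero (μ := η)]
      refine lintegral_congr fun h => ?_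
      rw [Set.indicator_of_notMem]
      rwa [Set.mem_preimage, hq]
  simp only [h4] at h3
  rw [lintegral_indicator_const hA] at h3
  rw [h3, lintegral_indicator hA', lintegral_tsum fun j =>
    (measurable_one.indicator (hT j)).aemeasurable]
  refine tsum_congr fun j => ?_
  rw [lintegral_indicator_one (hT j), Measure.restrict_apply hA', Measure.restrict_apply (hT j),
    Set.inter_comm]

end Unfolding

/-! ### The geometric side -/

lemma countable_of_discreteTopology {G : Type*} [Group G] [TopologicalSpace G]
    [SecondCountableTopology G] (Γ : Subgroup G) [DiscreteTopology Γ] : Countable Γ :=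
  TopologicalSpace.separableSpace_iff_countable.mp inferInstance

lemma isClosed_centralizer {G : Type*} [Group G] [TopologicalSpace G] [IsTopologicalGroup G]
    [T2Space G] (g : G) : IsClosed (Subgroup.centralizer {g} : Set G) := by
  have : (Subgroup.centralizer {g} : Set G) = {h | h * g = g * h} := by
    ext h; exact Subgroup.mem_centralizer_singleton_iff
  rw [this]
  exact isClosed_eq (by fun_prop) (by fun_prop)

lemma IsTiling.exists_finset_cover {G : Type*} [Group G] {Γ W : Subgroup G} {ι : Type*}
    [Finite ι] {x : ι → G} (h : IsTiling Γ W x) :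
    ∃ s : Finset G, ∀ g : G, ∃ γ : Γ, ∃ y ∈ s, ((γ : G) * y)⁻¹ * g ∈ W := by
  classical
  have := Fintype.ofFinite ι
  refine ⟨Finset.univ.image x, fun g => ?_⟩
  obtain ⟨γ, i, hi⟩ := h.cover g
  exact ⟨γ, x i, Finset.mem_image_of_mem _ (Finset.mem_univ i), hi⟩

section CentralizerVolume

variable {G : Type*} [Group G] [TopologicalSpace G] [IsTopologicalGroup G]
  [LocallyCompactSpace G] [SecondCountableTopology G] [T2Space G]
  [MeasurableSpace G] [BorelSpace G] (μ : Measure G) [μ.IsHaarMeasure]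
  {Γ W : Subgroup G} [DiscreteTopology Γ] {ι : Type*} [Finite ι] {x : ι → G}

/-- The centralizer `G_γ` is unimodular because it contains the cocompact lattice `Γ_γ`; so the
quotient measures on `Γ_γ \ G_γ` and `G_γ \ G` exist, and the former is finite. -/
lemma centralizer_quotientMeasures (hfree : ActsFreely Γ W) (hx : IsTiling Γ W x)
    (hWo : IsOpen (W : Set G)) (hWc : IsCompact (W : Set G)) (γ : Γ)
    (η : Measure (Subgroup.centralizer {(γ : G)})) [η.IsHaarMeasure] :
    IsQuotientMeasure (Γ.subgroupOf (Subgroup.centralizer {(γ : G)})) η Measure.count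
      (quotientMeasure (Γ.subgroupOf (Subgroup.centralizer {(γ : G)})) η Measure.count) ∧
    IsQuotientMeasure (Subgroup.centralizer {(γ : G)}) μ η
      (quotientMeasure (Subgroup.centralizer {(γ : G)}) μ η) ∧
    centralizerVolume Γ (γ : G) η < ∞ ∧ centralizerVolume Γ (γ : G) η ≠ 0 := by
  have hcl := isClosed_centralizer (γ : G)
  have : LocallyCompactSpace (Subgroup.centralizer {(γ : G)}) :=
    hcl.isClosedEmbedding_subtypeVal.locallyCompactSpace
  have : SecondCountableTopology (Subgroup.centralizer {(γ : G)}) :=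
    Topology.IsEmbedding.subtypeVal.secondCountableTopology
  have hWo' : IsOpen (W.subgroupOf (Subgroup.centralizer {(γ : G)}) :
      Set (Subgroup.centralizer {(γ : G)})) := hWo.preimage continuous_subtype_val
  have hWc' : IsCompact (W.subgroupOf (Subgroup.centralizer {(γ : G)}) :
      Set (Subgroup.centralizer {(γ : G)})) :=
    hcl.isClosedEmbedding_subtypeVal.isCompact_preimage hWc
  have := countable_of_discreteTopology Γ
  have : Countable (Γ.subgroupOf (Subgroup.centralizer {(γ : G)})) :=
    (toLattice_injective _).countable
  obtain ⟨s, hs⟩ := (hfree.subgroupOf (Subgroup.centralizer {(γ : G)})).exists_isTiling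
    (exists_finset_cover_centralizer hWc hx.exists_finset_cover γ)
  have := hs.isMulRightInvariant η hWo' hWc'
  have := isInvInvariant_of_isMulRightInvariant η hWo' hWc'
  have hw := hs.isWeight hWo'
  obtain ⟨w, hw'⟩ := exists_isWeight hcl η hWo hWc
  refine ⟨hw.quotientMeasure_spec, hw'.quotientMeasure_spec, ?_⟩
  have hvol : centralizerVolume Γ (γ : G) η =
      η (domain (W.subgroupOf (Subgroup.centralizer {(γ : G)})) fun i : s => i.1) := by
    rw [centralizerVolume, hw.quotientMeasure_eq (μ := η),
      Measure.map_apply (measurable_toQuot _) MeasurableSet.univ, Set.preimage_univ,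
      withDensity_apply _ MeasurableSet.univ, Measure.restrict_univ,
      lintegral_indicator_one (measurableSet_domain hWo')]
  rw [hvol]
  refine ⟨measure_domain_lt_top η hWc', ?_⟩
  obtain ⟨_, i, _⟩ := hs.cover 1
  have hsub : {y | i.1⁻¹ * y ∈ W.subgroupOf (Subgroup.centralizer {(γ : G)})} ⊆
    domain (W.subgroupOf (Subgroup.centralizer {(γ : G)})) fun i : s => i.1 := fun y hy => ⟨i, hy⟩
  exact (lt_of_lt_of_le ((isOpen_tile hWo' i.1).measure_pos η ⟨i.1, by simp⟩)
    (measure_mono hsub)).ne'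

end CentralizerVolume

section Character

variable {G : Type*} [Group G] {Γ : Subgroup G}
  {V : Type*} [NormedAddCommGroup V] [InnerProductSpace ℂ V] (ω : Γ →* (V ≃ₗᵢ[ℂ] V))

/-- The character of `ω`. -/
def character (γ : Γ) : ℂ :=
  LinearMap.trace ℂ V (ω γ).toLinearEquiv.toLinearMap

lemma character_eq_of_isConj {γ γ' : Γ} (h : IsConj γ γ') : character ω γ = character ω γ' := by
  obtain ⟨c, rfl⟩ := isConj_iff.mp h
  have e : (ω (c * γ * c⁻¹)).toLinearEquiv.toLinearMap =
      (ω c).toLinearEquiv.conj (ω γ).toLinearEquiv.toLinearMap := by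
    ext v
    rw [LinearEquiv.conj_apply]
    simp only [map_mul, map_inv]
    rfl
  rw [character, character, e, LinearMap.trace_conj']

lemma norm_character_le [FiniteDimensional ℂ V] (γ : Γ) : ‖character ω γ‖ ≤ Module.finrank ℂ V := by
  rw [character, LinearMap.trace_eq_sum_inner _ (stdOrthonormalBasis ℂ V)]
  refine (norm_sum_le _ _).trans ?_
  refine (Finset.sum_le_sum (g := fun _ => (1 : ℝ)) fun i _ => ?_).trans (by simp)
  refine (norm_inner_le_norm _ _).trans ?_
  rw [OrthonormalBasis.norm_eq_one, one_mul]
  change ‖ω γ _‖ ≤ 1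
  rw [LinearIsometryEquiv.norm_map, OrthonormalBasis.norm_eq_one]

end Character

lemma conj_eq_of_mem_tile {G : Type*} [Group G] {W : Subgroup G} {f : G → ℂ}
    (hf : ∀ u ∈ W, ∀ v ∈ W, ∀ g, f (u * g * v) = f g) (g : G) {y z : G} (hz : y⁻¹ * z ∈ W) :
    f (z⁻¹ * g * z) = f (y⁻¹ * g * y) := by
  rw [← hf _ (W.inv_mem hz) _ hz (y⁻¹ * g * y)]
  congr 1; group

section Geometric

variable {G : Type*} [Group G] [TopologicalSpace G] [IsTopologicalGroup G]
  [LocallyCompactSpace G] [SecondCountableTopology G] [T2Space G]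
  [MeasurableSpace G] [BorelSpace G] (μ : Measure G) [μ.IsHaarMeasure]
  {Γ W : Subgroup G} [DiscreteTopology Γ] {ι : Type*} [Fintype ι] {x : ι → G} {f : G → ℂ}

/-- The integral of `f (y⁻¹ γ y)` over the fundamental domain `⋃ x_i W`, as a finite sum. -/
def diagonalTerm (μ : Measure G) (W : Subgroup G) (x : ι → G) (f : G → ℂ) (g : G) : ℂ :=
  (μ W).toReal * ∑ i, f ((x i)⁻¹ * g * x i)

variable (hx : IsTiling Γ W x) (hWo : IsOpen (W : Set G)) (hWc : IsCompact (W : Set G))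
  (hf : ∀ u ∈ W, ∀ v ∈ W, ∀ g, f (u * g * v) = f g)

include hWo hf in
lemma continuous_conj (g : G) : Continuous fun y => f (y⁻¹ * g * y) :=
  continuous_of_right_invariant hWo fun y k hk =>
    conj_eq_of_mem_tile hf g (by simpa using hk)

include hx hWo hf in
lemma setLIntegral_domain_conj (g : G) :
    ∫⁻ y in domain W x, ‖f (y⁻¹ * g * y)‖ₑ ∂μ = ∑ i, ‖f ((x i)⁻¹ * g * x i)‖ₑ * μ W := by
  rw [domain_eq_iUnion, lintegral_iUnion (fun i => measurableSet_tile hWo _)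
    (fun i j hij => hx.disjoint hij), tsum_fintype]
  refine Finset.sum_congr rfl fun i _ => ?_
  rw [← measure_tile μ (x i), ← setLIntegral_const]
  exact setLIntegral_congr_fun (measurableSet_tile hWo _) fun y hy => by
    rw [conj_eq_of_mem_tile hf g hy]

include hx hWo hWc hf in
lemma integrableOn_domain_conj (g : G) :
    IntegrableOn (fun y => f (y⁻¹ * g * y)) (domain W x) μ := by
  refine ⟨(continuous_conj hWo hf g).aestronglyMeasurable, ?_⟩
  rw [HasFiniteIntegral, setLIntegral_domain_conj μ hx hWo hf g]
  exact ENNReal.sum_lt_top.mpr fun i _ => ENNReal.mul_lt_top enorm_lt_top hWc.measure_lt_top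

include hx hWo hWc hf in
lemma setIntegral_domain_conj (g : G) :
    ∫ y in domain W x, f (y⁻¹ * g * y) ∂μ = diagonalTerm μ W x f g := by
  have hint := integrableOn_domain_conj μ hx hWo hWc hf g
  rw [domain_eq_iUnion] at hint ⊢
  rw [integral_iUnion (fun i => measurableSet_tile hWo _) (fun i j hij => hx.disjoint hij) hint,
    tsum_fintype, diagonalTerm, Finset.mul_sum]
  refine Finset.sum_congr rfl fun i _ => ?_
  rw [setIntegral_congr_fun (g := fun _ => f ((x i)⁻¹ * g * x i)) (measurableSet_tile hWo _)
    (fun y hy => conj_eq_of_mem_tile hf g hy), setIntegral_const, Measure.real, measure_tile,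
    Complex.real_smul]

include hWo hf in
lemma tsum_enorm_conj_lt_top (hfree : ActsFreely Γ W) (hint : Integrable f μ) :
    ∑' γ : Γ, ∑ i, ‖f ((x i)⁻¹ * γ * x i)‖ₑ * μ W < ∞ := by
  have := countable_of_discreteTopology Γ
  rw [Summable.tsum_finsetSum fun i _ => ENNReal.summable]
  refine ENNReal.sum_lt_top.mpr fun i _ => ?_
  rw [ENNReal.tsum_mul_right]
  exact (hfree.tsum_enorm_le μ hWo (fun g k hk => by simpa using hf 1 W.one_mem k hk g)
    _ _).trans_lt hint.2

lemma enorm_diagonalTerm_le (hWc : IsCompact (W : Set G)) (g : G) :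
    ‖diagonalTerm μ W x f g‖ₑ ≤ ∑ i, ‖f ((x i)⁻¹ * g * x i)‖ₑ * μ W := by
  rw [diagonalTerm, enorm_mul, ← Finset.sum_mul, mul_comm]
  refine mul_le_mul' (enorm_sum_le _ _) ?_
  rw [← ofReal_norm, Complex.norm_real, Real.norm_of_nonneg ENNReal.toReal_nonneg,
    ENNReal.ofReal_toReal hWc.measure_lt_top.ne]

include hWo hWc hf in
lemma summable_norm_diagonalTerm (hfree : ActsFreely Γ W) (hint : Integrable f μ) :
    Summable fun γ : Γ => ‖diagonalTerm μ W x f γ‖ := by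
  have h : ∑' γ : Γ, ‖diagonalTerm μ W x f γ‖ₑ ≠ ∞ :=
    ((ENNReal.tsum_le_tsum fun γ : Γ => enorm_diagonalTerm_le μ hWc (γ : G)).trans_lt
      (tsum_enorm_conj_lt_top μ hWo hf hfree hint)).ne
  have := ENNReal.summable_toReal h
  simpa using this

include hx hWo hWc hf in
/-- The orbital integral over `G_γ \ G`, in terms of the fundamental domain `⋃ x_i W` for `Γ`. -/
lemma orbitalIntegral_eq (hfree : ActsFreely Γ W) (hint : Integrable f μ) (γ : Γ)
    (η : Measure (Subgroup.centralizer {(γ : G)})) [η.IsHaarMeasure] :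
    Integrable (orbitFunction f (γ : G))
      (quotientMeasure (Subgroup.centralizer {(γ : G)}) μ η) ∧
    ((centralizerVolume Γ (γ : G) η).toReal : ℂ) * orbitalIntegral μ (γ : G) η f =
      ∑' γ' : {γ' : Γ // IsConj γ γ'}, diagonalTerm μ W x f γ'.1 := by
  have := countable_of_discreteTopology Γ
  obtain ⟨hη, hμ, hfin, hpos⟩ := centralizer_quotientMeasures μ hfree hx hWo hWc γ η
  have hδ' : ∀ γ' : {γ' : Γ // IsConj γ γ'}, ∃ δ : Γ, δ⁻¹ * γ * δ = γ'.1 := fun γ' => by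
    obtain ⟨c, hc⟩ := isConj_iff.mp γ'.2
    exact ⟨c⁻¹, by simpa using hc⟩
  choose δ hδ using hδ'
  have hmap := map_sum_restrict_eq (measurableSet_domain hWo) (hx.isWeight hWo) δ
    (bijective_inv_mul γ δ hδ) hη hμ
  rw [← centralizerVolume] at hmap
  have hcont := continuous_conj hWo hf (γ : G)
  have hmeas : Measurable (orbitFunction f (γ : G)) :=
    measurable_from_quotient.mpr hcont.measurable
  have hpres : ∀ γ', MeasurePreserving (fun g => (δ γ' : G)⁻¹ * g)
      (μ.restrict {g | ((δ γ' : G))⁻¹ * g ∈ domain W x}) (μ.restrict (domain W x)) := fun γ' =>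
    (measurePreserving_mul_left μ (δ γ' : G)⁻¹).restrict_preimage (measurableSet_domain hWo)
  have hconj : ∀ (γ' : {γ' : Γ // IsConj γ γ'}) (g : G), f (g⁻¹ * γ * g) =
      f (((δ γ' : G)⁻¹ * g)⁻¹ * (γ'.1 : G) * ((δ γ' : G)⁻¹ * g)) := by
    intro γ' g
    have : (γ'.1 : G) = (δ γ' : G)⁻¹ * γ * δ γ' := by rw [← hδ γ']; push_cast; rfl
    rw [this]; congr 1; group
  -- integrability upstairs, on the sum of the translates `δ_{γ'} D`, by the bound over all of `Γ`
  have hl : ∫⁻ g, ‖f (g⁻¹ * γ * g)‖ₑ ∂(Measure.sum fun γ' : {γ' : Γ // IsConj γ γ'} =>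
      μ.restrict {g | ((δ γ' : G))⁻¹ * g ∈ domain W x}) < ∞ := by
    rw [lintegral_sum_measure]
    refine lt_of_le_of_lt ?_ (tsum_enorm_conj_lt_top (x := x) μ hWo hf hfree hint)
    refine le_trans (ENNReal.tsum_le_tsum fun γ' => le_of_eq ?_)
      (ENNReal.tsum_comp_le_tsum_of_injective Subtype.val_injective
        fun γ : Γ => ∑ i, ‖f ((x i)⁻¹ * γ * x i)‖ₑ * μ W)
    rw [← setLIntegral_domain_conj μ hx hWo hf,
      ← (hpres γ').lintegral_comp (continuous_conj hWo hf (γ'.1 : G)).measurable.enorm]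
    exact lintegral_congr fun g => by rw [hconj γ' g]
  have hint' : Integrable (fun g => f (g⁻¹ * γ * g))
      (Measure.sum fun γ' : {γ' : Γ // IsConj γ γ'} =>
      μ.restrict {g | ((δ γ' : G))⁻¹ * g ∈ domain W x}) := ⟨hcont.aestronglyMeasurable, hl⟩
  constructor
  · have h1 : Integrable (orbitFunction f (γ : G)) (centralizerVolume Γ (γ : G) η •
        quotientMeasure (Subgroup.centralizer {(γ : G)}) μ η) := by
      rw [← hmap]
      exact (integrable_map_measure hmeas.aestronglyMeasurable
        (measurable_toQuot _).aemeasurable).mpr hint'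
    exact (integrable_smul_measure hpos hfin.ne).mp h1
  · have h1 : ((centralizerVolume Γ (γ : G) η).toReal : ℂ) * orbitalIntegral μ (γ : G) η f =
        ∫ q, orbitFunction f (γ : G) q ∂(centralizerVolume Γ (γ : G) η •
          quotientMeasure (Subgroup.centralizer {(γ : G)}) μ η) := by
      rw [integral_smul_measure, Complex.real_smul, orbitalIntegral]
    rw [h1, ← hmap, integral_map (measurable_toQuot _).aemeasurable hmeas.aestronglyMeasurable]
    change ∫ g, f (g⁻¹ * γ * g) ∂_ = _
    rw [integral_sum_measure hint']
    refine tsum_congr fun γ' => ?_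
    rw [← setIntegral_domain_conj μ hx hWo hWc hf,
      ← (hpres γ').integral_comp (measurableEmbedding_mulLeft _)]
    exact integral_congr_ae (Filter.Eventually.of_forall fun g => hconj γ' g)

variable {V : Type*} [NormedAddCommGroup V] [InnerProductSpace ℂ V] [FiniteDimensional ℂ V]
  (ω : Γ →* (V ≃ₗᵢ[ℂ] V))

include hWo hWc hf in
lemma summable_norm_character_mul (hfree : ActsFreely Γ W) (hint : Integrable f μ) :
    Summable fun γ : Γ => ‖character ω γ * diagonalTerm μ W x f γ‖ := by
  refine Summable.of_nonneg_of_le (fun _ => norm_nonneg _) (fun γ => ?_)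
    ((summable_norm_diagonalTerm (x := x) μ hWo hWc hf hfree hint).mul_left
      (Module.finrank ℂ V : ℝ))
  rw [norm_mul]
  exact mul_le_mul_of_nonneg_right (norm_character_le ω γ) (norm_nonneg _)

include hx hWo hWc hf in
/-- The geometric side, grouped by conjugacy classes. -/
lemma geometric_side (hfree : ActsFreely Γ W) (hint : Integrable f μ)
    (η : ∀ γ : Γ, Measure (Subgroup.centralizer {(γ : G)})) [∀ γ, (η γ).IsHaarMeasure]
    (r : ConjClasses Γ → Γ) (hr : ∀ c, ConjClasses.mk (r c) = c) :
    Summable (fun c => ‖geometricTerm Γ ω μ η f (r c)‖) ∧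
      ∑' c, geometricTerm Γ ω μ η f (r c) = ∑' γ : Γ, character ω γ * diagonalTerm μ W x f γ := by
  let F : Γ → ℂ := fun γ => character ω γ * diagonalTerm μ W x f γ
  have hF : Summable fun γ => ‖F γ‖ := summable_norm_character_mul μ hWo hWc hf ω hfree hint
  let e : (Σ c : ConjClasses Γ, {γ' : Γ // ConjClasses.mk γ' = c}) ≃ Γ :=
    Equiv.sigmaFiberEquiv ConjClasses.mk
  have hFe : Summable fun p => ‖F (e p)‖ := e.summable_iff.mpr hF
  have hterm : ∀ c, geometricTerm Γ ω μ η f (r c) =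
      ∑' γ' : {γ' : Γ // ConjClasses.mk γ' = c}, F (e ⟨c, γ'⟩) := by
    intro c
    rw [geometricTerm, mul_assoc,
      (orbitalIntegral_eq μ hx hWo hWc hf hfree hint (r c) (η (r c))).2, ← tsum_mul_left]
    have heq : ∀ γ' : Γ, IsConj (r c) γ' ↔ ConjClasses.mk γ' = c := fun γ' => by
      rw [← ConjClasses.mk_eq_mk_iff_isConj, hr c, eq_comm]
    rw [← (Equiv.subtypeEquivRight heq).tsum_eq]
    refine tsum_congr fun γ' => ?_
    change character ω (r c) * _ = character ω γ'.1 * _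
    rw [character_eq_of_isConj ω γ'.2]
    rfl
  constructor
  · have h1 := hFe.sigma
    refine Summable.of_nonneg_of_le (fun _ => norm_nonneg _) (fun c => ?_) h1
    rw [hterm c]
    exact norm_tsum_le_tsum_norm (hFe.sigma_factor c)
  · rw [← e.tsum_eq (fun γ => F γ), hFe.of_norm.tsum_sigma]
    exact tsum_congr hterm

end Geometric

/-! ### Irreducible subrepresentations and decomposition -/

section Representations

variable {G : Type*} [Group G] {𝓗 : Type*} [NormedAddCommGroup 𝓗] [InnerProductSpace ℂ 𝓗]
  (R : G →* (𝓗 ≃ₗᵢ[ℂ] 𝓗)) (W : Subgroup G)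

/-- The vectors fixed by the subgroup `W`. -/
def fixedVectors : Submodule ℂ 𝓗 where
  carrier := {v | ∀ k ∈ W, R k v = v}
  zero_mem' := fun _ _ => map_zero _
  add_mem' := fun hv hw k hk => by rw [map_add, hv k hk, hw k hk]
  smul_mem' := fun c v hv k hk => by rw [map_smul, hv k hk]

/-- Closed invariant subspaces. -/
structure IsClosedInvariant (Z : Submodule ℂ 𝓗) : Prop where
  isClosed : IsClosed (Z : Set 𝓗)
  map_mem : ∀ g, ∀ v ∈ Z, R g v ∈ Z

variable {R W}

lemma rep_mul_apply (g h : G) (v : 𝓗) : R (g * h) v = R g (R h v) := by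
  rw [map_mul]; rfl

lemma rep_one_apply (v : 𝓗) : R 1 v = v := by rw [map_one]; rfl

lemma rep_inv_apply_apply (g : G) (v : 𝓗) : R g⁻¹ (R g v) = v := by
  rw [← rep_mul_apply, inv_mul_cancel, rep_one_apply]

lemma rep_apply_inv_apply (g : G) (v : 𝓗) : R g (R g⁻¹ v) = v := by
  rw [← rep_mul_apply, mul_inv_cancel, rep_one_apply]

lemma inner_rep_right (g : G) (v w : 𝓗) : inner ℂ v (R g w) = inner ℂ (R g⁻¹ v) w := by
  rw [← LinearIsometryEquiv.inner_map_map (R g) (R g⁻¹ v), rep_apply_inv_apply]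

lemma IsClosedInvariant.inf {Z Z' : Submodule ℂ 𝓗} (h : IsClosedInvariant R Z)
    (h' : IsClosedInvariant R Z') : IsClosedInvariant R (Z ⊓ Z') :=
  ⟨h.isClosed.inter h'.isClosed, fun g v hv => ⟨h.map_mem g v hv.1, h'.map_mem g v hv.2⟩⟩

lemma IsClosedInvariant.orthogonal {Z : Submodule ℂ 𝓗} (h : IsClosedInvariant R Z) :
    IsClosedInvariant R Zᗮ :=
  ⟨Z.isClosed_orthogonal, fun g v hv => (Submodule.mem_orthogonal _ _).mpr fun z hz => by
    rw [inner_rep_right]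
    exact (Submodule.mem_orthogonal _ _).mp hv _ (h.map_mem g⁻¹ z hz)⟩

lemma IsClosedInvariant.top : IsClosedInvariant R (⊤ : Submodule ℂ 𝓗) :=
  ⟨isClosed_univ, fun _ _ _ => trivial⟩

/-- The closed invariant subspace generated by a subspace. -/
def generatedSubspace (R : G →* (𝓗 ≃ₗᵢ[ℂ] 𝓗)) (S : Submodule ℂ 𝓗) : Submodule ℂ 𝓗 :=
  (Submodule.span ℂ {v | ∃ g, ∃ s ∈ S, v = R g s}).topologicalClosure

lemma le_generatedSubspace (S : Submodule ℂ 𝓗) : S ≤ generatedSubspace R S := fun s hs =>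
  Submodule.le_topologicalClosure _ (Submodule.subset_span ⟨1, s, hs, (rep_one_apply s).symm⟩)

lemma generatedSubspace_le {S Z : Submodule ℂ 𝓗} (hZ : IsClosedInvariant R Z) (h : S ≤ Z) :
    generatedSubspace R S ≤ Z := by
  refine Submodule.topologicalClosure_minimal _ (Submodule.span_le.mpr ?_) hZ.isClosed
  rintro _ ⟨g, s, hs, rfl⟩
  exact hZ.map_mem g s (h hs)

lemma isClosedInvariant_generatedSubspace (S : Submodule ℂ 𝓗) :
    IsClosedInvariant R (generatedSubspace R S) := by
  refine ⟨Submodule.isClosed_topologicalClosure _, fun g v hv => ?_⟩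
  have h1 : Submodule.span ℂ {v | ∃ g, ∃ s ∈ S, v = R g s} ≤
      (Submodule.span ℂ {v | ∃ g, ∃ s ∈ S, v = R g s}).comap
        (R g).toLinearEquiv.toLinearMap := by
    refine Submodule.span_le.mpr ?_
    rintro _ ⟨h, s, hs, rfl⟩
    exact Submodule.subset_span ⟨g * h, s, hs, (rep_mul_apply g h s).symm⟩
  exact map_mem_closure (R g).continuous hv fun w hw => h1 hw

lemma IsClosedInvariant.starProjection_mem_fixedVectors {Z : Submodule ℂ 𝓗}
    (hZ : IsClosedInvariant R Z) [Z.HasOrthogonalProjection] {v : 𝓗}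
    (hv : v ∈ fixedVectors R W) : Z.starProjection v ∈ fixedVectors R W := by
  intro k hk
  have h : Z.starProjection v = R k (Z.starProjection v) := by
    refine Submodule.eq_starProjection_of_mem_orthogonal
      (hZ.map_mem k _ (Z.starProjection_apply_mem v)) ?_
    have := hZ.orthogonal.map_mem k _ (Z.sub_starProjection_mem_orthogonal v)
    rwa [map_sub, hv k hk] at this
  exact h.symm

variable [CompleteSpace 𝓗]

/-- A closed invariant subspace with a nonzero `W`-fixed vector contains an irreducible one: among
the closed invariant subspaces of `Z`, take one whose space of `W`-fixed vectors is nonzero of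
minimal dimension; these vectors generate an irreducible subspace. -/
lemma exists_irreducible_le [FiniteDimensional ℂ (fixedVectors R W)] {Z : Submodule ℂ 𝓗}
    (hZ : IsClosedInvariant R Z) (hne : Z ⊓ fixedVectors R W ≠ ⊥) :
    ∃ S : Submodule ℂ 𝓗, S ≤ fixedVectors R W ∧ S ≠ ⊥ ∧ generatedSubspace R S ≤ Z ∧
      ∀ A ≤ generatedSubspace R S, IsClosedInvariant R A → A = ⊥ ∨ A = generatedSubspace R S := by
  have hfd : ∀ A : Submodule ℂ 𝓗, FiniteDimensional ℂ (A ⊓ fixedVectors R W : Submodule ℂ 𝓗) :=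
    fun A => Submodule.finiteDimensional_of_le inf_le_right
  obtain ⟨Y, ⟨hYZ, hY, hYne⟩, hmin⟩ := WellFounded.has_min
    (measure fun A : Submodule ℂ 𝓗 =>
      Module.finrank ℂ (A ⊓ fixedVectors R W : Submodule ℂ 𝓗)).wf
    {A | A ≤ Z ∧ IsClosedInvariant R A ∧ A ⊓ fixedVectors R W ≠ ⊥} ⟨Z, le_rfl, hZ, hne⟩
  have hgenY := generatedSubspace_le hY (inf_le_left : Y ⊓ fixedVectors R W ≤ Y)
  refine ⟨Y ⊓ fixedVectors R W, inf_le_right, hYne, hgenY.trans hYZ, fun A hAle hA => ?_⟩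
  by_cases hAX : A ⊓ fixedVectors R W = ⊥
  · left
    have : CompleteSpace A := hA.isClosed.completeSpace_coe
    -- the generators project to `W`-fixed vectors of `A`, which are zero
    have h1 : Y ⊓ fixedVectors R W ≤ Aᗮ := fun v hv => by
      have h2 : A.starProjection v ∈ A ⊓ fixedVectors R W :=
        ⟨A.starProjection_apply_mem v, hA.starProjection_mem_fixedVectors hv.2⟩
      rw [hAX, Submodule.mem_bot] at h2
      have h3 := A.sub_starProjection_mem_orthogonal v
      rwa [h2, sub_zero] at h3
    have h4 := hAle.trans (generatedSubspace_le hA.orthogonal h1)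
    rw [eq_bot_iff, ← A.inf_orthogonal_eq_bot]
    exact le_inf le_rfl h4
  · right
    have hAY := hAle.trans hgenY
    have h1 : A ⊓ fixedVectors R W = Y ⊓ fixedVectors R W := by
      refine Submodule.eq_of_le_of_finrank_le (inf_le_inf_right _ hAY) ?_
      exact not_lt.mp (hmin A ⟨hAY.trans hYZ, hA, hAX⟩)
    refine le_antisymm hAle (generatedSubspace_le hA ?_)
    rw [← h1]
    exact inf_le_left

end Representations

section Realization

variable {G : Type*} [Group G] [TopologicalSpace G] [IsTopologicalGroup G]
  {𝓗 : Type*} [NormedAddCommGroup 𝓗] [InnerProductSpace ℂ 𝓗] {R : G →* (𝓗 ≃ₗᵢ[ℂ] 𝓗)}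
  {W : Subgroup G}

lemma continuous_orbit_of_fixed (hWo : IsOpen (W : Set G)) {v : 𝓗} (hv : v ∈ fixedVectors R W) :
    Continuous fun g => R g v :=
  continuous_of_right_invariant hWo fun g k hk => by rw [rep_mul_apply, hv k hk]

/-- The vectors with continuous orbit maps form a closed subspace, because the representation is
by isometries. -/
lemma continuous_orbit_of_mem_generatedSubspace (hWo : IsOpen (W : Set G)) {S : Submodule ℂ 𝓗}
    (hS : S ≤ fixedVectors R W) {v : 𝓗} (hv : v ∈ generatedSubspace R S) :
    Continuous fun g => R g v := by
  let E : Submodule ℂ 𝓗 :=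
    { carrier := {v | Continuous fun g => R g v}
      zero_mem' := by simpa using continuous_const
      add_mem' := fun {a b} ha hb => by
        simp only [Set.mem_ofPred_eq, map_add] at ha hb ⊢
        exact ha.add hb
      smul_mem' := fun c a ha => by
        simp only [Set.mem_ofPred_eq, map_smul] at ha ⊢
        exact ha.const_smul c }
  have hE : IsClosed (E : Set 𝓗) := by
    refine isClosed_of_closure_subset fun v hv => ?_
    change Continuous fun g => R g v
    refine continuous_of_uniform_approx_of_continuous fun u hu => ?_
    obtain ⟨ε, hε, hεu⟩ := Metric.mem_uniformity_dist.mp hu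
    obtain ⟨w, hw, hd⟩ := Metric.mem_closure_iff.mp hv ε hε
    exact ⟨fun g => R g w, hw, fun g => hεu (by rwa [LinearIsometryEquiv.dist_map])⟩
  refine Submodule.topologicalClosure_minimal _ (Submodule.span_le.mpr ?_) hE hv
  rintro _ ⟨h, s, hs, rfl⟩
  have := (continuous_orbit_of_fixed hWo (hS hs)).comp (continuous_mul_const h)
  change Continuous fun g => R g (R h s)
  simpa only [Function.comp_def, rep_mul_apply] using this

/-- Translates of `W`-fixed vectors by a dense sequence in `G` are all the translates. -/
lemma isSeparable_generatedSubspace [SecondCountableTopology G] (hWo : IsOpen (W : Set G))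
    {S : Submodule ℂ 𝓗} [FiniteDimensional ℂ S] (hS : S ≤ fixedVectors R W) :
    TopologicalSpace.IsSeparable (generatedSubspace R S : Set 𝓗) := by
  have hSsep : TopologicalSpace.IsSeparable (S : Set 𝓗) := by
    have : TopologicalSpace.SeparableSpace S :=
      have := FiniteDimensional.proper ℂ S
      inferInstance
    exact TopologicalSpace.IsSeparable.of_subtype _
  refine TopologicalSpace.IsSeparable.closure (TopologicalSpace.IsSeparable.span ?_)
  have hden := TopologicalSpace.exists_countable_dense G
  obtain ⟨D, hDc, hDd⟩ := hden
  have : Countable D := hDc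
  refine (TopologicalSpace.IsSeparable.iUnion (s := fun d : D => R d.1 '' S)
    fun d => hSsep.image (R d.1).continuous).mono ?_
  rintro _ ⟨g, s, hs, rfl⟩
  obtain ⟨d, hdD, hd⟩ := hDd.exists_mem_open (isOpen_tile hWo g) ⟨g, by simp⟩
  refine Set.mem_iUnion.mpr ⟨⟨d, hdD⟩, s, hs, ?_⟩
  simp only
  have : d = g * (g⁻¹ * d) := by group
  rw [this, rep_mul_apply, hS hs _ hd]

/-- A separable Hilbert space is isometric to one in `Type`. -/
lemma exists_hilbertBasis_countable (E : Type*) [NormedAddCommGroup E] [InnerProductSpace ℂ E]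
    [CompleteSpace E] [TopologicalSpace.SeparableSpace E] :
    ∃ s : Set ℕ, Nonempty (HilbertBasis s ℂ E) := by
  obtain ⟨w, b, -⟩ := exists_hilbertBasis ℂ E
  have hdist : ∀ i j, i ≠ j → 1 ≤ dist (b i) (b j) := fun i j hij => by
    have h1 := norm_sub_sq (𝕜 := ℂ) (b i) (b j)
    rw [b.orthonormal.2 hij, b.orthonormal.1, b.orthonormal.1] at h1
    rw [dist_eq_norm]
    norm_num at h1
    nlinarith [norm_nonneg (b i - b j)]
  have hc : Countable w := by
    refine Pairwise.countable_of_isOpen_disjoint (s := fun i => Metric.ball (b i) (1 / 2))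
      (fun i j hij => Metric.ball_disjoint_ball ?_) (fun _ => Metric.isOpen_ball)
      (fun i => ⟨b i, by simp⟩)
    have := hdist i j hij
    linarith
  obtain ⟨φ, hφ⟩ := Countable.exists_injective_nat w
  let e := Equiv.ofInjective φ hφ
  refine ⟨Set.range φ, ⟨HilbertBasis.mk (v := b ∘ e.symm)
    (b.orthonormal.comp _ e.symm.injective) ?_⟩⟩
  rw [e.symm.surjective.range_comp]
  exact b.dense_span.ge

/-- An isometric embedding of an irreducible unitary representation with nonzero `W`-fixed vectors
into the representation `R`. -/
structure IrreducibleSubrep (R : G →* (𝓗 ≃ₗᵢ[ℂ] 𝓗)) (W : Subgroup G) where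
  /-- the irreducible representation -/
  σ : UnitaryRep G
  /-- the embedding -/
  T : σ.H →ₗᵢ[ℂ] 𝓗
  irr : σ.IsIrreducible
  map_ρ : ∀ g v, T (σ.ρ g v) = R g (T v)
  fixed_ne_bot : fixedVectors σ.ρ W ≠ ⊥

lemma exists_irreducibleSubrep [SecondCountableTopology G] [CompleteSpace 𝓗]
    (hWo : IsOpen (W : Set G)) [FiniteDimensional ℂ (fixedVectors R W)] {Z : Submodule ℂ 𝓗}
    (hZ : IsClosedInvariant R Z) (hne : Z ⊓ fixedVectors R W ≠ ⊥) :
    ∃ E : IrreducibleSubrep R W, (∀ v, E.T v ∈ Z) ∧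
      IsClosedInvariant R (LinearMap.range E.T.toLinearMap) := by
  obtain ⟨S, hSX, hSne, hSZ, hirr⟩ := exists_irreducible_le hZ hne
  set Y := generatedSubspace R S with hYdef
  have hY : IsClosedInvariant R Y := isClosedInvariant_generatedSubspace S
  have : FiniteDimensional ℂ S := Submodule.finiteDimensional_of_le hSX
  have : CompleteSpace Y := hY.isClosed.completeSpace_coe
  have : TopologicalSpace.SeparableSpace Y := (isSeparable_generatedSubspace hWo hSX).separableSpace
  obtain ⟨s, ⟨b⟩⟩ := exists_hilbertBasis_countable Y
  let L := b.repr
  let T : lp (fun _ : s => ℂ) 2 →ₗᵢ[ℂ] 𝓗 := Y.subtypeₗᵢ.comp L.symm.toLinearIsometry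
  have hTY : ∀ v, T v ∈ Y := fun v => (L.symm v).2
  have hTL : ∀ y : Y, T (L y) = y := fun y => congrArg Subtype.val (L.symm_apply_apply y)
  let RY : G → (Y ≃ₗᵢ[ℂ] Y) := fun g =>
    { toFun := fun v => ⟨R g v, hY.map_mem g v v.2⟩
      invFun := fun v => ⟨R g⁻¹ v, hY.map_mem g⁻¹ v v.2⟩
      map_add' := fun v w => Subtype.ext (map_add (R g) (v : 𝓗) w)
      map_smul' := fun c v => Subtype.ext (map_smul (R g) c (v : 𝓗))
      left_inv := fun v => Subtype.ext (rep_inv_apply_apply g (v : 𝓗))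
      right_inv := fun v => Subtype.ext (rep_apply_inv_apply g (v : 𝓗))
      norm_map' := fun v => (R g).norm_map (v : 𝓗) }
  let ρ : G →* (lp (fun _ : s => ℂ) 2 ≃ₗᵢ[ℂ] lp (fun _ : s => ℂ) 2) :=
    { toFun := fun g => (L.symm.trans (RY g)).trans L
      map_one' := by
        ext1 v
        change L (RY 1 (L.symm v)) = v
        rw [← L.eq_symm_apply]
        exact Subtype.ext (rep_one_apply _)
      map_mul' := fun g h => by
        ext1 v
        change L (RY (g * h) (L.symm v)) = L (RY g (L.symm (L (RY h (L.symm v)))))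
        rw [L.symm_apply_apply]
        congr 1
        exact Subtype.ext (rep_mul_apply g h _) }
  have hTρ : ∀ g v, T (ρ g v) = R g (T v) := fun g v => hTL (RY g (L.symm v))
  let σ : UnitaryRep G :=
    { H := lp (fun _ : s => ℂ) 2
      ρ := ρ
      continuous_ρ := fun v => by
        rw [T.isometry.isEmbedding.continuous_iff]
        have := continuous_orbit_of_mem_generatedSubspace hWo hSX (hTY v)
        exact this.congr fun g => (hTρ g v).symm }
  have hrange : LinearMap.range T.toLinearMap = Y := by
    ext y
    exact ⟨by rintro ⟨v, rfl⟩; exact hTY v, fun hy => ⟨L ⟨y, hy⟩, hTL ⟨y, hy⟩⟩⟩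
  have hfix : ∃ v ∈ fixedVectors σ.ρ W, v ≠ 0 := by
    obtain ⟨x, hx, hx0⟩ := Submodule.exists_mem_ne_zero_of_ne_bot hSne
    have hxY : x ∈ Y := le_generatedSubspace S hx
    refine ⟨L ⟨x, hxY⟩, fun k hk => ?_, fun h => hx0 ?_⟩
    · apply T.injective
      change T (ρ k _) = _
      rw [hTρ, hTL]
      exact hSX hx k hk
    · have := hTL ⟨x, hxY⟩
      rw [h] at this
      exact this.symm.trans (map_zero T)
  refine ⟨⟨σ, T, ⟨?_, fun A hA hAinv => ?_⟩, hTρ, ?_⟩, fun v => hSZ (hTY v), ?_⟩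
  · obtain ⟨v, -, hv⟩ := hfix
    exact ⟨v, 0, hv⟩
  · have hA' : IsClosedInvariant R (A.map T.toLinearMap) := by
      refine ⟨?_, ?_⟩
      · exact T.isometry.isClosedEmbedding.isClosedMap _ hA
      · rintro g _ ⟨a, ha, rfl⟩
        exact ⟨ρ g a, hAinv g a ha, hTρ g a⟩
    have hle : A.map T.toLinearMap ≤ Y := by
      rintro _ ⟨a, -, rfl⟩; exact hTY a
    rcases hirr _ hle hA' with h | h
    · left
      exact Submodule.map_injective_of_injective T.injective (h.trans (Submodule.map_bot _).symm)
    · right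
      rw [eq_top_iff]
      intro v _
      have : T v ∈ A.map T.toLinearMap := h ▸ hTY v
      obtain ⟨a, ha, e⟩ := this
      rwa [← T.injective e]
  · obtain ⟨v, hv, hv0⟩ := hfix
    exact (Submodule.ne_bot_iff _).mpr ⟨v, hv, hv0⟩
  · change IsClosedInvariant R (LinearMap.range T.toLinearMap)
    rw [hrange]; exact hY

/-- A maximal orthogonal family of irreducible subrepresentations with `W`-fixed vectors. It is
finite because splitting off such a subrepresentation lowers the dimension of the space of
`W`-fixed vectors. -/
lemma exists_decomposition [SecondCountableTopology G] [CompleteSpace 𝓗]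
    (hWo : IsOpen (W : Set G)) [FiniteDimensional ℂ (fixedVectors R W)] (Z : Submodule ℂ 𝓗)
    (hZ : IsClosedInvariant R Z) :
    ∃ (κ : Type) (_ : Fintype κ) (E : κ → IrreducibleSubrep R W),
      (∀ i v, (E i).T v ∈ Z) ∧
      (∀ i j, i ≠ j → ∀ v w, inner ℂ ((E i).T v) ((E j).T w) = 0) ∧
      ∀ z ∈ Z ⊓ fixedVectors R W, (∀ i v, inner ℂ ((E i).T v) z = 0) → z = 0 := by
  have hfd : ∀ A : Submodule ℂ 𝓗, FiniteDimensional ℂ (A ⊓ fixedVectors R W : Submodule ℂ 𝓗) :=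
    fun A => Submodule.finiteDimensional_of_le inf_le_right
  induction h : Module.finrank ℂ (Z ⊓ fixedVectors R W : Submodule ℂ 𝓗)
    using Nat.strong_induction_on generalizing Z with
  | _ n ih =>
    by_cases hne : Z ⊓ fixedVectors R W = ⊥
    · refine ⟨Empty, inferInstance, Empty.elim, fun i => i.elim, fun i => i.elim, fun z hz _ => ?_⟩
      rwa [hne, Submodule.mem_bot] at hz
    obtain ⟨E₀, hE₀, hE₀inv⟩ := exists_irreducibleSubrep hWo hZ hne
    set Y := LinearMap.range E₀.T.toLinearMap with hY
    have hlt : Module.finrank ℂ (Z ⊓ Yᗮ ⊓ fixedVectors R W : Submodule ℂ 𝓗) < n := by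
      rw [← h]
      refine Submodule.finrank_lt_finrank_of_lt (lt_of_le_of_ne
        (inf_le_inf_right _ inf_le_left) fun heq => ?_)
      obtain ⟨v, hv, hv0⟩ := Submodule.exists_mem_ne_zero_of_ne_bot E₀.fixed_ne_bot
      have h1 : E₀.T v ∈ Z ⊓ fixedVectors R W :=
        ⟨hE₀ v, fun k hk => by rw [← E₀.map_ρ, hv k hk]⟩
      rw [← heq] at h1
      have h2 := (Submodule.mem_orthogonal _ _).mp h1.1.2 (E₀.T v) ⟨v, rfl⟩
      rw [inner_self_eq_zero] at h2
      exact hv0 (E₀.T.injective (h2.trans (map_zero E₀.T).symm))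
    obtain ⟨κ, _, E, hEZ, horth, hmax⟩ := ih _ hlt (Z ⊓ Yᗮ) (hZ.inf hE₀inv.orthogonal) rfl
    refine ⟨Option κ, inferInstance, fun o => o.elim E₀ E, ?_, ?_, ?_⟩
    · rintro (_ | i) v
      · exact hE₀ v
      · exact (hEZ i v).1
    · rintro (_ | i) (_ | j) hij v w
      · exact absurd rfl hij
      · exact (Submodule.mem_orthogonal _ _).mp (hEZ j w).2 _ ⟨v, rfl⟩
      · exact (Submodule.mem_orthogonal' _ _).mp (hEZ i v).2 _ ⟨w, rfl⟩
      · exact horth i j (fun h => hij (congrArg some h)) v w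
    · intro z hz hzE
      refine hmax z ⟨⟨hz.1, ?_⟩, hz.2⟩ fun i v => hzE (some i) v
      refine (Submodule.mem_orthogonal _ _).mpr ?_
      rintro _ ⟨v, rfl⟩
      exact hzE none v

end Realization

/-! ### Schur's lemma and multiplicities -/

section Schur

variable {G : Type*} [Group G] [TopologicalSpace G]
  {𝓗 : Type*} [NormedAddCommGroup 𝓗] [InnerProductSpace ℂ 𝓗]

/-- The continuous intertwining maps from `π` to the representation `R`. -/
def homs (R : G →* (𝓗 ≃ₗᵢ[ℂ] 𝓗)) (π : UnitaryRep G) : Submodule ℂ (π.H →L[ℂ] 𝓗) where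
  carrier := {T | ∀ g v, T (π.ρ g v) = R g (T v)}
  zero_mem' := fun g v => by simp
  add_mem' := fun {S T} hS hT g v => by
    rw [add_apply, add_apply, hS, hT, map_add]
  smul_mem' := fun c T hT g v => by
    rw [smul_apply, smul_apply, hT, map_smul]

variable {R : G →* (𝓗 ≃ₗᵢ[ℂ] 𝓗)} {W : Subgroup G} {π σ : UnitaryRep G}

lemma map_mem_fixedVectors {T : π.H →L[ℂ] 𝓗} (hT : T ∈ homs R π) {v : π.H}
    (hv : v ∈ fixedVectors π.ρ W) : T v ∈ fixedVectors R W := fun k hk => by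
  rw [← hT, hv k hk]

lemma UnitaryRep.IsIrreducible.eq_zero_of_apply_eq_zero (hπ : π.IsIrreducible) {T : π.H →L[ℂ] 𝓗}
    (hT : T ∈ homs R π) {v : π.H} (hv : v ≠ 0) (hTv : T v = 0) : T = 0 := by
  rcases hπ.2 (LinearMap.ker T.toLinearMap) T.isClosed_ker (fun g w hw => by
    rw [LinearMap.mem_ker] at hw ⊢
    change T (π.ρ g w) = 0
    rw [hT g w, show T w = 0 from hw, map_zero]) with h | h
  · have : v ∈ LinearMap.ker T.toLinearMap := hTv
    rw [h, Submodule.mem_bot] at this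
    exact absurd this hv
  · ext w
    have : w ∈ LinearMap.ker T.toLinearMap := h ▸ trivial
    exact this

lemma UnitaryRep.IsIrreducible.injective (hπ : π.IsIrreducible) {T : π.H →L[ℂ] 𝓗}
    (hT : T ∈ homs R π) (h0 : T ≠ 0) : Function.Injective T := by
  refine (injective_iff_map_eq_zero T).mpr fun v hv => ?_
  by_contra hne
  exact h0 (hπ.eq_zero_of_apply_eq_zero hT hne hv)

lemma finiteDimensional_fixedVectors_of_injective [FiniteDimensional ℂ (fixedVectors R W)]
    {T : π.H →L[ℂ] 𝓗} (hT : T ∈ homs R π) (hinj : Function.Injective T) :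
    FiniteDimensional ℂ (fixedVectors π.ρ W) := by
  let S : fixedVectors π.ρ W →ₗ[ℂ] fixedVectors R W :=
    T.toLinearMap.restrict fun v hv => map_mem_fixedVectors hT hv
  refine FiniteDimensional.of_injective S fun v w h => Subtype.ext (hinj ?_)
  exact congrArg Subtype.val h

/-- Schur's lemma; an eigenvector exists among the finitely many dimensions of `W`-fixed
vectors. -/
lemma UnitaryRep.IsIrreducible.exists_eq_smul (hπ : π.IsIrreducible)
    (hne : fixedVectors π.ρ W ≠ ⊥) [FiniteDimensional ℂ (fixedVectors π.ρ W)]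
    {A : π.H →L[ℂ] π.H} (hA : A ∈ homs π.ρ π) :
    ∃ c : ℂ, A = c • ContinuousLinearMap.id ℂ π.H := by
  have : Nontrivial (fixedVectors π.ρ W) := Submodule.nontrivial_iff_ne_bot.mpr hne
  let S : fixedVectors π.ρ W →ₗ[ℂ] fixedVectors π.ρ W :=
    A.toLinearMap.restrict fun v hv => map_mem_fixedVectors hA hv
  obtain ⟨c, hc⟩ := Module.End.exists_eigenvalue S
  obtain ⟨v, hv⟩ := hc.exists_hasEigenvector
  refine ⟨c, sub_eq_zero.mp (hπ.eq_zero_of_apply_eq_zero (R := π.ρ) (v := (v : π.H)) ?_ ?_ ?_)⟩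
  · refine Submodule.sub_mem _ hA fun g w => ?_
    simp
  · exact fun h => hv.2 (Subtype.ext h)
  · have := congrArg Subtype.val hv.apply_eq_smul
    change A v = c • (v : π.H) at this
    simp [this]

lemma adjoint_rep_apply [CompleteSpace 𝓗] {T : π.H →L[ℂ] 𝓗} (hT : T ∈ homs R π) (g : G) (v : 𝓗) :
    T.adjoint (R g v) = π.ρ g (T.adjoint v) := by
  refine ext_inner_left ℂ fun w => ?_
  rw [ContinuousLinearMap.adjoint_inner_right, inner_rep_right, ← hT, inner_rep_right,
    ContinuousLinearMap.adjoint_inner_right]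

/-- Schur's lemma for two representations: a nonzero intertwining map is a multiple of a
unitary equivalence. -/
lemma UnitaryRep.IsIrreducible.equivalent (hπ : π.IsIrreducible) (hσ : σ.IsIrreducible)
    (hne : fixedVectors π.ρ W ≠ ⊥) [FiniteDimensional ℂ (fixedVectors π.ρ W)]
    {T : π.H →L[ℂ] σ.H} (hT : T ∈ homs σ.ρ π) (h0 : T ≠ 0) : π.Equivalent σ := by
  obtain ⟨c, hc⟩ := hπ.exists_eq_smul hne (A := T.adjoint ∘L T) (fun g v => by
    rw [ContinuousLinearMap.comp_apply, hT, adjoint_rep_apply hT]; rfl)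
  have hinner : ∀ v w, inner ℂ (T v) (T w) = c * inner ℂ v w := fun v w => by
    rw [← ContinuousLinearMap.adjoint_inner_right, ← ContinuousLinearMap.comp_apply, hc]
    simp [inner_smul_right]
  obtain ⟨v, hv⟩ : ∃ v, T v ≠ 0 := by
    by_contra! h
    exact h0 (ContinuousLinearMap.ext h)
  have hv0 : v ≠ 0 := fun h => hv (by rw [h, map_zero])
  have hcr : c = ((‖T v‖ / ‖v‖) ^ 2 : ℝ) := by
    have := hinner v v
    rw [inner_self_eq_norm_sq_to_K, inner_self_eq_norm_sq_to_K] at this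
    have hn : ((‖v‖ : ℝ) : ℂ) ≠ 0 := by exact_mod_cast norm_ne_zero_iff.mpr hv0
    push_cast
    rw [div_pow, eq_div_iff (pow_ne_zero 2 hn)]
    exact this.symm
  set t : ℝ := ‖T v‖ / ‖v‖ with ht
  have htpos : 0 < t := div_pos (norm_pos_iff.mpr hv) (norm_pos_iff.mpr hv0)
  have hnorm : ∀ w, ‖T w‖ = t * ‖w‖ := fun w => by
    have := hinner w w
    rw [inner_self_eq_norm_sq_to_K, inner_self_eq_norm_sq_to_K, hcr] at this
    have h2 : ‖T w‖ ^ 2 = (t * ‖w‖) ^ 2 := by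
      apply Complex.ofReal_injective
      rw [mul_pow]
      push_cast at this ⊢
      exact this
    exact (sq_eq_sq₀ (norm_nonneg _) (by positivity)).mp h2
  let U : π.H →ₗᵢ[ℂ] σ.H :=
    { toLinearMap := ((t : ℂ)⁻¹ • T).toLinearMap
      norm_map' := fun w => by
        change ‖(t : ℂ)⁻¹ • T w‖ = ‖w‖
        rw [norm_smul, hnorm, norm_inv, Complex.norm_real, Real.norm_of_nonneg htpos.le,
          inv_mul_cancel_left₀ htpos.ne'] }
  have hU : ∀ g w, U (π.ρ g w) = σ.ρ g (U w) := fun g w => by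
    change (t : ℂ)⁻¹ • T (π.ρ g w) = σ.ρ g ((t : ℂ)⁻¹ • T w)
    rw [hT, map_smul]
  have hsurj : Function.Surjective U := by
    rcases hσ.2 (LinearMap.range U.toLinearMap) U.isometry.isClosedEmbedding.isClosed_range
      (by rintro g _ ⟨w, rfl⟩; exact ⟨π.ρ g w, hU g w⟩) with h | h
    · exfalso
      have : U v ∈ LinearMap.range U.toLinearMap := ⟨v, rfl⟩
      rw [h, Submodule.mem_bot] at this
      exact hv0 (U.injective (this.trans (map_zero U).symm))
    · intro w
      have : w ∈ LinearMap.range U.toLinearMap := h ▸ trivial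
      exact this
  exact ⟨LinearIsometryEquiv.ofSurjective U hsurj, hU⟩

end Schur

section Multiplicity

variable {G : Type*} [Group G] [TopologicalSpace G]
  {𝓗 : Type*} [NormedAddCommGroup 𝓗] [InnerProductSpace ℂ 𝓗]
  {R : G →* (𝓗 ≃ₗᵢ[ℂ] 𝓗)} {W : Subgroup G}

lemma finiteDimensional_homs [FiniteDimensional ℂ (fixedVectors R W)] {π : UnitaryRep G}
    (hπ : π.IsIrreducible) (hne : fixedVectors π.ρ W ≠ ⊥) : FiniteDimensional ℂ (homs R π) := by
  obtain ⟨v, hv, hv0⟩ := Submodule.exists_mem_ne_zero_of_ne_bot hne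
  let ev : homs R π →ₗ[ℂ] fixedVectors R W :=
    { toFun := fun T => ⟨T.1 v, map_mem_fixedVectors T.2 hv⟩
      map_add' := fun _ _ => rfl
      map_smul' := fun _ _ => rfl }
  refine FiniteDimensional.of_injective ev ((injective_iff_map_eq_zero ev).mpr fun T hT => ?_)
  exact Subtype.ext (hπ.eq_zero_of_apply_eq_zero T.2 hv0 (congrArg Subtype.val hT))

open Classical in
/-- The multiplicity of an irreducible representation with `W`-fixed vectors is the number of its
occurrences in a maximal orthogonal family of irreducible subrepresentations with such vectors. -/
lemma finrank_homs_eq_card [CompleteSpace 𝓗] [FiniteDimensional ℂ (fixedVectors R W)]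
    {κ : Type} [Fintype κ] (E : κ → IrreducibleSubrep R W)
    (horth : ∀ i j, i ≠ j → ∀ v w, inner ℂ ((E i).T v) ((E j).T w) = 0)
    (hmax : ∀ z ∈ fixedVectors R W, (∀ i v, inner ℂ ((E i).T v) z = 0) → z = 0)
    {π : UnitaryRep G} (hπ : π.IsIrreducible) (hne : fixedVectors π.ρ W ≠ ⊥) :
    Module.finrank ℂ (homs R π) = Fintype.card {i // π.Equivalent (E i).σ} := by
  obtain ⟨v₀, hv₀, hv₀0⟩ := Submodule.exists_mem_ne_zero_of_ne_bot hne
  have hE : ∀ i, (E i).T.toContinuousLinearMap ∈ homs R (E i).σ := fun i => (E i).map_ρ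
  choose U hU using fun i : {i // π.Equivalent (E i).σ} => i.2
  let B : {i // π.Equivalent (E i).σ} → homs R π := fun i =>
    ⟨(E i).T.toContinuousLinearMap ∘L (U i).toContinuousLinearEquiv.toContinuousLinearMap,
      fun g v => by
        change (E i).T (U i (π.ρ g v)) = R g ((E i).T (U i v))
        rw [hU, (E i).map_ρ]⟩
  have hB : ∀ i v, (B i).1 v = (E i).T (U i v) := fun _ _ => rfl
  have hTT : ∀ (i) (v : (E i).σ.H), (E i).T.toContinuousLinearMap.adjoint ((E i).T v) = v :=
    fun i v => ext_inner_left ℂ fun w => by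
      rw [ContinuousLinearMap.adjoint_inner_right]
      exact (E i).T.inner_map_map w v
  have hTT' : ∀ i j, i ≠ j → ∀ v, (E i).T.toContinuousLinearMap.adjoint ((E j).T v) = 0 :=
    fun i j hij v => ext_inner_left ℂ fun w => by
      rw [ContinuousLinearMap.adjoint_inner_right, inner_zero_right]
      exact horth i j hij w v
  have hli : LinearIndependent ℂ B := by
    let ev : homs R π →ₗ[ℂ] 𝓗 :=
      { toFun := fun T => T.1 v₀
        map_add' := fun _ _ => rfl
        map_smul' := fun _ _ => rfl }
    refine LinearIndependent.of_comp ev (linearIndependent_of_ne_zero_of_inner_eq_zero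
      (𝕜 := ℂ) (fun i h => ?_) fun i j hij => ?_)
    · have h' : (E i).T (U i v₀) = 0 := h
      rw [← map_zero (E i).T] at h'
      have h'' := (E i).T.injective h'
      rw [← map_zero (U i)] at h''
      exact hv₀0 ((U i).injective h'')
    · exact horth i j (fun h => hij (Subtype.ext h)) _ _
  have hspan : ⊤ ≤ Submodule.span ℂ (Set.range B) := by
    rintro ⟨S, hS⟩ -
    by_cases hS0 : S = 0
    · have : (⟨S, hS⟩ : homs R π) = 0 := Subtype.ext hS0
      rw [this]; exact Submodule.zero_mem _
    have hfd : FiniteDimensional ℂ (fixedVectors π.ρ W) :=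
      finiteDimensional_fixedVectors_of_injective hS (hπ.injective hS hS0)
    have hadj : ∀ i, (E i).T.toContinuousLinearMap.adjoint ∘L S ∈ homs (E i).σ.ρ π :=
      fun i g v => by
        rw [ContinuousLinearMap.comp_apply, hS, adjoint_rep_apply (hE i)]; rfl
    have hc : ∀ i : {i // π.Equivalent (E i).σ}, ∃ c : ℂ, ∀ v,
        (E i).T.toContinuousLinearMap.adjoint (S v) = c • U i v := fun i => by
      obtain ⟨c, hc⟩ := hπ.exists_eq_smul hne
        (A := (U i).symm.toContinuousLinearEquiv.toContinuousLinearMap ∘L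
          ((E i).T.toContinuousLinearMap.adjoint ∘L S)) (fun g v => by
          change (U i).symm (((E i).T.toContinuousLinearMap.adjoint ∘L S) (π.ρ g v)) =
            π.ρ g ((U i).symm (((E i).T.toContinuousLinearMap.adjoint ∘L S) v))
          rw [hadj i g v, LinearIsometryEquiv.symm_apply_eq, hU,
            LinearIsometryEquiv.apply_symm_apply])
      refine ⟨c, fun v => ?_⟩
      have h1 := congrArg (fun A : π.H →L[ℂ] π.H => U i (A v)) hc
      change U i ((U i).symm _) = U i (c • v) at h1
      rw [LinearIsometryEquiv.apply_symm_apply, map_smul] at h1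
      exact h1
    choose c hc using hc
    have hzero : ∀ i, ¬ π.Equivalent (E i).σ → ∀ v,
        (E i).T.toContinuousLinearMap.adjoint (S v) = 0 := fun i hi v => by
      by_contra hv
      refine hi (hπ.equivalent (E i).irr hne (hadj i) fun h => hv ?_)
      exact congrArg (fun A : π.H →L[ℂ] (E i).σ.H => A v) h
    have hD : S - ∑ i, c i • (B i).1 = 0 := by
      have hmem : S - ∑ i, c i • (B i).1 ∈ homs R π :=
        Submodule.sub_mem _ hS (Submodule.sum_mem _ fun i _ => Submodule.smul_mem _ _ (B i).2)
      refine hπ.eq_zero_of_apply_eq_zero hmem hv₀0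
        (hmax _ (map_mem_fixedVectors hmem hv₀) fun j w => ?_)
      have hadj0 : (E j).T.toContinuousLinearMap.adjoint ((S - ∑ i, c i • (B i).1) v₀) = 0 := by
        rw [sub_apply, map_sub, sum_apply, map_sum]
        by_cases hj : π.Equivalent (E j).σ
        · rw [Finset.sum_eq_single ⟨j, hj⟩]
          · rw [smul_apply, hB, map_smul, hTT j, hc ⟨j, hj⟩, sub_self]
          · intro i _ hij
            rw [smul_apply, hB, map_smul,
              hTT' j i (fun h => hij (Subtype.ext h.symm)), smul_zero]
          · exact fun h => absurd (Finset.mem_univ _) h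
        · rw [hzero j hj, Finset.sum_eq_zero, sub_zero]
          intro i _
          rw [smul_apply, hB, map_smul,
            hTT' j i (fun h => hj (h ▸ i.2)), smul_zero]
      change inner ℂ ((E j).T.toContinuousLinearMap w) _ = 0
      rw [← ContinuousLinearMap.adjoint_inner_right, hadj0, inner_zero_right]
    have : (⟨S, hS⟩ : homs R π) = ∑ i, c i • B i := by
      refine Subtype.ext ?_
      rw [Submodule.coe_sum]
      exact sub_eq_zero.mp hD
    rw [this]
    exact Submodule.sum_mem _ fun i _ =>
      Submodule.smul_mem _ _ (Submodule.subset_span ⟨i, rfl⟩)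
  rw [← finrank_top, ← top_le_iff.mp hspan]
  exact finrank_span_eq_card hli

end Multiplicity

/-! ### Traces of the operators `π(f)` -/

section Trace

variable {H : Type*} [NormedAddCommGroup H] [InnerProductSpace ℂ H] [CompleteSpace H]

/-- The trace of an operator of finite rank can be computed in a finite orthonormal family whose
span contains its range. -/
lemma hilbertTrace_eq_sum {A A' : H → H} (hA : ∀ v w, inner ℂ v (A w) = inner ℂ (A' v) w)
    {κ : Type*} [Fintype κ] (u : κ → H) (hu : ∀ v, A v = ∑ j, inner ℂ (u j) (A v) • u j) :
    hilbertTrace A = ∑ j, inner ℂ (u j) (A (u j)) := by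
  rw [hilbertTrace]
  set b := (exists_hilbertBasis ℂ H).choose_spec.choose
  have h1 : ∀ i, inner ℂ (b i) (A (b i)) =
      ∑ j, inner ℂ (A' (u j)) (b i) * inner ℂ (b i) (u j) := fun i => by
    conv_lhs => rw [hu (b i)]
    rw [inner_sum]
    refine Finset.sum_congr rfl fun j _ => ?_
    rw [inner_smul_right, hA]
  have h2 : HasSum (fun i => inner ℂ (b i) (A (b i))) (∑ j, inner ℂ (A' (u j)) (u j)) := by
    simp only [h1]
    exact hasSum_sum fun j _ => b.hasSum_inner_mul_inner _ _
  rw [h2.tsum_eq]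
  exact Finset.sum_congr rfl fun j _ => (hA _ _).symm

lemma hilbertTrace_zero {A : H → H} (hA : ∀ v, A v = 0) : hilbertTrace A = 0 := by
  simp [hilbertTrace, hA]

end Trace

section Operators

variable {G : Type*} [Group G] [TopologicalSpace G] [IsTopologicalGroup G]
  [SecondCountableTopology G] [MeasurableSpace G] [BorelSpace G] (μ : Measure G)
  {𝓗 : Type*} [NormedAddCommGroup 𝓗] [InnerProductSpace ℂ 𝓗]
  {R : G →* (𝓗 ≃ₗᵢ[ℂ] 𝓗)} {W : Subgroup G} {f : G → ℂ}

lemma integrable_smul_orbit (hint : Integrable f μ) {v : 𝓗} (hv : Continuous fun g => R g v) :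
    Integrable (fun g => f g • R g v) μ := by
  refine (hint.norm.mul_const ‖v‖).mono' (hint.1.smul hv.aestronglyMeasurable) ?_
  exact Filter.Eventually.of_forall fun g => by rw [norm_smul, LinearIsometryEquiv.norm_map]

/-- The operator `R(f) = ∫ f(g) R(g) dg`, evaluated at vectors with continuous orbit map. -/
def repOp (R : G →* (𝓗 ≃ₗᵢ[ℂ] 𝓗)) (μ : Measure G) (f : G → ℂ) (v : 𝓗) : 𝓗 :=
  ∫ g, f g • R g v ∂μ

/-- The range of `R(f)` is fixed by `W` if `f` is left `W`-invariant. No integrability is needed: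
the integral of a function that is not integrable is `0`, and `R(k)` is invertible. -/
lemma repOp_mem_fixedVectors [MeasurableMul G] [μ.IsMulLeftInvariant]
    (hf : ∀ k ∈ W, ∀ g, f (k * g) = f g) (v : 𝓗) : repOp R μ f v ∈ fixedVectors R W := by
  intro k hk
  rw [repOp]
  have h1 : R k (∫ g, f g • R g v ∂μ) = ∫ g, R k (f g • R g v) ∂μ :=
    ((R k).toContinuousLinearEquiv.integral_comp_comm _).symm
  rw [h1, ← integral_mul_left_eq_self (fun g => f g • R g v) k]
  refine integral_congr_ae (Filter.Eventually.of_forall fun g => ?_)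
  simp only
  rw [map_smul, ← rep_mul_apply, hf k hk]

variable [CompleteSpace 𝓗]

lemma inner_repOp (hint : Integrable f μ) (u : 𝓗) {v : 𝓗} (hv : Continuous fun g => R g v) :
    inner ℂ u (repOp R μ f v) = ∫ g, f g * inner ℂ u (R g v) ∂μ := by
  rw [repOp, ← integral_inner (integrable_smul_orbit μ hint hv)]
  simp only [inner_smul_right]

lemma inner_repOp_eq_adjoint [μ.IsInvInvariant] (hint : Integrable f μ)
    (hR : ∀ v, Continuous fun g => R g v) (u v : 𝓗) :
    inner ℂ u (repOp R μ f v) =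
      inner ℂ (repOp R μ (fun g => (starRingEnd ℂ) (f g⁻¹)) u) v := by
  have hint' : Integrable (fun g => (starRingEnd ℂ) (f g⁻¹)) μ := by
    have h := hint.comp_inv
    exact (LinearIsometryEquiv.integrable_comp_iff Complex.conjLIE).mpr h
  rw [inner_repOp μ hint u (hR v), ← inner_conj_symm, inner_repOp μ hint' v (hR u),
    ← integral_conj, ← integral_inv_eq_self]
  refine integral_congr_ae (Filter.Eventually.of_forall fun g => ?_)
  simp only [map_mul, Complex.conj_conj, inner_conj_symm]
  rw [inner_rep_right, inv_inv]

end Operators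

section SpectralSide

variable {G : Type*} [Group G] [TopologicalSpace G] [IsTopologicalGroup G]
  [SecondCountableTopology G] [MeasurableSpace G] [BorelSpace G] (μ : Measure G)
  [μ.IsMulLeftInvariant]
  {𝓗 : Type*} [NormedAddCommGroup 𝓗] [InnerProductSpace ℂ 𝓗] [CompleteSpace 𝓗]
  {R : G →* (𝓗 ≃ₗᵢ[ℂ] 𝓗)} {W : Subgroup G} {f : G → ℂ}

lemma finiteDimensional_span_range_op (hf : ∀ k ∈ W, ∀ g, f (k * g) = f g)
    (π : UnitaryRep G) [FiniteDimensional ℂ (fixedVectors π.ρ W)] :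
    FiniteDimensional ℂ (Submodule.span ℂ (Set.range (π.op μ f))) := by
  refine Submodule.finiteDimensional_of_le (S₂ := fixedVectors π.ρ W)
    (Submodule.span_le.mpr ?_)
  rintro _ ⟨v, rfl⟩
  exact repOp_mem_fixedVectors μ hf v

/-- An averaging operator over a small compact open subgroup shows that a nonzero continuous
unitary representation has nonzero vectors fixed by such a subgroup. -/
lemma exists_nhds_fixedVectors_ne_bot [T2Space G] [μ.IsOpenPosMeasure]
    [IsFiniteMeasureOnCompacts μ] (π : UnitaryRep G) [Nontrivial π.H] :
    ∃ N ∈ 𝓝 (1 : G), ∀ W : Subgroup G, IsOpen (W : Set G) → IsCompact (W : Set G) →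
      (W : Set G) ⊆ N → fixedVectors π.ρ W ≠ ⊥ := by
  obtain ⟨v, hv⟩ := exists_ne (0 : π.H)
  have hvpos := norm_pos_iff.mpr hv
  refine ⟨{g | ‖π.ρ g v - v‖ < ‖v‖ / 2}, ?_, fun W hWo hWc hWN h => ?_⟩
  · refine (isOpen_lt ((π.continuous_ρ v).sub continuous_const).norm
      continuous_const).mem_nhds ?_
    simpa [rep_one_apply] using hvpos
  have hfin := hWc.measure_lt_top (μ := μ)
  have hpos : 0 < μ.real (W : Set G) := measureReal_pos hWo hWc
  have hind : Integrable ((W : Set G).indicator (1 : G → ℂ)) μ :=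
    (integrable_indicator_iff hWo.measurableSet).mpr (integrableOn_const hfin.ne)
  have hmem : repOp π.ρ μ ((W : Set G).indicator 1) v ∈ fixedVectors π.ρ W :=
    repOp_mem_fixedVectors μ (fun k hk g => by
      by_cases hg : g ∈ W
      · rw [Set.indicator_of_mem (W.mul_mem hk hg),
          Set.indicator_of_mem (show g ∈ (W : Set G) from hg)]
        rfl
      · rw [Set.indicator_of_notMem, Set.indicator_of_notMem (show g ∉ (W : Set G) from hg)]
        exact fun h => hg ((W.mul_mem_cancel_left hk).mp h)) v
  rw [h, Submodule.mem_bot] at hmem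
  have heq : repOp π.ρ μ ((W : Set G).indicator 1) v = ∫ g in (W : Set G), π.ρ g v ∂μ := by
    rw [repOp, ← integral_indicator hWo.measurableSet]
    congr 1
    ext g
    by_cases hg : g ∈ (W : Set G)
    · simp [Set.indicator_of_mem hg]
    · simp [Set.indicator_of_notMem hg]
  have hcont := π.continuous_ρ v
  have hintv : IntegrableOn (fun g => π.ρ g v) (W : Set G) μ :=
    hcont.continuousOn.integrableOn_compact hWc
  have hdiff : ∫ g in (W : Set G), (π.ρ g v - v) ∂μ = - (μ.real (W : Set G) • v) := by
    rw [integral_sub hintv (integrableOn_const hfin.ne), ← heq, hmem, setIntegral_const, zero_sub]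
  have hle := norm_setIntegral_le_of_norm_le_const (f := fun g => π.ρ g v - v) hfin
    (fun g hg => (hWN hg).le)
  rw [hdiff, norm_neg, norm_smul, Real.norm_of_nonneg hpos.le] at hle
  nlinarith

variable [μ.IsInvInvariant]

/-- An orthonormal family which spans the space of `W`-fixed vectors computes the trace of
`π(f)`. -/
lemma hilbertTrace_op_eq_sum (hf : ∀ k ∈ W, ∀ g, f (k * g) = f g) (hint : Integrable f μ)
    (π : UnitaryRep G) {κ : Type*} [Fintype κ] (u : κ → π.H)
    (hu : ∀ v ∈ fixedVectors π.ρ W, v = ∑ j, inner ℂ (u j) v • u j) :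
    hilbertTrace (π.op μ f) = ∑ j, ∫ g, f g * inner ℂ (u j) (π.ρ g (u j)) ∂μ := by
  change hilbertTrace (repOp π.ρ μ f) = _
  rw [hilbertTrace_eq_sum (inner_repOp_eq_adjoint μ hint π.continuous_ρ) u
    fun v => hu _ (repOp_mem_fixedVectors μ hf v)]
  exact Finset.sum_congr rfl fun j _ => inner_repOp μ hint _ (π.continuous_ρ _)

open Classical in
/-- The spectral side is the trace of `R(f)` on the space of `W`-fixed vectors. -/
lemma spectral_side (hWo : IsOpen (W : Set G)) [FiniteDimensional ℂ (fixedVectors R W)]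
    (hf : ∀ k ∈ W, ∀ g, f (k * g) = f g) (hint : Integrable f μ) {κ' : Type*} [Fintype κ']
    (b : OrthonormalBasis κ' ℂ (fixedVectors R W)) :
    (Function.support fun π : UnitaryDual G =>
      (Module.finrank ℂ (homs R π.rep) : ℂ) * hilbertTrace (π.rep.op μ f)).Finite ∧
    ∑ᶠ π : UnitaryDual G, (Module.finrank ℂ (homs R π.rep) : ℂ) * hilbertTrace (π.rep.op μ f) =
      ∑ k, ∫ g, f g * inner ℂ (b k : 𝓗) (R g (b k)) ∂μ := by
  obtain ⟨κ, _, E, -, horth, hmax⟩ := exists_decomposition hWo (⊤ : Submodule ℂ 𝓗)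
    (IsClosedInvariant.top (R := R))
  have hmax' : ∀ z ∈ fixedVectors R W, (∀ i v, inner ℂ ((E i).T v) z = 0) → z = 0 :=
    fun z hz => hmax z ⟨trivial, hz⟩
  have hE : ∀ i, (E i).T.toContinuousLinearMap ∈ homs R (E i).σ := fun i => (E i).map_ρ
  have hfdE : ∀ i, FiniteDimensional ℂ (fixedVectors (E i).σ.ρ W) := fun i =>
    finiteDimensional_fixedVectors_of_injective (hE i) (E i).T.injective
  let cl : κ → UnitaryDual G := fun i => Quotient.mk (unitaryEquivalence G) ⟨(E i).σ, (E i).irr⟩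
  have hcl : ∀ (π : UnitaryDual G) i, cl i = π ↔ π.rep.Equivalent (E i).σ := fun π i => by
    constructor
    · intro h
      have h1 : Quotient.mk (unitaryEquivalence G) (Quotient.out π) = cl i :=
        (Quotient.out_eq π).trans h.symm
      exact Quotient.exact h1
    · intro h
      have h1 : Quotient.mk (unitaryEquivalence G) (Quotient.out π) = cl i := Quotient.sound h
      exact h1.symm.trans (Quotient.out_eq π)
  let e : ∀ i, OrthonormalBasis (Fin (Module.finrank ℂ (fixedVectors (E i).σ.ρ W))) ℂ
      (fixedVectors (E i).σ.ρ W) := fun i => stdOrthonormalBasis ℂ _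
  have he : ∀ i, ∀ v ∈ fixedVectors (E i).σ.ρ W,
      v = ∑ j, inner ℂ ((e i j : (E i).σ.H)) v • (e i j : (E i).σ.H) := fun i v hv => by
    have := congrArg Subtype.val ((e i).sum_repr' ⟨v, hv⟩)
    rw [Submodule.coe_sum] at this
    exact this.symm
  let t : κ → ℂ := fun i => hilbertTrace ((E i).σ.op μ f)
  -- each spectral term is the sum over the occurrences of `π` in the family
  have hterm : ∀ π : UnitaryDual G,
      (Module.finrank ℂ (homs R π.rep) : ℂ) * hilbertTrace (π.rep.op μ f) =
        ∑ i with cl i = π, t i := fun π => by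
    have hirr : π.rep.IsIrreducible := (Quotient.out π).2
    by_cases hne : fixedVectors π.rep.ρ W = ⊥
    · have h0 : ∀ v, π.rep.op μ f v = 0 := fun v => by
        have := repOp_mem_fixedVectors (R := π.rep.ρ) (W := W) μ hf v
        rw [hne, Submodule.mem_bot] at this
        exact this
      rw [hilbertTrace_zero h0, mul_zero, Finset.sum_eq_zero]
      intro i hi
      exfalso
      obtain ⟨U, hU⟩ := (hcl π i).mp (Finset.mem_filter.mp hi).2
      obtain ⟨v, hv, hv0⟩ := Submodule.exists_mem_ne_zero_of_ne_bot (E i).fixed_ne_bot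
      have : U.symm v ∈ fixedVectors π.rep.ρ W := fun k hk => by
        rw [LinearIsometryEquiv.eq_symm_apply, hU, LinearIsometryEquiv.apply_symm_apply, hv k hk]
      rw [hne, Submodule.mem_bot, ← map_zero U.symm] at this
      exact hv0 (U.symm.injective this)
    · rw [finrank_homs_eq_card E horth hmax' hirr hne, Fintype.card_subtype]
      have ht : ∀ i ∈ Finset.univ.filter fun i => cl i = π,
          t i = hilbertTrace (π.rep.op μ f) := fun i hi => by
        obtain ⟨U, hU⟩ := (hcl π i).mp (Finset.mem_filter.mp hi).2
        have hUs : ∀ g v, U.symm ((E i).σ.ρ g v) = π.rep.ρ g (U.symm v) := fun g v => by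
          rw [LinearIsometryEquiv.symm_apply_eq, hU, LinearIsometryEquiv.apply_symm_apply]
        change hilbertTrace ((E i).σ.op μ f) = _
        rw [hilbertTrace_op_eq_sum μ hf hint (E i).σ _ (he i),
          hilbertTrace_op_eq_sum μ hf hint π.rep (fun j => U.symm (e i j : (E i).σ.H))]
        · refine Finset.sum_congr rfl fun j _ => ?_
          refine integral_congr_ae (Filter.Eventually.of_forall fun g => ?_)
          simp only
          rw [← hUs, LinearIsometryEquiv.inner_map_map]
        · intro v hv
          have hUv : U v ∈ fixedVectors (E i).σ.ρ W := fun k hk => by rw [← hU, hv k hk]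
          have h1 := congrArg U.symm (he i _ hUv)
          rw [LinearIsometryEquiv.symm_apply_apply, map_sum] at h1
          rw [h1]
          refine Finset.sum_congr rfl fun j _ => ?_
          rw [map_smul, ← h1, ← LinearIsometryEquiv.inner_map_map U (U.symm _) v,
            LinearIsometryEquiv.apply_symm_apply]
      rw [Finset.sum_congr rfl ht, Finset.sum_const, nsmul_eq_mul]
      congr 2
      refine congrArg Finset.card (Finset.filter_congr fun i _ => ?_)
      exact (hcl π i).symm
  have hsupp : (Function.support fun π : UnitaryDual G =>
      (Module.finrank ℂ (homs R π.rep) : ℂ) * hilbertTrace (π.rep.op μ f)) ⊆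
        (Finset.univ.image cl : Finset (UnitaryDual G)) := by
    intro π hπ
    rw [Function.mem_support, hterm π] at hπ
    obtain ⟨i, hi, -⟩ := Finset.exists_ne_zero_of_sum_ne_zero hπ
    exact Finset.mem_coe.mpr
      (Finset.mem_image.mpr ⟨i, Finset.mem_univ i, (Finset.mem_filter.mp hi).2⟩)
  refine ⟨(Finset.finite_toSet _).subset hsupp, ?_⟩
  rw [finsum_eq_sum_of_support_subset _ hsupp]
  simp only [hterm]
  rw [Finset.sum_fiberwise_of_maps_to (s := Finset.univ) (g := cl)
    (fun i _ => Finset.mem_image_of_mem cl (Finset.mem_univ i)) t]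
  -- the images of the bases `e i` form an orthonormal basis of the fixed vectors
  have hmemT : ∀ i j, (E i).T (e i j) ∈ fixedVectors R W := fun i j =>
    map_mem_fixedVectors (hE i) (e i j).2
  let u : (Σ i, Fin (Module.finrank ℂ (fixedVectors (E i).σ.ρ W))) → fixedVectors R W :=
    fun p => ⟨(E p.1).T (e p.1 p.2), hmemT p.1 p.2⟩
  have hu : Orthonormal ℂ u := by
    refine ⟨fun p => ?_, ?_⟩
    · change ‖(E p.1).T (e p.1 p.2)‖ = 1
      rw [LinearIsometry.norm_map]
      exact (e p.1).orthonormal.1 p.2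
    · rintro ⟨i, j⟩ ⟨i', j'⟩ hne
      change inner ℂ ((E i).T (e i j)) ((E i').T (e i' j')) = 0
      by_cases hi : i = i'
      · subst hi
        rw [LinearIsometry.inner_map_map]
        exact (e i).orthonormal.2 fun h => hne (by rw [h])
      · exact horth i i' hi _ _
  have huspan : (Submodule.span ℂ (Set.range u))ᗮ = ⊥ := by
    rw [eq_bot_iff]
    intro z hz
    refine Subtype.ext (hmax' z z.2 fun i v => ?_)
    have hTz : (E i).T.toContinuousLinearMap.adjoint (z : 𝓗) ∈ fixedVectors (E i).σ.ρ W :=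
      fun k hk => by rw [← adjoint_rep_apply (hE i), z.2 k hk]
    have h0 : (E i).T.toContinuousLinearMap.adjoint (z : 𝓗) = 0 := by
      rw [he i _ hTz]
      refine Finset.sum_eq_zero fun j _ => ?_
      rw [ContinuousLinearMap.adjoint_inner_right]
      have := (Submodule.mem_orthogonal _ _).mp hz (u ⟨i, j⟩) (Submodule.subset_span ⟨_, rfl⟩)
      have h' : inner ℂ ((E i).T.toContinuousLinearMap (e i j : (E i).σ.H)) (z : 𝓗) = 0 := this
      rw [h', zero_smul]
    change inner ℂ ((E i).T.toContinuousLinearMap v) (z : 𝓗) = 0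
    rw [← ContinuousLinearMap.adjoint_inner_right, h0, inner_zero_right]
  let bu := OrthonormalBasis.mkOfOrthogonalEqBot hu huspan
  have hbu : ∀ p, bu p = u p := fun p =>
    congrFun (OrthonormalBasis.coe_of_orthogonal_eq_bot_mk hu huspan) p
  -- the trace of `R(f)` does not depend on the orthonormal basis
  have hcont : ∀ v : fixedVectors R W, Continuous fun g => R g (v : 𝓗) := fun v =>
    continuous_orbit_of_fixed hWo v.2
  let A : fixedVectors R W →ₗ[ℂ] fixedVectors R W :=
    { toFun := fun v => ⟨repOp R μ f (v : 𝓗), repOp_mem_fixedVectors μ hf (v : 𝓗)⟩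
      map_add' := fun v w => Subtype.ext (by
        change ∫ g, f g • R g ((v : 𝓗) + w) ∂μ = _
        simp only [map_add, smul_add]
        exact integral_add (integrable_smul_orbit μ hint (hcont v))
          (integrable_smul_orbit μ hint (hcont w)))
      map_smul' := fun c v => Subtype.ext (by
        change ∫ g, f g • R g (c • (v : 𝓗)) ∂μ = _
        simp only [map_smul, smul_comm _ c]
        exact integral_smul c _) }
  have htr : ∀ v w : fixedVectors R W, inner ℂ v (A w) =
      ∫ g, f g * inner ℂ (v : 𝓗) (R g w) ∂μ := fun v w => inner_repOp μ hint _ (hcont w)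
  have h1 := LinearMap.trace_eq_sum_inner A b
  have h2 := LinearMap.trace_eq_sum_inner A bu
  simp only [htr] at h1 h2
  rw [← h1, h2, Fintype.sum_sigma]
  refine Finset.sum_congr rfl fun i _ => ?_
  change hilbertTrace ((E i).σ.op μ f) = _
  rw [hilbertTrace_op_eq_sum μ hf hint (E i).σ _ (he i)]
  refine Finset.sum_congr rfl fun j _ => ?_
  refine integral_congr_ae (Filter.Eventually.of_forall fun g => ?_)
  simp only [hbu]
  change _ = f g * inner ℂ ((E i).T (e i j)) (R g ((E i).T (e i j)))
  rw [← (E i).map_ρ, LinearIsometry.inner_map_map]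

end SpectralSide

/-! ### The representation on `L²(Γ \ G, ω)` -/

section InvariantFunctions

variable {G : Type*} [Group G] [TopologicalSpace G] [IsTopologicalGroup G]
  [SecondCountableTopology G] [T2Space G]
  [MeasurableSpace G] [BorelSpace G] {μ : Measure G}
  {Γ W : Subgroup G} [DiscreteTopology Γ] {ι : Type*} {x : ι → G}

lemma IsTiling.latticeMeasure_eq [μ.IsMulLeftInvariant] [SFinite μ] (hx : IsTiling Γ W x)
    (hWo : IsOpen (W : Set G)) :
    latticeMeasure Γ μ = (μ.restrict (domain W x)).map (toQuot Γ) := by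
  have := countable_of_discreteTopology Γ
  have hw := hx.isWeight hWo
  rw [latticeMeasure, hw.quotientMeasure_eq, withDensity_indicator_one (measurableSet_domain hWo)]

lemma measurePreserving_mul_right_restrict [μ.IsMulRightInvariant] {D : Set G}
    (hD : MeasurableSet D) (g : G) :
    MeasurePreserving (fun y => y * g) (μ.restrict {y | y * g ∈ D}) (μ.restrict D) :=
  (measurePreserving_mul_right μ g).restrict_preimage hD

lemma IsTiling.isFundamentalDomain_mul_right (hx : IsTiling Γ W x) (hWo : IsOpen (W : Set G))
    (g : G) : IsFundamentalDomain Γ {y | y * g ∈ domain W x} μ := by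
  refine IsFundamentalDomain.mk' ((measurableSet_domain hWo).preimage
    (measurable_mul_const g)).nullMeasurableSet fun y => ?_
  have := hx.existsUnique (y * g)
  simpa only [Set.mem_ofPred_eq, Subgroup.smul_def, smul_eq_mul, mul_assoc] using this

/-- Right translation preserves the integral over `Γ \ G`. -/
lemma IsTiling.setLIntegral_mul_right [μ.IsMulLeftInvariant] [μ.IsMulRightInvariant]
    (hx : IsTiling Γ W x) (hWo : IsOpen (W : Set G)) {F : G → ℝ≥0∞} (hF : Measurable F)
    (hFΓ : ∀ (γ : Γ) y, F (γ * y) = F y) (g : G) :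
    ∫⁻ y in domain W x, F (y * g) ∂μ = ∫⁻ y in domain W x, F y ∂μ := by
  have := countable_of_discreteTopology Γ
  rw [← (measurePreserving_mul_right_restrict (measurableSet_domain hWo) g).lintegral_comp hF]
  refine (hx.isFundamentalDomain μ hWo).setLIntegral_eq
    (hx.isFundamentalDomain_mul_right hWo g) (fun y => F (y * g)) fun γ y => ?_
  rw [Subgroup.smul_def, smul_eq_mul, mul_assoc, hFΓ]

lemma IsTiling.setIntegral_mul_right [μ.IsMulLeftInvariant] [μ.IsMulRightInvariant]
    (hx : IsTiling Γ W x) (hWo : IsOpen (W : Set G)) {F : G → ℂ}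
    (hFΓ : ∀ (γ : Γ) y, F (γ * y) = F y) (g : G) :
    ∫ y in domain W x, F (y * g) ∂μ = ∫ y in domain W x, F y ∂μ := by
  have := countable_of_discreteTopology Γ
  rw [← (measurePreserving_mul_right_restrict (measurableSet_domain hWo) g).integral_comp
    (measurableEmbedding_mulRight g) F]
  refine (hx.isFundamentalDomain μ hWo).setIntegral_eq
    (hx.isFundamentalDomain_mul_right hWo g) (f := fun y => F (y * g)) fun γ y => ?_
  rw [Subgroup.smul_def, smul_eq_mul, mul_assoc, hFΓ]

end InvariantFunctions

section Functions

variable {G : Type*} [Group G] [MeasurableSpace G] {μ : Measure G} {Γ : Subgroup G}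
  {V : Type*} [NormedAddCommGroup V] [InnerProductSpace ℂ V] {ω : Γ →* (V ≃ₗᵢ[ℂ] V)}

lemma PreL2.stronglyMeasurable (φ : PreL2 Γ ω μ) : StronglyMeasurable φ.fn := φ.2.1

lemma PreL2.isEquivariant (φ : PreL2 Γ ω μ) : IsEquivariant ω φ.fn := φ.2.2.1

lemma PreL2.fn_sub (φ ψ : PreL2 Γ ω μ) : (φ - ψ).fn = φ.fn - ψ.fn := rfl

lemma PreL2.fn_injective {φ ψ : PreL2 Γ ω μ} (h : φ.fn = ψ.fn) : φ = ψ := Subtype.ext h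

lemma inner_invariant (φ ψ : PreL2 Γ ω μ) (γ : Γ) (y : G) :
    (inner ℂ (φ.fn (γ * y)) (ψ.fn (γ * y)) : ℂ) = inner ℂ (φ.fn y) (ψ.fn y) := by
  rw [φ.isEquivariant, ψ.isEquivariant, LinearIsometryEquiv.inner_map_map]

end Functions

section HilbertSpace

variable {G : Type*} [Group G] [TopologicalSpace G] [IsTopologicalGroup G]
  [SecondCountableTopology G] [T2Space G]
  [MeasurableSpace G] [BorelSpace G] {μ : Measure G} [μ.IsMulLeftInvariant] [SFinite μ]
  {Γ W : Subgroup G} [DiscreteTopology Γ] {ι : Type*} {x : ι → G}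
  {V : Type*} [NormedAddCommGroup V] [InnerProductSpace ℂ V] {ω : Γ →* (V ≃ₗᵢ[ℂ] V)}

lemma IsTiling.lintegral_latticeMeasure (hx : IsTiling Γ W x) (hWo : IsOpen (W : Set G))
    {φ : G → V} (hφ : IsEquivariant ω φ) (hm : StronglyMeasurable φ) :
    ∫⁻ q, ‖φ q.out‖ₑ ^ 2 ∂(latticeMeasure Γ μ) = ∫⁻ y in domain W x, ‖φ y‖ₑ ^ 2 ∂μ := by
  rw [hx.latticeMeasure_eq hWo, lintegral_map ((hφ.measurable_enorm_out hm).pow_const 2)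
    (measurable_toQuot Γ)]
  simp only [hφ.norm_out]

/-- An element of `PreL2`, from a square integrable function on a fundamental domain. -/
def IsTiling.mkPreL2 (hx : IsTiling Γ W x) (hWo : IsOpen (W : Set G))
    (φ : G → V) (hm : StronglyMeasurable φ) (hφ : IsEquivariant ω φ)
    (hfin : ∫⁻ y in domain W x, ‖φ y‖ₑ ^ 2 ∂μ < ∞) : PreL2 Γ ω μ :=
  ⟨φ, hm, hφ, by rwa [hx.lintegral_latticeMeasure hWo hφ hm]⟩

lemma PreL2.setLIntegral_lt_top (hx : IsTiling Γ W x) (hWo : IsOpen (W : Set G))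
    (φ : PreL2 Γ ω μ) : ∫⁻ y in domain W x, ‖φ.fn y‖ₑ ^ 2 ∂μ < ∞ := by
  rw [← hx.lintegral_latticeMeasure hWo φ.isEquivariant φ.stronglyMeasurable]
  exact φ.2.2.2

lemma PreL2.inner_eq (hx : IsTiling Γ W x) (hWo : IsOpen (W : Set G)) (φ ψ : PreL2 Γ ω μ) :
    inner ℂ φ ψ = ∫ y in domain W x, inner ℂ (φ.fn y) (ψ.fn y) ∂μ := by
  change ∫ q : LeftQuot Γ, inner ℂ (φ.fn q.out) (ψ.fn q.out) ∂(latticeMeasure Γ μ) = _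
  have h := (φ.integrable_inner ψ).1
  rw [hx.latticeMeasure_eq hWo] at h ⊢
  rw [integral_map (measurable_toQuot Γ).aemeasurable h]
  exact integral_congr_ae (Filter.Eventually.of_forall fun y =>
    φ.isEquivariant.inner_out ψ.isEquivariant y)

lemma PreL2.mk_eq_mk_iff (hx : IsTiling Γ W x) (hWo : IsOpen (W : Set G)) (φ ψ : PreL2 Γ ω μ) :
    (SeparationQuotient.mk φ : L2 Γ ω μ) = SeparationQuotient.mk ψ ↔ φ.fn =ᵐ[μ] ψ.fn := by
  have := countable_of_discreteTopology Γ
  have hD := hx.isFundamentalDomain μ hWo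
  rw [SeparationQuotient.mk_eq_mk, Metric.inseparable_iff, dist_eq_norm, ← sq_eq_zero_iff,
    @norm_sq_eq_re_inner ℂ, PreL2.inner_eq hx hWo]
  have hint : IntegrableOn (fun y => inner ℂ ((φ - ψ).fn y) ((φ - ψ).fn y)) (domain W x) μ := by
    have h := (φ - ψ).integrable_inner (φ - ψ)
    rw [hx.latticeMeasure_eq hWo] at h
    have h2 := h.comp_measurable (measurable_toQuot Γ)
    refine h2.congr (Filter.Eventually.of_forall fun y => ?_)
    exact (φ - ψ).isEquivariant.inner_out (φ - ψ).isEquivariant y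
  rw [← integral_re hint, integral_eq_zero_iff_of_nonneg (fun y => inner_self_nonneg) hint.re]
  have hset : ∀ y, (RCLike.re (inner ℂ ((φ - ψ).fn y) ((φ - ψ).fn y) : ℂ) = 0) ↔
      φ.fn y = ψ.fn y := fun y => by
    rw [← norm_sq_eq_re_inner, sq_eq_zero_iff, norm_eq_zero, PreL2.fn_sub, Pi.sub_apply,
      sub_eq_zero]
  constructor
  · intro h
    have h1 : ∀ᵐ y ∂(μ.restrict (domain W x)), φ.fn y = ψ.fn y := by
      filter_upwards [h] with y hy using (hset y).mp hy
    have h2 : μ ({y | ¬ φ.fn y = ψ.fn y} ∩ domain W x) = 0 := by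
      rw [ae_iff, Measure.restrict_apply' (measurableSet_domain hWo)] at h1
      exact h1
    refine hD.measure_zero_of_invariant _ (fun γ => ?_) h2
    ext y
    have h3 : ∀ z, (φ.fn ((γ : G) * z) = ψ.fn ((γ : G) * z)) ↔ φ.fn z = ψ.fn z := fun z => by
      rw [φ.isEquivariant, ψ.isEquivariant, (ω γ).injective.eq_iff]
    rw [Set.mem_smul_set_iff_inv_smul_mem]
    have h4 := h3 (γ⁻¹ • y)
    have h5 : (γ : G) * (γ⁻¹ • y) = y := smul_inv_smul γ y
    rw [h5] at h4
    exact not_congr h4.symm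
  · intro h
    filter_upwards [ae_restrict_of_ae h] with y hy using (hset y).mpr hy

end HilbertSpace

section Shift

variable {G : Type*} [Group G] [TopologicalSpace G] [IsTopologicalGroup G]
  [SecondCountableTopology G] [T2Space G]
  [MeasurableSpace G] [BorelSpace G] {μ : Measure G} [μ.IsMulLeftInvariant] [SFinite μ]
  [μ.IsMulRightInvariant]
  {Γ W : Subgroup G} [DiscreteTopology Γ] {ι : Type*} {x : ι → G}
  {V : Type*} [NormedAddCommGroup V] [InnerProductSpace ℂ V] {ω : Γ →* (V ≃ₗᵢ[ℂ] V)}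

/-- The right shift `(R(g) φ)(y) = φ(y g)` of functions. -/
def preShift (hx : IsTiling Γ W x) (hWo : IsOpen (W : Set G)) (g : G) :
    PreL2 Γ ω μ →ₗ[ℂ] PreL2 Γ ω μ where
  toFun φ := hx.mkPreL2 hWo (fun y => φ.fn (y * g))
    (φ.stronglyMeasurable.comp_measurable (measurable_mul_const g))
    (fun γ y => by
      show φ.fn (γ * y * g) = ω γ (φ.fn (y * g))
      rw [mul_assoc, φ.isEquivariant]) (by
      have h := hx.setLIntegral_mul_right (μ := μ) hWo (φ.stronglyMeasurable.enorm.pow_const 2)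
        (fun γ y => by
          rw [φ.isEquivariant, ← ofReal_norm, LinearIsometryEquiv.norm_map, ofReal_norm]) g
      rw [h]
      exact φ.setLIntegral_lt_top hx hWo)
  map_add' _ _ := rfl
  map_smul' _ _ := rfl

lemma preShift_fn (hx : IsTiling Γ W x) (hWo : IsOpen (W : Set G)) (g : G) (φ : PreL2 Γ ω μ)
    (y : G) : (preShift hx hWo g φ).fn y = φ.fn (y * g) := rfl

lemma norm_preShift (hx : IsTiling Γ W x) (hWo : IsOpen (W : Set G)) (g : G) (φ : PreL2 Γ ω μ) :
    ‖preShift hx hWo g φ‖ = ‖φ‖ := by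
  have h : (inner ℂ (preShift hx hWo g φ) (preShift hx hWo g φ) : ℂ) = inner ℂ φ φ := by
    rw [PreL2.inner_eq hx hWo, PreL2.inner_eq hx hWo]
    exact hx.setIntegral_mul_right hWo (F := fun y => inner ℂ (φ.fn y) (φ.fn y))
      (inner_invariant φ φ) g
  rw [@norm_eq_sqrt_re_inner ℂ, @norm_eq_sqrt_re_inner ℂ, h]

/-- The right shift on `L²(Γ \ G, ω)`. -/
def shift (hx : IsTiling Γ W x) (hWo : IsOpen (W : Set G)) (g : G) :
    L2 Γ ω μ →L[ℂ] L2 Γ ω μ :=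
  SeparationQuotient.liftCLM ((SeparationQuotient.mkCLM ℂ (PreL2 Γ ω μ)).comp
    ((preShift hx hWo g).mkContinuous 1 fun φ => by rw [norm_preShift, one_mul]))
    fun _ _ h => (h.map (ContinuousLinearMap.continuous _)).eq

lemma shift_mk (hx : IsTiling Γ W x) (hWo : IsOpen (W : Set G)) (g : G) (φ : PreL2 Γ ω μ) :
    shift hx hWo g (SeparationQuotient.mk φ) = SeparationQuotient.mk (preShift hx hWo g φ) := rfl

lemma shift_mul (hx : IsTiling Γ W x) (hWo : IsOpen (W : Set G)) (g h : G) (Φ : L2 Γ ω μ) :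
    shift hx hWo (g * h) Φ = shift hx hWo g (shift hx hWo h Φ) := by
  obtain ⟨φ, rfl⟩ := SeparationQuotient.surjective_mk Φ
  simp only [shift_mk]
  congr 1
  refine PreL2.fn_injective (funext fun y => ?_)
  simp only [preShift_fn, mul_assoc]

lemma shift_one (hx : IsTiling Γ W x) (hWo : IsOpen (W : Set G)) (Φ : L2 Γ ω μ) :
    shift hx hWo 1 Φ = Φ := by
  obtain ⟨φ, rfl⟩ := SeparationQuotient.surjective_mk Φ
  rw [shift_mk]
  congr 1
  refine PreL2.fn_injective (funext fun y => ?_)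
  rw [preShift_fn, mul_one]

/-- The unitary representation of `G` on `L²(Γ \ G, ω)` by right shifts. -/
def shiftRep (hx : IsTiling Γ W x) (hWo : IsOpen (W : Set G)) :
    G →* (L2 Γ ω μ ≃ₗᵢ[ℂ] L2 Γ ω μ) where
  toFun g :=
    { toFun := shift hx hWo g
      invFun := shift hx hWo g⁻¹
      map_add' := map_add _
      map_smul' := map_smul _
      left_inv := fun Φ => by rw [← shift_mul, inv_mul_cancel, shift_one]
      right_inv := fun Φ => by rw [← shift_mul, mul_inv_cancel, shift_one]
      norm_map' := fun Φ => by
        obtain ⟨φ, rfl⟩ := SeparationQuotient.surjective_mk Φ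
        exact norm_preShift hx hWo g φ }
  map_one' := LinearIsometryEquiv.ext fun Φ => shift_one hx hWo Φ
  map_mul' g h := LinearIsometryEquiv.ext fun Φ => shift_mul hx hWo g h Φ

lemma shiftRep_mk (hx : IsTiling Γ W x) (hWo : IsOpen (W : Set G)) (g : G) (φ : PreL2 Γ ω μ) :
    shiftRep hx hWo g (SeparationQuotient.mk φ) = SeparationQuotient.mk (preShift hx hWo g φ) := rfl

lemma isRightShift_iff (hx : IsTiling Γ W x) (hWo : IsOpen (W : Set G)) (g : G)
    (Φ Ψ : L2 Γ ω μ) : IsRightShift g Φ Ψ ↔ Ψ = shiftRep hx hWo g Φ := by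
  constructor
  · rintro ⟨φ, ψ, rfl, rfl, h⟩
    rw [shiftRep_mk]
    congr 1
    exact PreL2.fn_injective (funext h)
  · rintro rfl
    obtain ⟨φ, rfl⟩ := SeparationQuotient.surjective_mk Φ
    exact ⟨φ, preShift hx hWo g φ, rfl, rfl, fun _ => rfl⟩

lemma intertwiners_eq_homs (hx : IsTiling Γ W x) (hWo : IsOpen (W : Set G)) (π : UnitaryRep G) :
    intertwiners Γ ω μ π = homs (shiftRep hx hWo) π := by
  ext T
  exact forall₂_congr fun g v => isRightShift_iff hx hWo g _ _

/-- A shift invariant class contains a shift invariant function, namely the average over `W` of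
any of its elements; the average agrees almost everywhere with the function by Fubini. -/
lemma exists_invariant_representative [μ.IsOpenPosMeasure]
    [IsFiniteMeasureOnCompacts μ] [CompleteSpace V] (hx : IsTiling Γ W x)
    (hWo : IsOpen (W : Set G)) (hWc : IsCompact (W : Set G)) {Φ : L2 Γ ω μ}
    (hΦ : Φ ∈ fixedVectors (shiftRep hx hWo) W) :
    ∃ φ : PreL2 Γ ω μ, SeparationQuotient.mk φ = Φ ∧ ∀ y, ∀ k ∈ W, φ.fn (y * k) = φ.fn y := by
  obtain ⟨φ, rfl⟩ := SeparationQuotient.surjective_mk Φ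
  have hfin := hWc.measure_lt_top (μ := μ)
  have hpos : 0 < μ.real (W : Set G) := measureReal_pos hWo hWc
  let φ' : G → V := fun y => (μ.real (W : Set G))⁻¹ • ∫ k in (W : Set G), φ.fn (y * k) ∂μ
  have hinv : ∀ y, ∀ k ∈ W, φ' (y * k) = φ' y := by
    intro y k hk
    simp only [φ']
    congr 1
    rw [← integral_indicator hWo.measurableSet, ← integral_indicator hWo.measurableSet,
      ← integral_mul_left_eq_self (fun l => (W : Set G).indicator (fun l => φ.fn (y * l)) l) k]
    congr 1
    ext l
    by_cases hl : l ∈ (W : Set G)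
    · rw [Set.indicator_of_mem hl, Set.indicator_of_mem (W.mul_mem hk hl), mul_assoc]
    · rw [Set.indicator_of_notMem hl, Set.indicator_of_notMem]
      exact fun h => hl ((W.mul_mem_cancel_left hk).mp h)
  have hequiv : IsEquivariant ω φ' := fun γ y => by
    simp only [φ']
    have h1 := ((ω γ).toContinuousLinearEquiv).integral_comp_comm
      (μ := μ.restrict (W : Set G)) (fun k => φ.fn (y * k))
    have h2 : ∀ k, φ.fn (γ * y * k) = ω γ (φ.fn (y * k)) := fun k => by
      rw [mul_assoc, φ.isEquivariant]
    simp only [h2]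
    rw [show ω γ ((μ.real (W : Set G))⁻¹ • ∫ k in (W : Set G), φ.fn (y * k) ∂μ) =
      (μ.real (W : Set G))⁻¹ • ω γ (∫ k in (W : Set G), φ.fn (y * k) ∂μ) from
      (ω γ).toLinearEquiv.toLinearMap.map_smul_of_tower _ _]
    exact congrArg _ h1
  have hae : φ' =ᵐ[μ] φ.fn := by
    have h1 : ∀ k ∈ (W : Set G), ∀ᵐ y ∂μ, φ.fn (y * k) = φ.fn y := fun k hk =>
      (PreL2.mk_eq_mk_iff hx hWo (preShift hx hWo k φ) φ).mp (hΦ k hk)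
    have h2 : ∀ᵐ k ∂(μ.restrict (W : Set G)), ∀ᵐ y ∂μ, φ.fn (y * k) = φ.fn y :=
      (ae_restrict_mem hWo.measurableSet).mono h1
    have hmeas : MeasurableSet {p : G × G | φ.fn (p.2 * p.1) = φ.fn p.2} :=
      StronglyMeasurable.measurableSet_eq_fun
        (φ.stronglyMeasurable.comp_measurable (measurable_snd.mul measurable_fst))
        (φ.stronglyMeasurable.comp_measurable measurable_snd)
    rw [Measure.ae_ae_comm hmeas] at h2
    filter_upwards [h2] with y hy
    simp only [φ']
    rw [integral_congr_ae hy, setIntegral_const, inv_smul_smul₀ hpos.ne']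
  have hm : StronglyMeasurable φ' :=
    (continuous_of_right_invariant hWo hinv).stronglyMeasurable
  let ψ : PreL2 Γ ω μ := hx.mkPreL2 hWo φ' hm hequiv (by
    refine lt_of_eq_of_lt (lintegral_congr_ae ?_) (φ.setLIntegral_lt_top hx hWo)
    filter_upwards [ae_restrict_of_ae hae] with y hy
    rw [hy])
  exact ⟨ψ, (PreL2.mk_eq_mk_iff hx hWo ψ φ).mpr hae, hinv⟩

end Shift

/-! ### Completeness and step functions -/

section Coordinates

variable {G : Type*} [Group G] {Γ W : Subgroup G} {ι : Type*} {x : ι → G}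

/-- The element `γ` of `Γ` for which `y ∈ γ x_i W` for some `i`. -/
def IsTiling.latticePart (hx : IsTiling Γ W x) (y : G) : Γ := (hx.cover y).choose

/-- The index `i` for which `y ∈ Γ x_i W`. -/
def IsTiling.index (hx : IsTiling Γ W x) (y : G) : ι := (hx.cover y).choose_spec.choose

lemma IsTiling.mem_tile (hx : IsTiling Γ W x) (y : G) :
    ((hx.latticePart y : G) * x (hx.index y))⁻¹ * y ∈ W := (hx.cover y).choose_spec.choose_spec

lemma IsTiling.latticePart_eq (hx : IsTiling Γ W x) {γ : Γ} {i : ι} {y : G}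
    (h : ((γ : G) * x i)⁻¹ * y ∈ W) : hx.latticePart y = γ := (hx.unique (hx.mem_tile y) h).1

lemma IsTiling.index_eq (hx : IsTiling Γ W x) {γ : Γ} {i : ι} {y : G}
    (h : ((γ : G) * x i)⁻¹ * y ∈ W) : hx.index y = i := (hx.unique (hx.mem_tile y) h).2

lemma IsTiling.latticePart_mul (hx : IsTiling Γ W x) (γ : Γ) (y : G) :
    hx.latticePart (γ * y) = γ * hx.latticePart y :=
  hx.latticePart_eq (i := hx.index y) (by
    convert hx.mem_tile y using 1; push_cast; group)

lemma IsTiling.index_mul (hx : IsTiling Γ W x) (γ : Γ) (y : G) :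
    hx.index (γ * y) = hx.index y :=
  hx.index_eq (γ := γ * hx.latticePart y) (by
    convert hx.mem_tile y using 1; push_cast; group)

lemma IsTiling.latticePart_mul_right (hx : IsTiling Γ W x) (y : G) {k : G} (hk : k ∈ W) :
    hx.latticePart (y * k) = hx.latticePart y :=
  hx.latticePart_eq (i := hx.index y) (by
    rw [← mul_assoc]; exact W.mul_mem (hx.mem_tile y) hk)

lemma IsTiling.index_mul_right (hx : IsTiling Γ W x) (y : G) {k : G} (hk : k ∈ W) :
    hx.index (y * k) = hx.index y :=
  hx.index_eq (γ := hx.latticePart y) (by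
    rw [← mul_assoc]; exact W.mul_mem (hx.mem_tile y) hk)

lemma IsTiling.latticePart_of_mem_domain (hx : IsTiling Γ W x) {y : G} (hy : y ∈ domain W x) :
    hx.latticePart y = 1 := by
  obtain ⟨i, hi⟩ := hy
  exact hx.latticePart_eq (i := i) (by simpa using hi)

variable {V : Type*} [NormedAddCommGroup V] [InnerProductSpace ℂ V] {ω : Γ →* (V ≃ₗᵢ[ℂ] V)}

/-- The equivariant function that agrees with `u` on the fundamental domain. -/
def IsTiling.extend (hx : IsTiling Γ W x) (ω : Γ →* (V ≃ₗᵢ[ℂ] V)) (u : G → V) (y : G) : V :=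
  ω (hx.latticePart y) (u ((hx.latticePart y : G)⁻¹ * y))

lemma IsTiling.isEquivariant_extend (hx : IsTiling Γ W x) (u : G → V) :
    IsEquivariant ω (hx.extend ω u) := fun γ y => by
  have h : ((γ * hx.latticePart y : Γ) : G)⁻¹ * (γ * y) = (hx.latticePart y : G)⁻¹ * y := by
    push_cast; group
  rw [IsTiling.extend, hx.latticePart_mul, h, map_mul]
  rfl

lemma IsTiling.extend_of_mem_domain (hx : IsTiling Γ W x) (u : G → V) {y : G}
    (hy : y ∈ domain W x) : hx.extend ω u y = u y := by
  simp [IsTiling.extend, hx.latticePart_of_mem_domain hy]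

/-- The equivariant, right `W`-invariant function with given values at the points `x_i`. -/
def IsTiling.stepFn (hx : IsTiling Γ W x) (ω : Γ →* (V ≃ₗᵢ[ℂ] V)) (c : ι → V) (y : G) : V :=
  ω (hx.latticePart y) (c (hx.index y))

lemma IsTiling.stepFn_eq (hx : IsTiling Γ W x) (c : ι → V) {γ : Γ} {i : ι} {y : G}
    (h : ((γ : G) * x i)⁻¹ * y ∈ W) : hx.stepFn ω c y = ω γ (c i) := by
  rw [IsTiling.stepFn, hx.latticePart_eq h, hx.index_eq h]

lemma IsTiling.stepFn_of_mem_tile (hx : IsTiling Γ W x) (c : ι → V) {i : ι} {y : G}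
    (h : (x i)⁻¹ * y ∈ W) : hx.stepFn ω c y = c i := by
  rw [hx.stepFn_eq c (γ := 1) (i := i) (by simpa using h), map_one]; rfl

lemma IsTiling.stepFn_mul_right (hx : IsTiling Γ W x) (c : ι → V) (y : G) {k : G} (hk : k ∈ W) :
    hx.stepFn ω c (y * k) = hx.stepFn ω c y := by
  rw [IsTiling.stepFn, hx.latticePart_mul_right y hk, hx.index_mul_right y hk, IsTiling.stepFn]

lemma IsTiling.isEquivariant_stepFn (hx : IsTiling Γ W x) (c : ι → V) :
    IsEquivariant ω (hx.stepFn ω c) := fun γ y => by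
  rw [IsTiling.stepFn, hx.latticePart_mul, hx.index_mul, map_mul]; rfl

lemma IsTiling.norm_stepFn_le [Fintype ι] (hx : IsTiling Γ W x) (c : ι → V) (y : G) :
    ‖hx.stepFn ω c y‖ ≤ ∑ i, ‖c i‖ := by
  rw [IsTiling.stepFn, LinearIsometryEquiv.norm_map]
  exact Finset.single_le_sum (f := fun i => ‖c i‖) (fun _ _ => norm_nonneg _) (Finset.mem_univ _)

end Coordinates

section Completeness

variable {G : Type*} [Group G] [TopologicalSpace G] [IsTopologicalGroup G]
  [SecondCountableTopology G] [T2Space G]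
  [MeasurableSpace G] [BorelSpace G] {μ : Measure G} [μ.IsMulLeftInvariant] [SFinite μ]
  {Γ W : Subgroup G} [DiscreteTopology Γ] {ι : Type*} {x : ι → G}
  {V : Type*} [NormedAddCommGroup V] [InnerProductSpace ℂ V] {ω : Γ →* (V ≃ₗᵢ[ℂ] V)}

lemma IsTiling.measurable_latticePart (hx : IsTiling Γ W x) (hWo : IsOpen (W : Set G)) :
    Measurable hx.latticePart := by
  have h : Continuous hx.latticePart :=
    continuous_of_right_invariant hWo fun y k hk => hx.latticePart_mul_right y hk
  exact h.measurable

lemma IsTiling.stronglyMeasurable_extend [FiniteDimensional ℂ V] (hx : IsTiling Γ W x)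
    (hWo : IsOpen (W : Set G)) {u : G → V} (hu : StronglyMeasurable u) :
    StronglyMeasurable (hx.extend ω u) := by
  have := countable_of_discreteTopology Γ
  have : ProperSpace V := FiniteDimensional.proper ℂ V
  borelize V
  have h : Measurable fun p : Γ × G => ω p.1 (u ((p.1 : G)⁻¹ * p.2)) :=
    measurable_from_prod_countable_right fun γ =>
      (ω γ).continuous.measurable.comp (hu.measurable.comp (measurable_const_mul (γ : G)⁻¹))
  exact (h.comp ((hx.measurable_latticePart hWo).prodMk measurable_id)).stronglyMeasurable

lemma PreL2.memLp (hx : IsTiling Γ W x) (hWo : IsOpen (W : Set G)) (φ : PreL2 Γ ω μ) :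
    MemLp φ.fn 2 (μ.restrict (domain W x)) := by
  refine ⟨φ.stronglyMeasurable.aestronglyMeasurable, ?_⟩
  rw [eLpNorm_lt_top_iff_lintegral_rpow_enorm_lt_top (by norm_num) (by norm_num)]
  simpa using φ.setLIntegral_lt_top hx hWo

/-- Restriction to the fundamental domain. -/
def restrictDomain (hx : IsTiling Γ W x) (hWo : IsOpen (W : Set G)) :
    PreL2 Γ ω μ →ₗ[ℂ] Lp V 2 (μ.restrict (domain W x)) where
  toFun φ := (φ.memLp hx hWo).toLp φ.fn
  map_add' _ _ := rfl
  map_smul' _ _ := rfl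

lemma norm_restrictDomain (hx : IsTiling Γ W x) (hWo : IsOpen (W : Set G)) (φ : PreL2 Γ ω μ) :
    ‖restrictDomain hx hWo φ‖ = ‖φ‖ := by
  rw [@norm_eq_sqrt_re_inner ℂ, @norm_eq_sqrt_re_inner ℂ, L2.inner_def, PreL2.inner_eq hx hWo]
  congr 2
  refine integral_congr_ae ?_
  filter_upwards [(φ.memLp hx hWo).coeFn_toLp] with y hy
  change inner ℂ ((φ.memLp hx hWo).toLp φ.fn y) ((φ.memLp hx hWo).toLp φ.fn y) = _
  rw [hy]

lemma surjective_restrictDomain [FiniteDimensional ℂ V] (hx : IsTiling Γ W x)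
    (hWo : IsOpen (W : Set G)) :
    Function.Surjective (restrictDomain hx hWo : PreL2 Γ ω μ → _) := by
  intro u
  have hu := Lp.stronglyMeasurable u
  have hae : hx.extend ω u =ᵐ[μ.restrict (domain W x)] u := by
    filter_upwards [ae_restrict_mem (measurableSet_domain hWo)] with y hy
    exact hx.extend_of_mem_domain u hy
  have hfin : ∫⁻ y in domain W x, ‖hx.extend ω u y‖ₑ ^ 2 ∂μ < ∞ := by
    have h1 := (Lp.memLp u).2
    rw [eLpNorm_lt_top_iff_lintegral_rpow_enorm_lt_top (by norm_num) (by norm_num)] at h1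
    refine lt_of_eq_of_lt (lintegral_congr_ae ?_) h1
    filter_upwards [hae] with y hy
    simp [hy]
  let φ : PreL2 Γ ω μ :=
    hx.mkPreL2 hWo _ (hx.stronglyMeasurable_extend hWo hu) (hx.isEquivariant_extend u) hfin
  exact ⟨φ, Lp.ext ((φ.memLp hx hWo).coeFn_toLp.trans hae)⟩

/-- Restriction to a fundamental domain identifies `L²(Γ \ G, ω)` with an ordinary `L²` space. -/
lemma completeSpace_L2 [FiniteDimensional ℂ V] (hx : IsTiling Γ W x) (hWo : IsOpen (W : Set G)) :
    CompleteSpace (L2 Γ ω μ) := by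
  have : CompleteSpace V := FiniteDimensional.complete ℂ V
  have h : IsUniformInducing (restrictDomain hx hWo : PreL2 Γ ω μ → _) :=
    (AddMonoidHomClass.isometry_of_norm _ (norm_restrictDomain hx hWo)).isUniformInducing
  have : CompleteSpace (PreL2 Γ ω μ) :=
    (h.completeSpace_congr (surjective_restrictDomain hx hWo)).mpr inferInstance
  infer_instance

end Completeness

section StepFunctions

variable {G : Type*} [Group G] [TopologicalSpace G] [IsTopologicalGroup G]
  [LocallyCompactSpace G] [SecondCountableTopology G] [T2Space G]
  [MeasurableSpace G] [BorelSpace G] {μ : Measure G} [μ.IsHaarMeasure]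
  {Γ W : Subgroup G} [DiscreteTopology Γ] {ι : Type*} [Fintype ι] {x : ι → G}
  {V : Type*} [NormedAddCommGroup V] [InnerProductSpace ℂ V] {ω : Γ →* (V ≃ₗᵢ[ℂ] V)}

lemma IsTiling.continuous_stepFn (hx : IsTiling Γ W x) (hWo : IsOpen (W : Set G)) (c : ι → V) :
    Continuous (hx.stepFn ω c) :=
  continuous_of_right_invariant hWo fun y _ hk => hx.stepFn_mul_right c y hk

lemma IsTiling.setLIntegral_stepFn (hx : IsTiling Γ W x) (hWo : IsOpen (W : Set G))
    (c : ι → V) : ∫⁻ y in domain W x, ‖hx.stepFn ω c y‖ₑ ^ 2 ∂μ = ∑ i, ‖c i‖ₑ ^ 2 * μ W := by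
  rw [domain_eq_iUnion, lintegral_iUnion (fun i => measurableSet_tile hWo _)
    (fun i j hij => hx.disjoint hij), tsum_fintype]
  refine Finset.sum_congr rfl fun i _ => ?_
  rw [← measure_tile μ (x i), ← setLIntegral_const]
  exact setLIntegral_congr_fun (measurableSet_tile hWo _) fun y hy => by
    rw [hx.stepFn_of_mem_tile c hy]

variable (μ ω) in
/-- `stepFn`, as a linear map to square integrable functions. -/
def stepPreL2 (hx : IsTiling Γ W x) (hWo : IsOpen (W : Set G)) (hWc : IsCompact (W : Set G)) :
    (ι → V) →ₗ[ℂ] PreL2 Γ ω μ where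
  toFun c := hx.mkPreL2 hWo (hx.stepFn ω c) (hx.continuous_stepFn hWo c).stronglyMeasurable
    (hx.isEquivariant_stepFn c) (by
      rw [hx.setLIntegral_stepFn hWo]
      exact ENNReal.sum_lt_top.mpr fun i _ =>
        ENNReal.mul_lt_top (ENNReal.pow_lt_top enorm_lt_top) hWc.measure_lt_top)
  map_add' c d := PreL2.fn_injective (funext fun y => map_add (ω (hx.latticePart y)) _ _)
  map_smul' a c := PreL2.fn_injective (funext fun y => map_smul (ω (hx.latticePart y)) _ _)

lemma stepPreL2_fn (hx : IsTiling Γ W x) (hWo : IsOpen (W : Set G)) (hWc : IsCompact (W : Set G))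
    (c : ι → V) : (stepPreL2 μ ω hx hWo hWc c).fn = hx.stepFn ω c := rfl

lemma norm_stepPreL2_sq (hx : IsTiling Γ W x) (hWo : IsOpen (W : Set G))
    (hWc : IsCompact (W : Set G)) (c : ι → V) :
    ‖stepPreL2 μ ω hx hWo hWc c‖ ^ 2 = μ.real W * ∑ i, ‖c i‖ ^ 2 := by
  have hc : ∀ i, ∀ y ∈ {y | (x i)⁻¹ * y ∈ W},
      (inner ℂ (hx.stepFn ω c y) (hx.stepFn ω c y) : ℂ) = ((‖c i‖ ^ 2 : ℝ) : ℂ) := fun i y hy => by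
    rw [hx.stepFn_of_mem_tile c hy, inner_self_eq_norm_sq_to_K]; norm_cast
  rw [@norm_sq_eq_re_inner ℂ, PreL2.inner_eq hx hWo, stepPreL2_fn, domain_eq_iUnion,
    integral_iUnion_fintype (fun i => measurableSet_tile hWo _) (fun i j hij => hx.disjoint hij)]
  · rw [Finset.mul_sum, map_sum]
    refine Finset.sum_congr rfl fun i _ => ?_
    rw [setIntegral_congr_fun (measurableSet_tile hWo _) (hc i), setIntegral_const, Measure.real,
      measure_tile, Complex.real_smul, ← Complex.ofReal_mul]
    exact Complex.ofReal_re _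
  · intro i
    refine IntegrableOn.congr_fun (f := fun _ => ((‖c i‖ ^ 2 : ℝ) : ℂ)) ?_
      (fun y hy => (hc i y hy).symm) (measurableSet_tile hWo _)
    exact integrableOn_const (by rw [measure_tile]; exact hWc.measure_lt_top.ne)

end StepFunctions

/-! ### The trace of `R(f)` on the invariant vectors -/

section InvariantBasis

variable {G : Type*} [Group G] [TopologicalSpace G] [IsTopologicalGroup G]
  [LocallyCompactSpace G] [SecondCountableTopology G] [T2Space G]
  [MeasurableSpace G] [BorelSpace G] {μ : Measure G} [μ.IsHaarMeasure] [μ.IsMulRightInvariant]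
  {Γ W : Subgroup G} [DiscreteTopology Γ] {ι : Type*} [Fintype ι] {x : ι → G}
  {V : Type*} [NormedAddCommGroup V] [InnerProductSpace ℂ V] {ω : Γ →* (V ≃ₗᵢ[ℂ] V)}

lemma stepPreL2_mem_fixedVectors (hx : IsTiling Γ W x) (hWo : IsOpen (W : Set G))
    (hWc : IsCompact (W : Set G)) (c : ι → V) :
    (SeparationQuotient.mk (stepPreL2 μ ω hx hWo hWc c) : L2 Γ ω μ) ∈
      fixedVectors (shiftRep hx hWo) W := fun k hk => by
  rw [shiftRep_mk]
  congr 1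
  refine PreL2.fn_injective (funext fun y => ?_)
  rw [preShift_fn, stepPreL2_fn, hx.stepFn_mul_right c y hk]

variable (μ ω) in
/-- The space of `W`-invariant vectors in `L²(Γ \ G, ω)`, as a sum of copies of `V` indexed by the
double cosets `Γ x_i W`; the factor makes the map isometric. -/
def stepIsometry (hx : IsTiling Γ W x) (hWo : IsOpen (W : Set G)) (hWc : IsCompact (W : Set G)) :
    PiLp 2 (fun _ : ι => V) →ₗᵢ[ℂ] fixedVectors (shiftRep (μ := μ) (ω := ω) hx hWo) W where
  toLinearMap := (((Real.sqrt (μ.real (W : Set G)))⁻¹ : ℝ) : ℂ) •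
    LinearMap.codRestrict (fixedVectors (shiftRep hx hWo) W)
      ((SeparationQuotient.mkCLM ℂ (PreL2 Γ ω μ)).toLinearMap ∘ₗ stepPreL2 μ ω hx hWo hWc ∘ₗ
        (WithLp.linearEquiv 2 ℂ (ι → V)).toLinearMap)
      fun c => stepPreL2_mem_fixedVectors hx hWo hWc _
  norm_map' c := by
    have hpos := measureReal_pos (μ := μ) hWo hWc
    have h : ‖stepPreL2 μ ω hx hWo hWc c.ofLp‖ = Real.sqrt (μ.real (W : Set G)) * ‖c‖ := by
      rw [← Real.sqrt_sq (norm_nonneg (stepPreL2 μ ω hx hWo hWc c.ofLp)), norm_stepPreL2_sq,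
        Real.sqrt_mul hpos.le, PiLp.norm_eq_of_L2]
    rw [LinearMap.smul_apply, norm_smul, Complex.norm_real, norm_inv,
      Real.norm_of_nonneg (Real.sqrt_nonneg _)]
    change _ * ‖stepPreL2 μ ω hx hWo hWc c.ofLp‖ = _
    rw [h, inv_mul_cancel_left₀ (Real.sqrt_pos.mpr hpos).ne']

lemma stepIsometry_apply (hx : IsTiling Γ W x) (hWo : IsOpen (W : Set G))
    (hWc : IsCompact (W : Set G)) (c : PiLp 2 (fun _ : ι => V)) :
    (stepIsometry μ ω hx hWo hWc c : L2 Γ ω μ) = (((Real.sqrt (μ.real (W : Set G)))⁻¹ : ℝ) : ℂ) •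
      SeparationQuotient.mk (stepPreL2 μ ω hx hWo hWc c.ofLp) := rfl

lemma surjective_stepIsometry [CompleteSpace V] (hx : IsTiling Γ W x) (hWo : IsOpen (W : Set G))
    (hWc : IsCompact (W : Set G)) : Function.Surjective (stepIsometry μ ω hx hWo hWc) := by
  rintro ⟨Φ, hΦ⟩
  obtain ⟨φ, rfl, hφ⟩ := exists_invariant_representative hx hWo hWc hΦ
  have hs : (((Real.sqrt (μ.real (W : Set G)))⁻¹ : ℝ) : ℂ) ≠ 0 :=
    Complex.ofReal_ne_zero.mpr (inv_ne_zero (Real.sqrt_pos.mpr (measureReal_pos hWo hWc)).ne')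
  -- an invariant function is determined by its values at the points `x_i`
  have hstep : stepPreL2 μ ω hx hWo hWc (fun i => φ.fn (x i)) = φ := by
    refine PreL2.fn_injective (funext fun y => ?_)
    rw [stepPreL2_fn, IsTiling.stepFn, ← φ.isEquivariant, ← hφ _ _ (hx.mem_tile y),
      mul_inv_cancel_left]
  refine ⟨(((Real.sqrt (μ.real (W : Set G)))⁻¹ : ℝ) : ℂ)⁻¹ • WithLp.toLp 2 fun i => φ.fn (x i),
    Subtype.ext ?_⟩
  rw [map_smul, Submodule.coe_smul, stepIsometry_apply, inv_smul_smul₀ hs, hstep]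

variable (μ ω) in
/-- The isometry between the sum of copies of `V` and the space of `W`-invariant vectors. -/
def stepEquiv [CompleteSpace V] (hx : IsTiling Γ W x) (hWo : IsOpen (W : Set G))
    (hWc : IsCompact (W : Set G)) :
    PiLp 2 (fun _ : ι => V) ≃ₗᵢ[ℂ] fixedVectors (shiftRep (μ := μ) (ω := ω) hx hWo) W :=
  LinearIsometryEquiv.ofSurjective _ (surjective_stepIsometry hx hWo hWc)

lemma finiteDimensional_fixedVectors_shiftRep [FiniteDimensional ℂ V] (hx : IsTiling Γ W x)
    (hWo : IsOpen (W : Set G)) (hWc : IsCompact (W : Set G)) :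
    FiniteDimensional ℂ (fixedVectors (shiftRep (μ := μ) (ω := ω) hx hWo) W) := by
  have : CompleteSpace V := FiniteDimensional.complete ℂ V
  have : FiniteDimensional ℂ (PiLp 2 (fun _ : ι => V)) := inferInstance
  exact (stepEquiv μ ω hx hWo hWc).toLinearEquiv.finiteDimensional

end InvariantBasis

section MatrixCoefficients

variable {G : Type*} [Group G] [TopologicalSpace G] [IsTopologicalGroup G]
  [LocallyCompactSpace G] [SecondCountableTopology G] [T2Space G]
  [MeasurableSpace G] [BorelSpace G] {μ : Measure G} [μ.IsHaarMeasure] [μ.IsMulRightInvariant]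
  {Γ W : Subgroup G} [DiscreteTopology Γ] {ι : Type*} [Fintype ι] [DecidableEq ι] {x : ι → G}
  {V : Type*} [NormedAddCommGroup V] [InnerProductSpace ℂ V] {ω : Γ →* (V ≃ₗᵢ[ℂ] V)}
  {f : G → ℂ}

/-- The integral over `Γ x_j W` is a sum over the disjoint tiles `γ x_j W`. -/
lemma integral_mul_inner_stepFn_single (hfree : ActsFreely Γ W) (hx : IsTiling Γ W x)
    (hWo : IsOpen (W : Set G)) (hf : ∀ k ∈ W, ∀ g, f (g * k) = f g) (hint : Integrable f μ)
    (j : ι) (v : V) :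
    ∫ g, f ((x j)⁻¹ * g) * inner ℂ v (hx.stepFn ω (Pi.single j v) g) ∂μ =
      μ.real W * ∑' γ : Γ, f ((x j)⁻¹ * γ * x j) * inner ℂ v (ω γ v) := by
  have := countable_of_discreteTopology Γ
  -- the step function vanishes off `Γ x_j W`
  have hzero : ∀ g, g ∉ (⋃ γ : Γ, {g | ((γ : G) * x j)⁻¹ * g ∈ W}) →
      f ((x j)⁻¹ * g) * inner ℂ v (hx.stepFn ω (Pi.single j v) g) = 0 := by
    intro g hg
    have hne : hx.index g ≠ j := fun h =>
      hg (Set.mem_iUnion.mpr ⟨hx.latticePart g, by simpa [h] using hx.mem_tile g⟩)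
    rw [IsTiling.stepFn, Pi.single_eq_of_ne hne, map_zero, inner_zero_right, mul_zero]
  have hi : Integrable
      (fun g => f ((x j)⁻¹ * g) * inner ℂ v (hx.stepFn ω (Pi.single j v) g)) μ := by
    refine (hint.comp_mul_left (x j)⁻¹).mul_bdd (c := ‖v‖ * ∑ i, ‖(Pi.single j v : ι → V) i‖) ?_ ?_
    · exact (continuous_const.inner (hx.continuous_stepFn hWo _)).aestronglyMeasurable
    · exact Filter.Eventually.of_forall fun g => (norm_inner_le_norm _ _).trans
        (mul_le_mul_of_nonneg_left (hx.norm_stepFn_le _ _) (norm_nonneg _))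
  rw [← setIntegral_eq_integral_of_forall_compl_eq_zero hzero,
    integral_iUnion (fun γ => measurableSet_tile hWo _) (hfree.disjoint_tile (x j))
      hi.integrableOn, ← tsum_mul_left]
  refine tsum_congr fun γ => ?_
  have hc : ∀ g ∈ {g | ((γ : G) * x j)⁻¹ * g ∈ W},
      f ((x j)⁻¹ * g) * inner ℂ v (hx.stepFn ω (Pi.single j v) g) =
        f ((x j)⁻¹ * γ * x j) * inner ℂ v (ω γ v) := fun g hg => by
    rw [hx.stepFn_eq _ hg, Pi.single_eq_same, ← hf _ hg ((x j)⁻¹ * γ * x j)]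
    congr 2; group
  rw [setIntegral_congr_fun (measurableSet_tile hWo _) hc, setIntegral_const, Measure.real,
    measure_tile, Complex.real_smul, Measure.real]

lemma integral_mul_inner_shift (hfree : ActsFreely Γ W) (hx : IsTiling Γ W x)
    (hWo : IsOpen (W : Set G)) (hWc : IsCompact (W : Set G))
    (hf : ∀ u ∈ W, ∀ v ∈ W, ∀ g, f (u * g * v) = f g) (hint : Integrable f μ) (j : ι) (v : V) :
    ∫ g, f g * inner ℂ
        (SeparationQuotient.mk (stepPreL2 μ ω hx hWo hWc (Pi.single j v)) : L2 Γ ω μ)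
        (shiftRep hx hWo g (SeparationQuotient.mk (stepPreL2 μ ω hx hWo hWc (Pi.single j v)))) ∂μ =
      μ.real W * (μ.real W * ∑' γ : Γ, f ((x j)⁻¹ * γ * x j) * inner ℂ v (ω γ v)) := by
  set φ := hx.stepFn ω (Pi.single j v) with hφ
  have hfin : IsFiniteMeasure (μ.restrict (domain W x)) :=
    ⟨by rw [Measure.restrict_apply_univ]; exact measure_domain_lt_top μ hWc⟩
  have hφc : Continuous φ := hx.continuous_stepFn hWo _
  have hφb : ∀ y, ‖φ y‖ ≤ ∑ i, ‖(Pi.single j v : ι → V) i‖ := hx.norm_stepFn_le _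
  have hin : ∀ g, inner ℂ
        (SeparationQuotient.mk (stepPreL2 μ ω hx hWo hWc (Pi.single j v)) : L2 Γ ω μ)
        (shiftRep hx hWo g (SeparationQuotient.mk (stepPreL2 μ ω hx hWo hWc (Pi.single j v)))) =
      ∫ y in domain W x, inner ℂ (φ y) (φ (y * g)) ∂μ := fun g => by
    rw [shiftRep_mk, SeparationQuotient.inner_mk_mk, PreL2.inner_eq hx hWo]
    rfl
  have hprod : Integrable (Function.uncurry fun (g y : G) => f g * inner ℂ (φ y) (φ (y * g)))
      (μ.prod (μ.restrict (domain W x))) := by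
    refine (hint.comp_fst (μ.restrict (domain W x))).mul_bdd
      (c := (∑ i, ‖(Pi.single j v : ι → V) i‖) * ∑ i, ‖(Pi.single j v : ι → V) i‖) ?_ ?_
    · exact ((hφc.comp continuous_snd).inner
        (hφc.comp (continuous_snd.mul continuous_fst))).aestronglyMeasurable
    · exact Filter.Eventually.of_forall fun p => (norm_inner_le_norm _ _).trans
        (mul_le_mul (hφb _) (hφb _) (norm_nonneg _) (Finset.sum_nonneg fun _ _ => norm_nonneg _))
  -- after Fubini, the inner integral is constant on the tile `x_j W`, and zero on the others
  have hinner : ∀ y ∈ domain W x, ∫ g, f g * inner ℂ (φ y) (φ (y * g)) ∂μ =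
      {y | (x j)⁻¹ * y ∈ W}.indicator
        (fun _ => ∫ g, f ((x j)⁻¹ * g) * inner ℂ v (φ g) ∂μ) y := by
    rintro y ⟨i, hi⟩
    by_cases hij : i = j
    · subst hij
      have hy : φ y = v := by rw [hφ, hx.stepFn_of_mem_tile _ hi, Pi.single_eq_same]
      rw [Set.indicator_of_mem (by exact hi),
        ← integral_mul_left_eq_self (fun g => f g * inner ℂ (φ y) (φ (y * g))) y⁻¹]
      refine integral_congr_ae (Filter.Eventually.of_forall fun g => ?_)
      simp only [mul_inv_cancel_left, hy]
      rw [← hf _ (W.inv_mem hi) 1 W.one_mem ((x i)⁻¹ * g)]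
      congr 2; group
    · have hy : φ y = 0 := by rw [hφ, hx.stepFn_of_mem_tile _ hi, Pi.single_eq_of_ne hij]
      have hj : y ∉ {y | (x j)⁻¹ * y ∈ W} := fun h =>
        Set.disjoint_left.mp (hx.disjoint hij) hi h
      rw [Set.indicator_of_notMem hj]
      simp [hy]
  have hsub : domain W x ∩ {y | (x j)⁻¹ * y ∈ W} = {y | (x j)⁻¹ * y ∈ W} :=
    Set.inter_eq_right.mpr fun y hy => ⟨j, hy⟩
  simp only [hin, ← integral_const_mul]
  rw [integral_integral_swap hprod, setIntegral_congr_fun (measurableSet_domain hWo) hinner,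
    setIntegral_indicator (measurableSet_tile hWo _), hsub, setIntegral_const,
    integral_mul_inner_stepFn_single hfree hx hWo
      (fun k hk g => by simpa using hf 1 W.one_mem k hk g) hint, Measure.real, measure_tile,
    Complex.real_smul, Measure.real]

end MatrixCoefficients

section Trace

variable {G : Type*} [Group G] [TopologicalSpace G] [IsTopologicalGroup G]
  [LocallyCompactSpace G] [SecondCountableTopology G] [T2Space G]
  [MeasurableSpace G] [BorelSpace G] {μ : Measure G} [μ.IsHaarMeasure] [μ.IsMulRightInvariant]
  {Γ W : Subgroup G} [DiscreteTopology Γ] {ι : Type*} [Fintype ι] {x : ι → G}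
  {V : Type*} [NormedAddCommGroup V] [InnerProductSpace ℂ V] [FiniteDimensional ℂ V]
  {ω : Γ →* (V ≃ₗᵢ[ℂ] V)} {f : G → ℂ}

variable (μ ω) in
/-- An orthonormal basis of the space of `W`-invariant vectors in `L²(Γ \ G, ω)`, consisting of
functions supported on one double coset `Γ x_i W` each. -/
def invariantBasis (hx : IsTiling Γ W x) (hWo : IsOpen (W : Set G)) (hWc : IsCompact (W : Set G)) :
    OrthonormalBasis ((_ : ι) × Fin (Module.finrank ℂ V)) ℂ
      (fixedVectors (shiftRep (μ := μ) (ω := ω) hx hWo) W) :=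
  have : CompleteSpace V := FiniteDimensional.complete ℂ V
  (Pi.orthonormalBasis fun _ => stdOrthonormalBasis ℂ V).map (stepEquiv μ ω hx hWo hWc)

lemma invariantBasis_apply [DecidableEq ι] (hx : IsTiling Γ W x) (hWo : IsOpen (W : Set G))
    (hWc : IsCompact (W : Set G)) (j : ι) (a : Fin (Module.finrank ℂ V)) :
    (invariantBasis μ ω hx hWo hWc ⟨j, a⟩ : L2 Γ ω μ) =
      (((Real.sqrt (μ.real (W : Set G)))⁻¹ : ℝ) : ℂ) • SeparationQuotient.mk
        (stepPreL2 μ ω hx hWo hWc (Pi.single j (stdOrthonormalBasis ℂ V a))) := by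
  rw [invariantBasis, OrthonormalBasis.map_apply, Pi.orthonormalBasis_apply]
  rfl

/-- The trace of `R(f)` on the space of `W`-invariant vectors. -/
lemma sum_integral_invariantBasis (hfree : ActsFreely Γ W) (hx : IsTiling Γ W x)
    (hWo : IsOpen (W : Set G)) (hWc : IsCompact (W : Set G))
    (hf : ∀ u ∈ W, ∀ v ∈ W, ∀ g, f (u * g * v) = f g) (hint : Integrable f μ) :
    ∑ k, ∫ g, f g * inner ℂ (invariantBasis μ ω hx hWo hWc k : L2 Γ ω μ)
        (shiftRep hx hWo g (invariantBasis μ ω hx hWo hWc k)) ∂μ =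
      ∑' γ : Γ, character ω γ * diagonalTerm μ W x f γ := by
  classical
  have := countable_of_discreteTopology Γ
  have hpos := measureReal_pos (μ := μ) hWo hWc
  have hterm : ∀ (j : ι) (a : Fin (Module.finrank ℂ V)),
      ∫ g, f g * inner ℂ (invariantBasis μ ω hx hWo hWc ⟨j, a⟩ : L2 Γ ω μ)
        (shiftRep hx hWo g (invariantBasis μ ω hx hWo hWc ⟨j, a⟩)) ∂μ =
      ∑' γ : Γ, μ.real W * (f ((x j)⁻¹ * γ * x j) *
        inner ℂ (stdOrthonormalBasis ℂ V a) (ω γ (stdOrthonormalBasis ℂ V a))) := by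
    intro j a
    rw [invariantBasis_apply]
    have hs : ((((Real.sqrt (μ.real (W : Set G)))⁻¹ : ℝ) : ℂ) *
        (((Real.sqrt (μ.real (W : Set G)))⁻¹ : ℝ) : ℂ)) * (μ.real (W : Set G) : ℂ) = 1 := by
      rw [← Complex.ofReal_mul, ← Complex.ofReal_mul, ← mul_inv, Real.mul_self_sqrt hpos.le,
        inv_mul_cancel₀ hpos.ne', Complex.ofReal_one]
    have hr : ∀ z : ℂ, ∀ g, f g * ((((Real.sqrt (μ.real (W : Set G)))⁻¹ : ℝ) : ℂ) *
        ((((Real.sqrt (μ.real (W : Set G)))⁻¹ : ℝ) : ℂ) * z)) =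
        ((((Real.sqrt (μ.real (W : Set G)))⁻¹ : ℝ) : ℂ) *
        (((Real.sqrt (μ.real (W : Set G)))⁻¹ : ℝ) : ℂ)) * (f g * z) := fun z g => by ring
    simp only [map_smul, inner_smul_left, inner_smul_right, Complex.conj_ofReal, hr]
    rw [integral_const_mul, integral_mul_inner_shift hfree hx hWo hWc hf hint, ← mul_assoc, hs,
      one_mul, tsum_mul_left]
  have hsum : ∀ (j : ι) (a : Fin (Module.finrank ℂ V)),
      Summable fun γ : Γ => μ.real W * (f ((x j)⁻¹ * γ * x j) *
        inner ℂ (stdOrthonormalBasis ℂ V a) (ω γ (stdOrthonormalBasis ℂ V a))) := by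
    intro j a
    refine Summable.mul_left _ (Summable.of_norm ?_)
    have h1 : ∑' γ : Γ, ‖f ((x j)⁻¹ * γ * x j)‖ₑ ≠ ∞ := by
      intro htop
      have h2 := hfree.tsum_enorm_le μ hWo
        (fun g k hk => by simpa using hf 1 W.one_mem k hk g) (x j) (x j)
      rw [htop, ENNReal.top_mul (hWo.measure_pos μ ⟨1, W.one_mem⟩).ne'] at h2
      exact absurd (h2.trans_lt hint.2) (lt_irrefl _)
    have h3 : Summable fun γ : Γ => ‖f ((x j)⁻¹ * γ * x j)‖ := by
      simpa using ENNReal.summable_toReal h1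
    refine Summable.of_nonneg_of_le (fun _ => norm_nonneg _) (fun γ => ?_) h3
    rw [norm_mul]
    refine mul_le_of_le_one_right (norm_nonneg _) ((norm_inner_le_norm _ _).trans ?_)
    rw [LinearIsometryEquiv.norm_map, OrthonormalBasis.norm_eq_one, one_mul]
  rw [Fintype.sum_sigma]
  simp only [hterm]
  simp only [← Summable.tsum_finsetSum fun a _ => hsum _ a]
  rw [← Summable.tsum_finsetSum fun j _ => summable_sum fun a _ => hsum j a]
  refine tsum_congr fun γ => ?_
  rw [character, LinearMap.trace_eq_sum_inner _ (stdOrthonormalBasis ℂ V), diagonalTerm,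
    Finset.mul_sum, Finset.mul_sum]
  refine Finset.sum_congr rfl fun j _ => ?_
  rw [Finset.sum_mul]
  refine Finset.sum_congr rfl fun a _ => ?_
  change _ = inner ℂ (stdOrthonormalBasis ℂ V a) (ω γ (stdOrthonormalBasis ℂ V a)) *
    ((μ.real W : ℂ) * _)
  ring

end Trace

/-! ### The trace formula -/

section General

variable {G : Type*} [Group G] [TopologicalSpace G] [IsTopologicalGroup G]
  [LocallyCompactSpace G] [SecondCountableTopology G] [T2Space G] [TotallyDisconnectedSpace G]
  [MeasurableSpace G] [BorelSpace G] (μ : Measure G) [μ.IsHaarMeasure]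
  (Γ : Subgroup G) [DiscreteTopology Γ] [CompactSpace (LeftQuot Γ)]
  {V : Type*} [NormedAddCommGroup V] [InnerProductSpace ℂ V] [FiniteDimensional ℂ V]
  (ω : Γ →* (V ≃ₗᵢ[ℂ] V))

/-- Small compact open subgroups act freely on `Γ \ G`, and so tile `G`. -/
lemma exists_isTiling_subset {U : Subgroup G} (hUo : IsOpen (U : Set G))
    (hUc : IsCompact (U : Set G)) {N : Set G} (hN : N ∈ 𝓝 (1 : G)) :
    ∃ W : Subgroup G, W ≤ U ∧ IsOpen (W : Set G) ∧ IsCompact (W : Set G) ∧ (W : Set G) ⊆ N ∧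
      ActsFreely Γ W ∧ ∃ s : Finset G, IsTiling Γ W (fun i : s => (i : G)) := by
  obtain ⟨W, hWU, hWo, hWc, hWN, hfree⟩ := exists_actsFreely Γ hUo hUc hN
  exact ⟨W, hWU, hWo, hWc, hWN, hfree, hfree.exists_isTiling (exists_finset_cover Γ hWo)⟩

/-- Multiplicities are finite: an irreducible representation is generated by a vector fixed by a
small subgroup `W`, and the space of `W`-invariant functions is finite dimensional. -/
lemma finiteDimensional_intertwiners {U : Subgroup G} (hUo : IsOpen (U : Set G))
    (hUc : IsCompact (U : Set G)) {π : UnitaryRep G} (hπ : π.IsIrreducible) :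
    FiniteDimensional ℂ (intertwiners Γ ω μ π) := by
  have := hπ.1
  obtain ⟨N, hN, hNW⟩ := exists_nhds_fixedVectors_ne_bot μ π
  obtain ⟨W, -, hWo, hWc, hWN, -, s, hx⟩ := exists_isTiling_subset Γ hUo hUc hN
  have := countable_of_discreteTopology Γ
  have := hx.isMulRightInvariant μ hWo hWc
  have := finiteDimensional_fixedVectors_shiftRep (μ := μ) (ω := ω) hx hWo hWc
  rw [intertwiners_eq_homs hx hWo]
  exact finiteDimensional_homs hπ (hNW W hWo hWc hWN)

/-- The trace formula for a cocompact lattice in a totally disconnected locally compact group. -/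
theorem trace_formula (η : ∀ γ : Γ, Measure (Subgroup.centralizer {(γ : G)}))
    [∀ γ, (η γ).IsHaarMeasure] (f : G → ℂ) (hf : Integrable f μ)
    (hlc : UniformlyLocallyConstant f) :
    (∀ π : UnitaryDual G, FiniteDimensional ℂ (intertwiners Γ ω μ π.rep) ∧
      (multiplicity Γ ω μ π.rep ≠ 0 →
        FiniteDimensional ℂ (Submodule.span ℂ (Set.range (π.rep.op μ f))))) ∧
    (Function.support (spectralTerm Γ ω μ f)).Finite ∧
    (∀ γ : Γ, centralizerVolume Γ (γ : G) (η γ) < ∞ ∧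
      Integrable (orbitFunction f (γ : G))
        (quotientMeasure (Subgroup.centralizer {(γ : G)}) μ (η γ))) ∧
    ∀ r : ConjClasses Γ → Γ, (∀ c, ConjClasses.mk (r c) = c) →
      Summable (fun c => ‖geometricTerm Γ ω μ η f (r c)‖) ∧
      ∑ᶠ π, spectralTerm Γ ω μ f π = ∑' c, geometricTerm Γ ω μ η f (r c) := by
  obtain ⟨U, hUo, hUc, hU⟩ := hlc
  obtain ⟨W, hWU, hWo, hWc, -, hfree, s, hx⟩ := exists_isTiling_subset Γ hUo hUc Filter.univ_mem
  have hfW : ∀ u ∈ W, ∀ v ∈ W, ∀ g, f (u * g * v) = f g := fun u hu v hv g =>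
    hU u (hWU hu) v (hWU hv) g
  have hleft : ∀ k ∈ W, ∀ g, f (k * g) = f g := fun k hk g => by
    simpa using hfW k hk 1 W.one_mem g
  have := countable_of_discreteTopology Γ
  have := hx.isMulRightInvariant μ hWo hWc
  have := isInvInvariant_of_isMulRightInvariant μ hWo hWc
  have := completeSpace_L2 (μ := μ) (ω := ω) hx hWo
  have := finiteDimensional_fixedVectors_shiftRep (μ := μ) (ω := ω) hx hWo hWc
  have hspec : spectralTerm Γ ω μ f = fun π : UnitaryDual G =>
      (Module.finrank ℂ (homs (shiftRep (μ := μ) (ω := ω) hx hWo) π.rep) : ℂ) *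
        hilbertTrace (π.rep.op μ f) := funext fun π => by
    rw [spectralTerm, multiplicity, intertwiners_eq_homs hx hWo]
  obtain ⟨hfin, htrace⟩ := spectral_side μ hWo hleft hf
    (invariantBasis μ ω hx hWo hWc)
  rw [hspec]
  refine ⟨fun π => ⟨finiteDimensional_intertwiners μ Γ ω hUo hUc (Quotient.out π).2, fun hne => ?_⟩,
    hfin, fun γ => ⟨(centralizer_quotientMeasures μ hfree hx hWo hWc γ (η γ)).2.2.1,
      (orbitalIntegral_eq μ hx hWo hWc hfW hfree hf γ (η γ)).1⟩, fun r hr => ?_⟩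
  -- a nonzero intertwining map embeds the `W`-fixed vectors of `π` into those of `R`
  · rw [multiplicity, intertwiners_eq_homs hx hWo] at hne
    have hbot : homs (shiftRep (μ := μ) (ω := ω) hx hWo) π.rep ≠ ⊥ := fun h =>
      hne (by rw [h, finrank_bot])
    obtain ⟨T, hT, hT0⟩ := Submodule.exists_mem_ne_zero_of_ne_bot hbot
    have := finiteDimensional_fixedVectors_of_injective (W := W) hT
      (UnitaryRep.IsIrreducible.injective (Quotient.out π).2 hT hT0)
    exact finiteDimensional_span_range_op μ hleft π.rep
  · obtain ⟨hsum, hgeom⟩ := geometric_side μ hx hWo hWc hfW ω hfree hf η r hr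
    exact ⟨hsum, by rw [htrace, hgeom, sum_integral_invariantBasis hfree hx hWo hWc hfW hf]⟩

end General

end TraceFormula

end

theorem proposition1p4
    {F : Type*} [Field F] [ValuativeRel F] [TopologicalSpace F] [IsNonarchimedeanLocalField F]
    {n : ℕ} (𝒢 : Subgroup (GL (Fin n) (AlgebraicClosure F)))
    (halg : TraceFormula.IsLinearAlgebraicGroupOver F 𝒢)
    (hss : TraceFormula.IsSemisimple 𝒢)
    [MeasurableSpace (TraceFormula.rationalPoints F 𝒢)]
    [BorelSpace (TraceFormula.rationalPoints F 𝒢)]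
    (μ : Measure (TraceFormula.rationalPoints F 𝒢)) [μ.IsHaarMeasure]
    (Γ : Subgroup (TraceFormula.rationalPoints F 𝒢)) [DiscreteTopology Γ]
    [CompactSpace (TraceFormula.LeftQuot Γ)]
    {V : Type*} [NormedAddCommGroup V] [InnerProductSpace ℂ V] [FiniteDimensional ℂ V]
    (ω : Γ →* (V ≃ₗᵢ[ℂ] V))
    (η : ∀ γ : Γ,
      Measure (Subgroup.centralizer {(γ : TraceFormula.rationalPoints F 𝒢)}))
    [∀ γ, (η γ).IsHaarMeasure]
    (f : TraceFormula.rationalPoints F 𝒢 → ℂ) (hf : Integrable f μ)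
    (hlc : TraceFormula.UniformlyLocallyConstant f) :
    -- the spectral side is meaningful
    (∀ π : TraceFormula.UnitaryDual (TraceFormula.rationalPoints F 𝒢),
      FiniteDimensional ℂ (TraceFormula.intertwiners Γ ω μ π.rep) ∧
      (TraceFormula.multiplicity Γ ω μ π.rep ≠ 0 →
        FiniteDimensional ℂ (Submodule.span ℂ (Set.range (π.rep.op μ f))))) ∧
    -- and it is a finite sum
    (Function.support (TraceFormula.spectralTerm Γ ω μ f)).Finite ∧
    -- the geometric side is meaningful
    (∀ γ : Γ, TraceFormula.centralizerVolume Γ (γ : TraceFormula.rationalPoints F 𝒢) (η γ) < ∞ ∧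
      Integrable (TraceFormula.orbitFunction f (γ : TraceFormula.rationalPoints F 𝒢))
        (TraceFormula.quotientMeasure
          (Subgroup.centralizer {(γ : TraceFormula.rationalPoints F 𝒢)}) μ (η γ))) ∧
    -- it converges absolutely, and both sides agree
    ∀ r : ConjClasses Γ → Γ, (∀ c, ConjClasses.mk (r c) = c) →
      Summable (fun c => ‖TraceFormula.geometricTerm Γ ω μ η f (r c)‖) ∧
      ∑ᶠ π, TraceFormula.spectralTerm Γ ω μ f π =
        ∑' c, TraceFormula.geometricTerm Γ ω μ η f (r c) := by
  have := TraceFormula.t2Space_localField F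
  have := TraceFormula.totallyDisconnectedSpace_localField F
  have := TraceFormula.secondCountableTopology_localField F
  have := TraceFormula.locallyCompactSpace_GL F n
  have := TraceFormula.secondCountableTopology_GL F n
  have := TraceFormula.totallyDisconnectedSpace_GL F n
  have hcl := (TraceFormula.isClosed_rationalPoints F n 𝒢 halg).isClosedEmbedding_subtypeVal
  have : LocallyCompactSpace (TraceFormula.rationalPoints F 𝒢) := hcl.locallyCompactSpace
  have : SecondCountableTopology (TraceFormula.rationalPoints F 𝒢) :=
    Topology.IsEmbedding.subtypeVal.secondCountableTopology
  exact TraceFormula.trace_formula μ Γ ω η f hf hlc
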